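/- All disks are closed unit disks in the Euclidean plane. A sequence $D_1,\dots,D_n$ ($n\ge 1$) of pairwise disjoint unit disks with centers $c_i=(x_i,y_i)$ is \emph{monotonically separated} if $x_1<\dots<x_n$ and, for all $i<j<k$, $D_k$ is disjoint from $\operatorname{conv}(D_i\cup D_j)$ and $D_i$ is disjoint from $\operatorname{conv}(D_j\cup D_k)$. A \emph{conveyor belt} of the disks is a continuously differentiable simple closed curve (with a regular parametrization) that touches the boundary of every disk, is disjoint from all disk interiors, and consists of finitely many arcs of the disks and bitangent segments between them. It is specified by the cyclic list of its \emph{contacts}: the disks in the order in which the directed belt visits them, each with the side (left or right) of the belt on which it lies. \emph{The winding belt.} The upper convex hull is the part of the boundary of the convex hull of all the disks that runs clockwise from its leftmost to its rightmost point, without these two points. The \emph{upper hull disks} are the disks other than $D_1$ and $D_n$ that contact it; the other disks are the \emph{lower disks} $E_0=D_1,E_1,\dots,E_k=D_n$, listed from left to right. For consecutive lower disks $E=E_{i}$, $E'=E_{i+1}$, the \emph{winding process} starts with a ray on the lower bitangent of $E,E'$ with apex on $E$ and pointing towards $E'$; the \emph{unwinding process} starts with the same ray with its direction reversed. The ray is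 rotated counterclockwise, staying tangent at its apex to the disk that carries the apex. Whenever it becomes tangent to an upper hull disk $U$ between $E$ and $E'$ in the $x$-order (the leftmost such $U$ in case of a tie), the bitangent along the ray is followed to $U$, the apex is shifted to $U$, and the rotation continues around $U$; such shifts come before a tangency to $E'$ that occurs in the same direction. When the ray is tangent to $E'$ for the first time, the path followed so far together with the final bitangent to $E'$ is the \emph{lower} partial belt from $E$ to $E'$; at the second time it is the \emph{upper} one, and the process stops. The winding process gives the partial belts that have $E$ on their left, the unwinding process those that have $E$ on their right; lower partial belts have $E'$ on their left, upper ones have $E'$ on their right. A \emph{winding belt} is obtained by joining partial belts from $E_0$ to $E_1$, from $E_1$ to $E_2$, …, from $E_{k-1}$ to $E_k$ along arcs of the $E_i$, where $E_0$ and $E_k$ are kept on the left and, for $0<i<k$, $E_i$ is kept on the left if the centers of $E_{i-1},E_i,E_{i+1}$ form a left turn, on the right if they form a right turn, and on either side if they are collinear; the belt is closed up by following the upper convex hull from $E_k$ back to $E_0$, with the upper hull disks on the left. \textbf{Theorem.} There are a real RAM program $P$ and a constant $C$ such that, for every $n\ge 1$ and every monotonically separated sequence of $n$ pairwise disjoint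 unit disks, $P$, given $n$ and the coordinates $x_1,y_1,\dots,x_n,y_n$ of the centers in the order of the sequence, halts after at most $Cn$ steps and outputs the cyclic list of contacts of a winding belt, and the closed curve specified by this list is a conveyor belt of the disks. (A real RAM has registers and indirectly addressed memory cells for natural numbers and for real numbers. Each of the following is one step: setting a register to a natural number constant; addition and truncated subtraction of natural numbers; addition, subtraction, multiplication, division and square root of real numbers; loading and storing; jumps, also conditional on a comparison $\le$ of two natural numbers or of two real numbers.) -/

import Mathlib

/-!
The Euclidean plane is `ℂ`: the point `(x, y)` is `x + y i`, and the norm of `ℂ` is the Euclidean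
norm. All disks are closed disks of radius one, given by their centers `c : Fin n → ℂ`.
-/

namespace ConveyorBelt

noncomputable section

/-! ### Configurations of unit disks -/

/-- The closed unit disk with center `z`. -/
def disk (z : ℂ) : Set ℂ := Metric.closedBall z 1

/-- The `x`-coordinates of the centers increase strictly and, for `i < j < k`, the `k`th disk is
disjoint from the convex hull of the `i`th and `j`th disks, and the `i`th disk is disjoint from the
convex hull of the `j`th and `k`th disks. -/
def MonotonicallySeparated {n : ℕ} (c : Fin n → ℂ) : Prop :=
  StrictMono (fun i => (c i).re) ∧
    ∀ i j k : Fin n, i < j → j < k →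
      Disjoint (disk (c k)) (convexHull ℝ (disk (c i) ∪ disk (c j))) ∧
      Disjoint (disk (c i)) (convexHull ℝ (disk (c j) ∪ disk (c k)))

/-- The disks are pairwise disjoint. -/
def DisjointDisks {n : ℕ} (c : Fin n → ℂ) : Prop :=
  ∀ i j : Fin n, i ≠ j → Disjoint (disk (c i)) (disk (c j))

/-! ### Conveyor belts -/

/-- The segment from `p` to `q` is a bitangent of the unit disks with centers `z` and `w`: it is
tangent to the first disk at `p` and to the second disk at `q`. -/
def IsBitangent (z w p q : ℂ) : Prop :=
  p ∈ Metric.sphere z 1 ∧ q ∈ Metric.sphere w 1 ∧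
    inner ℝ (q - p) (p - z) = 0 ∧ inner ℝ (q - p) (q - w) = 0

/-- `γ` is a (regular, `T`-periodic) parametrization of a conveyor belt of the unit disks with
centers `c`: a continuously differentiable simple closed curve that touches the boundary of each
disk, is disjoint from the disk interiors, and is a finite concatenation of arcs of the disks and
bitangents between them. -/
structure IsConveyorBelt {n : ℕ} (c : Fin n → ℂ) (γ : ℝ → ℂ) (T : ℝ) : Prop where
  period_pos : 0 < T
  periodic : Function.Periodic γ T
  contDiff : ContDiff ℝ 1 γ
  regular : ∀ t, deriv γ t ≠ 0
  simple : Set.InjOn γ (Set.Ico 0 T)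
  touches : ∀ i, ∃ t, γ t ∈ Metric.sphere (c i) 1
  avoids : ∀ i t, γ t ∉ Metric.ball (c i) 1
  pieces : ∃ (N : ℕ) (s : ℕ → ℝ), s N = s 0 + T ∧ ∀ k < N, s k ≤ s (k + 1) ∧
    ((∃ i, γ '' Set.Icc (s k) (s (k + 1)) ⊆ Metric.sphere (c i) 1) ∨
      (∃ i j, i ≠ j ∧ IsBitangent (c i) (c j) (γ (s k)) (γ (s (k + 1))) ∧
        γ '' Set.Icc (s k) (s (k + 1)) = segment ℝ (γ (s k)) (γ (s (k + 1)))))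

/-- The side of a directed tangent line (or of a directed curve) on which a disk lies. -/
inductive Side where
  | left
  | right

/-- `1` for the left side and `-1` for the right side. -/
def Side.sign : Side → ℝ
  | .left => 1
  | .right => -1

/-- The unit vector with direction angle `θ`. -/
def dir (θ : ℝ) : ℂ := Complex.exp (θ * Complex.I)

/-- The point at which a directed line of direction angle `θ` touches the unit disk with center `z`
when this disk lies on the side `σ` of the line. (`I * dir θ` is the left unit normal.) -/
def touchPoint (z : ℂ) (σ : Side) (θ : ℝ) : ℂ := z - (σ.sign : ℂ) * (Complex.I * dir θ)

/-- A visit of a belt to a disk: the index of the disk and the side of the directed belt on which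
the disk lies. -/
abbrev Contact (n : ℕ) := Fin n × Side

/-- The closed curve `γ` of length `T`, parametrized by arc length, is the belt specified by the
cyclic list `B` of contacts: it reaches the `j`th contact at time `s j` in the direction `θ j`, runs
along the boundary of that disk through an arc of angle (and length) `δ j`, which brings it to the
direction `θ (j + 1)`, and then follows a line segment of length `l j` in this direction to the next
contact (after the last contact, to the first one, as `γ` is `T`-periodic). -/
def Traces {n : ℕ} (c : Fin n → ℂ) (B : List (Contact n)) (γ : ℝ → ℂ) (T : ℝ) : Prop :=
  Function.Periodic γ T ∧
  ∃ s θ δ l : ℕ → ℝ, s 0 = 0 ∧ s B.length = T ∧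
    ∀ j : Fin B.length,
      0 ≤ δ j ∧ δ j ≤ 2 * Real.pi ∧ 0 ≤ l j ∧
      s (j + 1) = s j + δ j + l j ∧
      θ (j + 1) = θ j + (B.get j).2.sign * δ j ∧
      (∀ t ∈ Set.Icc 0 (δ j),
        γ (s j + t) =
          touchPoint (c (B.get j).1) (B.get j).2 (θ j + (B.get j).2.sign * t)) ∧
      (∀ t ∈ Set.Icc 0 (l j),
        γ (s j + δ j + t) =
          touchPoint (c (B.get j).1) (B.get j).2 (θ (j + 1)) + (t : ℂ) * dir (θ (j + 1)))

/-! ### Upper hull disks -/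

/-- The convex hull of all the disks. -/
def hull {n : ℕ} (c : Fin n → ℂ) : Set ℂ := convexHull ℝ (⋃ i, disk (c i))

/-- The upper convex hull: the part of the boundary of the convex hull that runs clockwise from its
leftmost point to its rightmost point, without these two points. -/
def upperHull {n : ℕ} (c : Fin n → ℂ) : Set ℂ :=
  {p | p ∈ hull c ∧ (∃ q ∈ hull c, q.re < p.re) ∧ (∃ q ∈ hull c, p.re < q.re) ∧
    ∀ q ∈ hull c, q.re = p.re → q.im ≤ p.im}

/-- The disks, other than the first and the last one, that contact the upper convex hull. -/
def IsUpperHullDisk {n : ℕ} (c : Fin n → ℂ) (i : Fin n) : Prop :=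
  (∃ j, j < i) ∧ (∃ k, i < k) ∧ (disk (c i) ∩ upperHull c).Nonempty

open Classical in
/-- The upper hull disks, from left to right. -/
def upperDisks {n : ℕ} (c : Fin n → ℂ) : List (Fin n) :=
  (Finset.univ.filter fun i => IsUpperHullDisk c i).sort (· ≤ ·)

open Classical in
/-- The disks `D₀, …, D_k` that are not upper hull disks, from left to right. -/
def lowerDisks {n : ℕ} (c : Fin n → ℂ) : List (Fin n) :=
  (Finset.univ.filter fun i => ¬ IsUpperHullDisk c i).sort (· ≤ ·)

/-! ### The winding process -/

/-- A ray tangent at its apex to a disk, which lies on the given side of the ray. -/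
structure Ray (n : ℕ) where
  disk : Fin n
  side : Side
  angle : ℝ

/-- The ray after it has been turned around its disk to the direction `θ`. -/
def Ray.turn {n : ℕ} (r : Ray n) (θ : ℝ) : Ray n := ⟨r.disk, r.side, θ⟩

/-- The apex of a ray. -/
def Ray.apex {n : ℕ} (c : Fin n → ℂ) (r : Ray n) : ℂ := touchPoint (c r.disk) r.side r.angle

/-- The ray is tangent to the disk `q`, which lies on its side `τ`. -/
def Ray.TangentTo {n : ℕ} (c : Fin n → ℂ) (r : Ray n) (q : Fin n) (τ : Side) : Prop :=
  ∃ t : ℝ, 0 ≤ t ∧ r.apex c + (t : ℂ) * dir r.angle = touchPoint (c q) τ r.angle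

/-- When the ray `r` is rotated counterclockwise around its disk, it becomes tangent to a disk of
`V` for the first time as `r'`, with its apex shifted to that disk. If it becomes tangent to several
disks of `V` at this moment, the one with the smallest `x`-coordinate, that is, with the smallest
index, is chosen. -/
def NextShift {n : ℕ} (c : Fin n → ℂ) (V : Set (Fin n)) (r r' : Ray n) : Prop :=
  r'.disk ∈ V ∧ r'.disk ≠ r.disk ∧ r.angle ≤ r'.angle ∧
    (r.turn r'.angle).TangentTo c r'.disk r'.side ∧
    (∀ q ∈ V, q ≠ r.disk → ∀ φ ∈ Set.Ico r.angle r'.angle, ∀ τ,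
      ¬ (r.turn φ).TangentTo c q τ) ∧
    (∀ q ∈ V, q ≠ r.disk → ∀ τ, (r.turn r'.angle).TangentTo c q τ → r'.disk ≤ q)

/-- A finite sequence of shifts leads from the first ray to the second one, and the list records
the disks to which the apex is shifted on the way. -/
inductive Shifts {n : ℕ} (c : Fin n → ℂ) (V : Set (Fin n)) :
    Ray n → List (Contact n) → Ray n → Prop
  | nil (r : Ray n) : Shifts c V r [] r
  | cons {r r' r'' : Ray n} {p : List (Contact n)} :
      NextShift c V r r' → Shifts c V r' p r'' → Shifts c V r ((r'.disk, r'.side) :: p) r''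

/-- In the process that starts with the ray `r₀`, and shifts the apex to the disks of `V` as they
are met, the rotating ray is tangent to the disk `e`, on its side `τ`, when its direction is `θ`;
`p` lists the disks to which the apex was shifted until then (shifts that occur at this same
direction come first). -/
def MeetsAt {n : ℕ} (c : Fin n → ℂ) (V : Set (Fin n)) (e : Fin n) (r₀ : Ray n) (θ : ℝ)
    (p : List (Contact n)) (τ : Side) : Prop :=
  ∃ r : Ray n, Shifts c V r₀ p r ∧ r.angle ≤ θ ∧
    (∀ q ∈ V, q ≠ r.disk → ∀ φ ∈ Set.Icc r.angle θ, ∀ τ', ¬ (r.turn φ).TangentTo c q τ') ∧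
    (r.turn θ).TangentTo c e τ

/-- The initial ray of the process from disk `a` to disk `b`. It lies on the line of the lower
bitangent of `a` and `b`, with apex on `a`. For the winding process (`left`) it points towards `b`,
so that `a` is on its left; for the unwinding process (`right`) its direction is reversed, so that
`a` is on its right. -/
def startRay {n : ℕ} (c : Fin n → ℂ) (a b : Fin n) : Side → Ray n
  | .left => ⟨a, .left, Complex.arg (c b - c a)⟩
  | .right => ⟨a, .right, Complex.arg (c b - c a) - Real.pi⟩

/-- The upper hull disks between `a` and `b`. -/
def between {n : ℕ} (c : Fin n → ℂ) (a b : Fin n) : Set (Fin n) :=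
  {u | IsUpperHullDisk c u ∧ a < u ∧ u < b}

/-- `p` lists the contacts, strictly between `a` and `b`, of one of the four partial belts from disk
`a` to disk `b`. The belt leaves `a` on its side `σ`: it is made by the winding process if `a` is on
its left, and by the unwinding process if `a` is on its right. It is the `lower` belt, reported when
the rotating ray is tangent to `b` for the first time, if `b` is to be on its left, and the `upper`
belt, reported at the second time, if `b` is to be on its right. -/
def IsPartialBelt {n : ℕ} (c : Fin n → ℂ) (a : Fin n) (σ : Side) (b : Fin n) (τ : Side)
    (p : List (Contact n)) : Prop :=
  let M := MeetsAt c (between c a b) b (startRay c a b σ)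
  match τ with
  | .left => ∃ θ, M θ p .left ∧ ∀ θ' p' τ', M θ' p' τ' → θ ≤ θ'
  | .right => ∃ θ₁ p₁ τ₁ θ, θ₁ < θ ∧ M θ₁ p₁ τ₁ ∧ M θ p .right ∧
      ∀ θ' p' τ', M θ' p' τ' → θ' = θ₁ ∨ θ ≤ θ'

/-! ### The belt of a monotonically separated sequence -/

/-- The cross product of two plane vectors. -/
def cross (z w : ℂ) : ℝ := z.re * w.im - z.im * w.re

/-- `B` lists the contacts of the concatenation of partial belts through the given disks, where the
disk `a` is kept on the side `σ a`. -/
inductive Chain {n : ℕ} (c : Fin n → ℂ) (σ : Fin n → Side) :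
    List (Fin n) → List (Contact n) → Prop
  | single (a : Fin n) : Chain c σ [a] [(a, σ a)]
  | cons {a b : Fin n} {D : List (Fin n)} {p B : List (Contact n)} :
      IsPartialBelt c a (σ a) b (σ b) p → Chain c σ (b :: D) B →
      Chain c σ (a :: b :: D) ((a, σ a) :: (p ++ B))

/-- The sides on which the belt keeps the lower disks. The first and the last disk are touched on
their lower sides. On every other lower disk `b`, between its neighbors `a` and `d`, the belt has to
contain the arc of `b` outside the convex hulls of `a, b` and of `b, d`: it takes the outer side of
the turn from `a` over `b` to `d`. Both sides are allowed if the three centers are collinear. -/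
def AdmissibleSides {n : ℕ} (c : Fin n → ℂ) (σ : Fin n → Side) : Prop :=
  (∀ i, (∀ j, i ≤ j) → σ i = .left) ∧ (∀ i, (∀ j, j ≤ i) → σ i = .left) ∧
    ∀ a b d, [a, b, d] <:+: lowerDisks c →
      (0 < cross (c b - c a) (c d - c b) → σ b = .left) ∧
      (cross (c b - c a) (c d - c b) < 0 → σ b = .right)

/-- `B` is the cyclic list of contacts, in counterclockwise order, of the belt obtained from the
winding process: the lower disks are joined from left to right by partial belts, and the result is
closed up by the upper convex hull, which is followed from right to left. -/
def IsWindingBelt {n : ℕ} (c : Fin n → ℂ) (B : List (Contact n)) : Prop :=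
  ∃ (σ : Fin n → Side) (A : List (Contact n)), AdmissibleSides c σ ∧
    Chain c σ (lowerDisks c) A ∧
    B = A ++ (upperDisks c).reverse.map fun u => (u, Side.left)

/-! ### The real random access machine -/

/-- Instructions of a real RAM. There are registers and memory cells for natural numbers (used for
indices and addresses) and for real numbers. A letter `d` names a destination register, `a` and `b`
name source registers, and `l` is a line of the program. Only the natural number registers can be
used as addresses of memory cells. -/
inductive Instr where
  | natConst (d k : ℕ)
  | natAdd (d a b : ℕ)
  | natSub (d a b : ℕ)
  | natLoad (d a : ℕ)
  | natStore (a b : ℕ)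
  | realConst (d k : ℕ)
  | realAdd (d a b : ℕ)
  | realSub (d a b : ℕ)
  | realMul (d a b : ℕ)
  | realDiv (d a b : ℕ)
  | realSqrt (d a : ℕ)
  | realLoad (d a : ℕ)
  | realStore (a b : ℕ)
  | jump (l : ℕ)
  | jumpNatLE (a b l : ℕ)
  | jumpRealLE (a b l : ℕ)
  | halt

/-- A program is a finite list of instructions. -/
abbrev Program := List Instr

/-- A state of the machine: the program counter, the registers and the memory. -/
structure State where
  pc : ℕ
  natReg : ℕ → ℕ
  natMem : ℕ → ℕ
  realReg : ℕ → ℝ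
  realMem : ℕ → ℝ

/-- The execution of one instruction. The machine gets stuck (`none`) at `halt`, at a division by
zero and at the square root of a negative number. -/
def Instr.exec (s : State) : Instr → Option State
  | .natConst d k => some { s with
      pc := s.pc + 1, natReg := Function.update s.natReg d k }
  | .natAdd d a b => some { s with
      pc := s.pc + 1, natReg := Function.update s.natReg d (s.natReg a + s.natReg b) }
  | .natSub d a b => some { s with
      pc := s.pc + 1, natReg := Function.update s.natReg d (s.natReg a - s.natReg b) }
  | .natLoad d a => some { s with
      pc := s.pc + 1, natReg := Function.update s.natReg d (s.natMem (s.natReg a)) }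
  | .natStore a b => some { s with
      pc := s.pc + 1, natMem := Function.update s.natMem (s.natReg a) (s.natReg b) }
  | .realConst d k => some { s with
      pc := s.pc + 1, realReg := Function.update s.realReg d (k : ℝ) }
  | .realAdd d a b => some { s with
      pc := s.pc + 1, realReg := Function.update s.realReg d (s.realReg a + s.realReg b) }
  | .realSub d a b => some { s with
      pc := s.pc + 1, realReg := Function.update s.realReg d (s.realReg a - s.realReg b) }
  | .realMul d a b => some { s with
      pc := s.pc + 1, realReg := Function.update s.realReg d (s.realReg a * s.realReg b) }
  | .realDiv d a b =>
      if s.realReg b = 0 then none else some { s with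
        pc := s.pc + 1, realReg := Function.update s.realReg d (s.realReg a / s.realReg b) }
  | .realSqrt d a =>
      if s.realReg a < 0 then none else some { s with
        pc := s.pc + 1, realReg := Function.update s.realReg d (Real.sqrt (s.realReg a)) }
  | .realLoad d a => some { s with
      pc := s.pc + 1, realReg := Function.update s.realReg d (s.realMem (s.natReg a)) }
  | .realStore a b => some { s with
      pc := s.pc + 1, realMem := Function.update s.realMem (s.natReg a) (s.realReg b) }
  | .jump l => some { s with pc := l }
  | .jumpNatLE a b l => some { s with
      pc := if s.natReg a ≤ s.natReg b then l else s.pc + 1 }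
  | .jumpRealLE a b l => some { s with
      pc := if s.realReg a ≤ s.realReg b then l else s.pc + 1 }
  | .halt => none

/-- One step of the machine. -/
def step (P : Program) (s : State) : Option State := P[s.pc]?.bind (Instr.exec s)

/-- The state after `t` steps, if the machine does not get stuck before. -/
def run (P : Program) : ℕ → State → Option State
  | 0, s => some s
  | t + 1, s => (step P s).bind (run P t)

/-- Started in the state `s`, the program reaches a `halt` instruction in the state `s'` after
exactly `t` steps. -/
def HaltsIn (P : Program) (s : State) (t : ℕ) (s' : State) : Prop :=
  run P t s = some s' ∧ P[s'.pc]? = some Instr.halt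

/-- The initial state for the input `c`: the number `n` of disks is in the natural number register
`0`, and the coordinates `x_i, y_i` of the centers, in the order of the sequence, are in the real
memory cells `2 i` and `2 i + 1`. All other registers and cells are zero. -/
def inputState {n : ℕ} (c : Fin n → ℂ) : State where
  pc := 0
  natReg := fun k => if k = 0 then n else 0
  natMem := fun _ => 0
  realReg := fun _ => 0
  realMem := fun k =>
    if h : k / 2 < n then (if k % 2 = 0 then (c ⟨k / 2, h⟩).re else (c ⟨k / 2, h⟩).im) else 0

/-- The code of a side in the output. -/
def Side.code : Side → ℕ
  | .left => 1
  | .right => 0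

/-- The output in the state `s` is the list `B` of contacts: its length is in the natural number
register `0`, and the disk and the side of the `j`th contact are in the natural number memory cells
`2 j` and `2 j + 1`. -/
def HasOutput {n : ℕ} (s : State) (B : List (Contact n)) : Prop :=
  s.natReg 0 = B.length ∧
    ∀ j : Fin B.length,
      s.natMem (2 * j) = (B.get j).1 ∧ s.natMem (2 * j + 1) = (B.get j).2.code

end

end ConveyorBelt

/-! ### Coordinates along a direction, and angles of bitangents. -/

namespace ConveyorBelt
noncomputable section
open Real

/-! ### Rotated coordinates -/

/-! The proof rests on one number per pair of contacts: `tangentDir`, the direction of the bitangent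
from disk `r`, kept on side `ρ`, to disk `q`, kept on side `τ`. It is the chord direction corrected
by an arcsine. Since the centers are ordered by abscissa, chord directions lie in `(-π/2, π/2)` and
bitangent directions to later disks in `(-π, π)`, so they are compared as real numbers without
wraparound. In the coordinates `lon`, `lat` along a direction, a tangency is an equation for `lat`,
and the position before or after a tangency is an inequality for it. Where a disk lies behind the
ray and this test fails, monotone separation closes the case (`two_lt_lat_of_cross_nonpos`).

All disks strictly between two consecutive lower disks lie on the upper hull, so a gap is a concave
chain of centers. Three facts about such chains carry the combinatorics.
`SeparatedSeq.le_tangentDir_iff`: a shift to the disk met first does not change whether a later disk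
is met on its left before or after that shift. `SeparatedSeq.tangentDir_right_le`: a shift only
delays the final tangency that keeps the target on the right.
`SeparatedSeq.not_tangentDir_lt_and_le`: the first disk met is always the next disk or the last one
before the target. The first two make the rotating ray follow a greedy path (`GapPath`,
`GapModel.isPartialBelt`); the third finds each of its contacts by comparing two candidates
(`firstMet`).

The belt is simple for the following reasons. The lower path is taut, that is, it turns towards
every disk it visits (`TautPath`), and it passes below the disks it skips
(`one_lt_dist_of_lt_tangentDir`). Segments over disjoint ranges of indices are far apart by
separation (`not_nearSegment`). Consecutive segments are separated either by a turn of less than `π`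
around their common disk or by the bisector of the angle at its center
(`consecutive_segments_disjoint`, `one_lt_mul_cos`). The lower path lies strictly below all upper
supporting lines, while the way back lies on them (`BelowHull`, `OnHull`), so the two can share a
disk but no point. Integrating the unit tangent yields the curve (`BeltData.exists_curve`).

The algorithm is an incremental hull scan with a stack, a scan from right to left for the lower
disks, a walk along the lower path, and a walk back along the hull predecessors. Directions are
compared through the tangent of the half angle, which is increasing on `(-π, π)` and computable with
one square root. The hull scan is linear by a potential that combines stack depth with the number of
disks left. A small compiler from expressions, commands and loops to machine code turns loop
invariants with decreasing bounds into step counts. -/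

/-- The coordinate of a vector along the direction `φ`. -/
def lon (φ : ℝ) (v : ℂ) : ℝ := v.re * cos φ + v.im * sin φ

/-- The coordinate of a vector along the left normal of the direction `φ`. -/
def lat (φ : ℝ) (v : ℂ) : ℝ := v.im * cos φ - v.re * sin φ

theorem lon_add (φ : ℝ) (v w : ℂ) : lon φ (v + w) = lon φ v + lon φ w := by
  simp [lon]; ring

theorem lat_add (φ : ℝ) (v w : ℂ) : lat φ (v + w) = lat φ v + lat φ w := by
  simp [lat]; ring

theorem lon_sub (φ : ℝ) (v w : ℂ) : lon φ (v - w) = lon φ v - lon φ w := by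
  simp [lon]; ring

theorem lat_sub (φ : ℝ) (v w : ℂ) : lat φ (v - w) = lat φ v - lat φ w := by
  simp [lat]; ring

theorem lon_ofReal_mul (φ r : ℝ) (v : ℂ) : lon φ (r * v) = r * lon φ v := by
  simp [lon]; ring

theorem lat_ofReal_mul (φ r : ℝ) (v : ℂ) : lat φ (r * v) = r * lat φ v := by
  simp [lat]; ring

theorem lon_neg (φ : ℝ) (v : ℂ) : lon φ (-v) = -lon φ v := by
  simp [lon]; ring

theorem lat_neg (φ : ℝ) (v : ℂ) : lat φ (-v) = -lat φ v := by
  simp [lat]; ring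

theorem dir_re (θ : ℝ) : (dir θ).re = cos θ := by
  simp [dir, Complex.exp_ofReal_mul_I_re]

theorem dir_im (θ : ℝ) : (dir θ).im = sin θ := by
  simp [dir, Complex.exp_ofReal_mul_I_im]

theorem norm_dir (θ : ℝ) : ‖dir θ‖ = 1 := by
  simp [dir, Complex.norm_exp_ofReal_mul_I]

theorem lon_dir (φ θ : ℝ) : lon φ (dir θ) = cos (θ - φ) := by
  simp [lon, dir_re, dir_im, cos_sub]

theorem lat_dir (φ θ : ℝ) : lat φ (dir θ) = sin (θ - φ) := by
  simp [lat, dir_re, dir_im, sin_sub]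

theorem lon_sq_add_lat_sq (φ : ℝ) (v : ℂ) : lon φ v ^ 2 + lat φ v ^ 2 = ‖v‖ ^ 2 := by
  rw [Complex.sq_norm, Complex.normSq_apply, lon, lat]
  have := sin_sq_add_cos_sq φ
  linear_combination (v.re ^ 2 + v.im ^ 2) * this

theorem abs_lat_le (φ : ℝ) (v : ℂ) : |lat φ v| ≤ ‖v‖ := by
  apply abs_le_of_sq_le_sq _ (norm_nonneg v)
  nlinarith [lon_sq_add_lat_sq φ v, sq_nonneg (lon φ v)]

theorem eq_of_lon_eq_of_lat_eq {φ : ℝ} {v w : ℂ} (h₁ : lon φ v = lon φ w)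
    (h₂ : lat φ v = lat φ w) : v = w := by
  have h := lon_sq_add_lat_sq φ (v - w)
  rw [lon_sub, lat_sub, h₁, h₂] at h
  have : ‖v - w‖ = 0 := by nlinarith [norm_nonneg (v - w)]
  exact sub_eq_zero.mp (norm_eq_zero.mp this)

theorem cross_eq_lon_lat (φ : ℝ) (v w : ℂ) :
    cross v w = lon φ v * lat φ w - lat φ v * lon φ w := by
  have := sin_sq_add_cos_sq φ
  simp only [cross, lon, lat]
  linear_combination (-(v.re * w.im - v.im * w.re)) * this

theorem lon_eq_norm_mul_cos (φ : ℝ) (v : ℂ) : lon φ v = ‖v‖ * cos (v.arg - φ) := by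
  have h₁ := Complex.norm_mul_cos_arg v
  have h₂ := Complex.norm_mul_sin_arg v
  rw [lon, cos_sub]; linear_combination -cos φ * h₁ - sin φ * h₂

theorem lat_eq_norm_mul_sin (φ : ℝ) (v : ℂ) : lat φ v = ‖v‖ * sin (v.arg - φ) := by
  have h₁ := Complex.norm_mul_cos_arg v
  have h₂ := Complex.norm_mul_sin_arg v
  rw [lat, sin_sub]; linear_combination sin φ * h₁ - cos φ * h₂

theorem lon_touchPoint (φ : ℝ) (z : ℂ) (σ : Side) (θ : ℝ) :
    lon φ (touchPoint z σ θ) = lon φ z + σ.sign * sin (θ - φ) := by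
  simp [lon, touchPoint, dir_re, dir_im, sin_sub]; ring

theorem lat_touchPoint (φ : ℝ) (z : ℂ) (σ : Side) (θ : ℝ) :
    lat φ (touchPoint z σ θ) = lat φ z - σ.sign * cos (θ - φ) := by
  simp [lat, touchPoint, dir_re, dir_im, cos_sub]; ring

theorem Side.sign_left : Side.left.sign = 1 := rfl

theorem Side.sign_right : Side.right.sign = -1 := rfl

theorem Side.sign_sq (σ : Side) : σ.sign * σ.sign = 1 := by cases σ <;> simp [Side.sign]

theorem Side.abs_sign (σ : Side) : |σ.sign| = 1 := by cases σ <;> simp [Side.sign]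

theorem Side.sign_le_one (σ : Side) : σ.sign ≤ 1 := by cases σ <;> norm_num [Side.sign]

theorem Side.neg_one_le_sign (σ : Side) : -1 ≤ σ.sign := by cases σ <;> norm_num [Side.sign]

theorem touchPoint_mem_sphere (z : ℂ) (σ : Side) (θ : ℝ) :
    touchPoint z σ θ ∈ Metric.sphere z 1 := by
  rw [mem_sphere_iff_norm, touchPoint]
  simp only [sub_sub_cancel_left, norm_neg, norm_mul, Complex.norm_real, Complex.norm_I, norm_dir,
    Real.norm_eq_abs, Side.abs_sign, mul_one]

/-! ### Vectors that point to the right -/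

theorem abs_arg_lt {w : ℂ} (h : 0 < w.re) : -(π / 2) < w.arg ∧ w.arg < π / 2 :=
  abs_lt.mp (Complex.abs_arg_lt_pi_div_two_iff.mpr (Or.inl h))

theorem cross_eq_norm_mul_sin (v w : ℂ) : cross v w = ‖v‖ * ‖w‖ * sin (w.arg - v.arg) := by
  rw [cross_eq_lon_lat v.arg, lon_eq_norm_mul_cos, lat_eq_norm_mul_sin, lat_eq_norm_mul_sin v.arg v]
  simp; ring

theorem norm_pos_of_re_pos {w : ℂ} (h : 0 < w.re) : 0 < ‖w‖ :=
  h.trans_le ((le_abs_self _).trans (Complex.abs_re_le_norm w))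

/-- Both arguments lie in `(-π/2, π/2)`, so their difference lies in `(-π, π)`, where the sine has
the sign of its argument. Orientation tests between vectors that point to the right thus become
comparisons of real numbers. -/
theorem cross_nonpos_iff {v w : ℂ} (hv : 0 < v.re) (hw : 0 < w.re) :
    cross v w ≤ 0 ↔ w.arg ≤ v.arg := by
  obtain ⟨a, b⟩ := abs_arg_lt hv
  obtain ⟨c, d⟩ := abs_arg_lt hw
  have h : 0 < ‖v‖ * ‖w‖ := mul_pos (norm_pos_of_re_pos hv) (norm_pos_of_re_pos hw)
  rw [cross_eq_norm_mul_sin]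
  constructor
  · intro h'
    by_contra! hlt
    have := sin_pos_of_pos_of_lt_pi (sub_pos.mpr hlt) (by linarith)
    nlinarith [mul_pos h this]
  · intro h'
    have := sin_nonpos_of_nonpos_of_neg_pi_le (sub_nonpos.mpr h') (by linarith)
    nlinarith

theorem cross_comm (v w : ℂ) : cross v w = -cross w v := by
  simp [cross]; ring

theorem cross_nonneg_iff {v w : ℂ} (hv : 0 < v.re) (hw : 0 < w.re) :
    0 ≤ cross v w ↔ v.arg ≤ w.arg := by
  rw [← cross_nonpos_iff hw hv, cross_comm w v]; simp

theorem cross_neg_iff {v w : ℂ} (hv : 0 < v.re) (hw : 0 < w.re) :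
    cross v w < 0 ↔ w.arg < v.arg := by
  rw [← not_le, cross_nonneg_iff hv hw, not_le]

/-- The direction of a line that touches unit disks on the sides with signs `ρ` and `τ`, where
`k = ρ - τ` and `w` is the vector from the first center to the second one. -/
def bitangentAngle (w : ℂ) (k : ℝ) : ℝ := w.arg + arcsin (k / ‖w‖)

theorem bitangentAngle_zero (w : ℂ) : bitangentAngle w 0 = w.arg := by simp [bitangentAngle]

theorem arcsin_div_mem {w : ℂ} {k : ℝ} (hw : 2 < ‖w‖) (hk : |k| ≤ 2) :
    -(π / 2) < arcsin (k / ‖w‖) ∧ arcsin (k / ‖w‖) < π / 2 := by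
  obtain ⟨h₁, h₂⟩ := abs_le.mp hk
  rw [neg_pi_div_two_lt_arcsin, arcsin_lt_pi_div_two, lt_div_iff₀ (by linarith),
    div_lt_iff₀ (by linarith)]
  constructor <;> linarith

theorem sin_arcsin_div {w : ℂ} {k : ℝ} (hw : 2 < ‖w‖) (hk : |k| ≤ 2) :
    sin (arcsin (k / ‖w‖)) = k / ‖w‖ := by
  obtain ⟨h₁, h₂⟩ := abs_le.mp hk
  apply sin_arcsin
  · rw [le_div_iff₀ (by linarith)]; linarith
  · rw [div_le_iff₀ (by linarith)]; linarith

theorem bitangentAngle_mono {w : ℂ} {k l : ℝ} (h : k ≤ l) :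
    bitangentAngle w k ≤ bitangentAngle w l := by
  unfold bitangentAngle
  gcongr

theorem bitangentAngle_strictMono {w : ℂ} {k l : ℝ} (hw : 2 < ‖w‖) (hk : |k| ≤ 2) (hl : |l| ≤ 2)
    (h : k < l) : bitangentAngle w k < bitangentAngle w l := by
  refine lt_of_le_of_ne (bitangentAngle_mono h.le) fun e => h.ne ?_
  have e' : arcsin (k / ‖w‖) = arcsin (l / ‖w‖) := by
    unfold bitangentAngle at e; linarith
  have := congrArg sin e'
  rw [sin_arcsin_div hw hk, sin_arcsin_div hw hl, div_left_inj' (by linarith)] at this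
  exact this

section
variable {w : ℂ} {k : ℝ}

theorem bitangentAngle_lt_arg_add (hw : 2 < ‖w‖) (hk : |k| ≤ 2) :
    bitangentAngle w k < w.arg + π / 2 := by
  have := (arcsin_div_mem hw hk).2
  unfold bitangentAngle; linarith

theorem arg_sub_lt_bitangentAngle (hw : 2 < ‖w‖) (hk : |k| ≤ 2) :
    w.arg - π / 2 < bitangentAngle w k := by
  have := (arcsin_div_mem hw hk).1
  unfold bitangentAngle; linarith

theorem lat_bitangentAngle (hw : 2 < ‖w‖) (hk : |k| ≤ 2) :
    lat (bitangentAngle w k) w = -k := by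
  rw [lat_eq_norm_mul_sin, bitangentAngle, sub_add_cancel_left, sin_neg, sin_arcsin_div hw hk]
  field_simp

theorem lon_bitangentAngle_pos (hw : 2 < ‖w‖) (hk : |k| ≤ 2) :
    0 < lon (bitangentAngle w k) w := by
  rw [lon_eq_norm_mul_cos, bitangentAngle, sub_add_cancel_left, cos_neg]
  obtain ⟨h₁, h₂⟩ := arcsin_div_mem hw hk
  exact mul_pos (by linarith) (cos_pos_of_mem_Ioo ⟨h₁, h₂⟩)

/-- `lat φ w` is `‖w‖ * sin (w.arg - φ)`, and the sine increases on `[-π/2, π/2]`. The condition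
`h'` keeps the angle in this interval; where it may fail, the target lies behind the ray and a
separate argument is needed. -/
theorem neg_lt_lat_of_lt_bitangentAngle (hw : 2 < ‖w‖) (hk : |k| ≤ 2) {φ : ℝ}
    (h : φ < bitangentAngle w k) (h' : w.arg - φ ≤ π / 2) : -k < lat φ w := by
  obtain ⟨h₁, h₂⟩ := arcsin_div_mem hw hk
  have h₃ : -arcsin (k / ‖w‖) < w.arg - φ := by unfold bitangentAngle at h; linarith
  have := sin_lt_sin_of_lt_of_le_pi_div_two (by linarith) h' h₃
  rw [sin_neg, sin_arcsin_div hw hk] at this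
  rw [lat_eq_norm_mul_sin]
  have h₄ := mul_lt_mul_of_pos_left this (show 0 < ‖w‖ by linarith)
  have : ‖w‖ * -(k / ‖w‖) = -k := by field_simp
  linarith

theorem lat_lt_neg_of_bitangentAngle_lt (hw : 2 < ‖w‖) (hk : |k| ≤ 2) {φ : ℝ}
    (h : bitangentAngle w k < φ) (h' : -(π / 2) ≤ w.arg - φ) : lat φ w < -k := by
  obtain ⟨h₁, h₂⟩ := arcsin_div_mem hw hk
  have h₃ : w.arg - φ < -arcsin (k / ‖w‖) := by unfold bitangentAngle at h; linarith
  have := sin_lt_sin_of_lt_of_le_pi_div_two h' (by linarith) h₃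
  rw [sin_neg, sin_arcsin_div hw hk] at this
  rw [lat_eq_norm_mul_sin]
  have h₄ := mul_lt_mul_of_pos_left this (show 0 < ‖w‖ by linarith)
  have : ‖w‖ * -(k / ‖w‖) = -k := by field_simp
  linarith

theorem neg_le_lat_of_le_bitangentAngle (hw : 2 < ‖w‖) (hk : |k| ≤ 2) {φ : ℝ}
    (h : φ ≤ bitangentAngle w k) (h' : w.arg - φ ≤ π / 2) : -k ≤ lat φ w := by
  rcases h.eq_or_lt with rfl | h
  · rw [lat_bitangentAngle hw hk]
  · exact (neg_lt_lat_of_lt_bitangentAngle hw hk h h').le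

theorem lat_le_neg_of_bitangentAngle_le (hw : 2 < ‖w‖) (hk : |k| ≤ 2) {φ : ℝ}
    (h : bitangentAngle w k ≤ φ) (h' : -(π / 2) ≤ w.arg - φ) : lat φ w ≤ -k := by
  rcases h.eq_or_lt with rfl | h
  · rw [lat_bitangentAngle hw hk]
  · exact (lat_lt_neg_of_bitangentAngle_lt hw hk h h').le

/-- The norm is invariant under rotation, so `lat` and the sign of `lon` fix both coordinates of
`w`, hence the direction up to full turns. The integer `m` has to be kept, because the rotating ray
has a real angle and not an angle modulo `2π`. -/
theorem exists_eq_bitangentAngle_add (hw : 2 < ‖w‖) (hk : |k| ≤ 2) {φ : ℝ}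
    (h : lat φ w = -k) (h' : 0 ≤ lon φ w) : ∃ m : ℤ, φ = bitangentAngle w k + 2 * π * m := by
  have hs : sin φ = sin (bitangentAngle w k) ∧ cos φ = cos (bitangentAngle w k) := by
    have h₀ := lat_bitangentAngle hw hk
    have h₁ := lon_bitangentAngle_pos hw hk
    have e₁ := lon_sq_add_lat_sq φ w
    have e₂ := lon_sq_add_lat_sq (bitangentAngle w k) w
    have e₃ : lon φ w = lon (bitangentAngle w k) w := by
      have e : lon φ w ^ 2 = lon (bitangentAngle w k) w ^ 2 := by
        rw [h] at e₁; rw [h₀] at e₂; linarith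
      exact (sq_eq_sq₀ h' h₁.le).mp e
    rw [← h₀] at h
    set ψ := bitangentAngle w k
    have hn : w.re ^ 2 + w.im ^ 2 = ‖w‖ ^ 2 := by
      rw [Complex.sq_norm, Complex.normSq_apply]; ring
    have hn' : 0 < ‖w‖ ^ 2 := by positivity
    unfold lon at e₃
    unfold lat at h
    constructor
    · have : ‖w‖ ^ 2 * (sin φ - sin ψ) = 0 := by
        rw [← hn]; linear_combination w.im * e₃ - w.re * h
      rcases mul_eq_zero.mp this with h | h <;> linarith
    · have : ‖w‖ ^ 2 * (cos φ - cos ψ) = 0 := by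
        rw [← hn]; linear_combination w.re * e₃ + w.im * h
      rcases mul_eq_zero.mp this with h | h <;> linarith
  have := Real.Angle.cos_sin_inj hs.2 hs.1
  obtain ⟨m, hm⟩ := Real.Angle.angle_eq_iff_two_pi_dvd_sub.mp this
  exact ⟨m, by linarith⟩

end

end
end ConveyorBelt

/-! ### Separated sequences and the order in which tangencies occur. -/

namespace ConveyorBelt
noncomputable section
open Real

/-! ### Separated sequences -/

/-- The unit disks with centers `z 0, …, z (n - 1)` are disjoint and monotonically separated. -/
structure SeparatedSeq (z : ℕ → ℂ) (n : ℕ) : Prop where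
  re_lt : ∀ i j, i < j → j < n → (z i).re < (z j).re
  two_lt : ∀ i j, i < j → j < n → 2 < ‖z j - z i‖
  two_lt_right : ∀ i j k, i < j → j < k → k < n → ∀ t : ℝ, 0 ≤ t → t ≤ 1 →
    2 < ‖((1 - t : ℝ) : ℂ) * (z i - z k) + (t : ℂ) * (z j - z k)‖
  two_lt_left : ∀ i j k, i < j → j < k → k < n → ∀ t : ℝ, 0 ≤ t → t ≤ 1 →
    2 < ‖((1 - t : ℝ) : ℂ) * (z j - z i) + (t : ℂ) * (z k - z i)‖

/-- The path from `z i` over `z j` to `z k` does not turn left. -/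
def Concave (z : ℕ → ℂ) (i j k : ℕ) : Prop := cross (z j - z i) (z k - z j) ≤ 0

/-- The direction of the bitangent from the disk `r`, on its side `ρ`, to the disk `q`, on its
side `τ`. -/
def tangentDir (z : ℕ → ℂ) (r : ℕ) (ρ : Side) (q : ℕ) (τ : Side) : ℝ :=
  bitangentAngle (z q - z r) (ρ.sign - τ.sign)

theorem Side.abs_sub_le (ρ τ : Side) : |ρ.sign - τ.sign| ≤ 2 := by
  rw [abs_le]; cases ρ <;> cases τ <;> norm_num [Side.sign]

theorem tangentDir_left_left (z : ℕ → ℂ) (r q : ℕ) :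
    tangentDir z r .left q .left = (z q - z r).arg := by
  simp [tangentDir, bitangentAngle_zero]

theorem tangentDir_same (z : ℕ → ℂ) (r q : ℕ) (σ : Side) :
    tangentDir z r σ q σ = (z q - z r).arg := by
  simp [tangentDir, bitangentAngle_zero]

theorem tangentDir_left_le (z : ℕ → ℂ) (r q : ℕ) (ρ τ : Side) :
    tangentDir z r ρ q .left ≤ tangentDir z r ρ q τ :=
  bitangentAngle_mono (by linarith [τ.sign_le_one, Side.sign_left])

theorem tangentDir_le_right (z : ℕ → ℂ) (r q : ℕ) (ρ τ : Side) :
    tangentDir z r ρ q τ ≤ tangentDir z r ρ q .right :=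
  bitangentAngle_mono (by linarith [τ.neg_one_le_sign, Side.sign_right])

theorem arg_le_tangentDir_of_left (z : ℕ → ℂ) (r q : ℕ) (τ : Side) :
    (z q - z r).arg ≤ tangentDir z r .left q τ := by
  rw [← tangentDir_left_left]; exact tangentDir_left_le ..

theorem tangentDir_le_arg_of_right (z : ℕ → ℂ) (r q : ℕ) (τ : Side) :
    tangentDir z r .right q τ ≤ (z q - z r).arg := by
  rw [← tangentDir_same z r q .right]; exact tangentDir_le_right ..

theorem tangentDir_to_left_le_arg (z : ℕ → ℂ) (r q : ℕ) (ρ : Side) :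
    tangentDir z r ρ q .left ≤ (z q - z r).arg := by
  rw [← tangentDir_same z r q .left]
  exact bitangentAngle_mono (by linarith [ρ.sign_le_one, Side.sign_left])

theorem arg_le_tangentDir_to_right (z : ℕ → ℂ) (r q : ℕ) (ρ : Side) :
    (z q - z r).arg ≤ tangentDir z r ρ q .right := by
  rw [← tangentDir_same z r q .right]
  exact bitangentAngle_mono (by linarith [ρ.neg_one_le_sign, Side.sign_right])

/-- If a point has distance more than two from a segment whose end lies ahead of it and whose start
lies behind it, in the direction `φ`, and lies to the right of the segment, then the segment passes
at its left at distance more than two. -/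
theorem two_lt_lat_of_cross_nonpos {v w : ℂ} {φ : ℝ}
    (h : ∀ t : ℝ, 0 ≤ t → t ≤ 1 → 2 < ‖((1 - t : ℝ) : ℂ) * v + (t : ℂ) * w‖)
    (hv : lon φ v ≤ 0) (hw : 0 < lon φ w) (hc : cross v w ≤ 0) :
    ¬ (lat φ v ≤ 2 ∧ lat φ w ≤ 2) := by
  rintro ⟨h₁, h₂⟩
  have hd : 0 < lon φ w - lon φ v := by linarith
  -- At this parameter the segment crosses the normal of `φ` through the origin, so the point `u`
  -- there has `lon φ u = 0` and its norm is `|lat φ u|`.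
  set t := -lon φ v / (lon φ w - lon φ v) with ht
  have ht0 : 0 ≤ t := div_nonneg (by linarith) hd.le
  have ht1 : t ≤ 1 := by rw [ht, div_le_one hd]; linarith
  have e : (1 - t) * lon φ v + t * lon φ w = 0 := by
    rw [ht]; field_simp; ring
  have := h t ht0 ht1
  set u := ((1 - t : ℝ) : ℂ) * v + (t : ℂ) * w with hu
  have elon : lon φ u = 0 := by rw [hu, lon_add, lon_ofReal_mul, lon_ofReal_mul, e]
  have elat : lat φ u = (1 - t) * lat φ v + t * lat φ w := by
    rw [hu, lat_add, lat_ofReal_mul, lat_ofReal_mul]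
  have hle : lat φ u ≤ 2 := by rw [elat]; nlinarith
  have hge : 0 ≤ lat φ u := by
    rw [cross_eq_lon_lat φ] at hc
    have : 0 ≤ lon φ w * lat φ u := by
      have : lon φ w * lat φ u = (1 - t) * (lat φ v * lon φ w - lon φ v * lat φ w) := by
        rw [elat]; linear_combination lat φ w * e
      rw [this]; exact mul_nonneg (by linarith) (by linarith)
    exact nonneg_of_mul_nonneg_right this hw
  have := lon_sq_add_lat_sq φ u
  rw [elon] at this
  nlinarith [norm_nonneg u]

namespace SeparatedSeq

variable {z : ℕ → ℂ} {n : ℕ} (S : SeparatedSeq z n)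
include S

theorem re_pos {i j : ℕ} (hij : i < j) (hj : j < n) : 0 < (z j - z i).re := by
  have := S.re_lt i j hij hj
  simp only [Complex.sub_re]; linarith

theorem arg_mem {i j : ℕ} (hij : i < j) (hj : j < n) :
    -(π / 2) < (z j - z i).arg ∧ (z j - z i).arg < π / 2 := abs_arg_lt (S.re_pos hij hj)

/-- The direction of the long chord lies between those of the two short ones. So concavity may be
read off at the middle center, at the first one or at the last one; the two variants below serve
chords with a common start or a common end. -/
theorem concave_iff {i j k : ℕ} (hij : i < j) (hjk : j < k) (hk : k < n) :
    Concave z i j k ↔ (z k - z j).arg ≤ (z j - z i).arg :=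
  cross_nonpos_iff (S.re_pos hij (hjk.trans hk)) (S.re_pos hjk hk)

omit S in
theorem cross_sub_left (i j k : ℕ) :
    cross (z j - z i) (z k - z i) = cross (z j - z i) (z k - z j) := by
  simp [cross]; ring

omit S in
theorem cross_sub_right (i j k : ℕ) :
    cross (z k - z i) (z k - z j) = cross (z j - z i) (z k - z j) := by
  simp [cross]; ring

theorem concave_iff_left {i j k : ℕ} (hij : i < j) (hjk : j < k) (hk : k < n) :
    Concave z i j k ↔ (z k - z i).arg ≤ (z j - z i).arg := by
  rw [Concave, ← cross_sub_left,
    cross_nonpos_iff (S.re_pos hij (hjk.trans hk)) (S.re_pos (hij.trans hjk) hk)]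

theorem concave_iff_right {i j k : ℕ} (hij : i < j) (hjk : j < k) (hk : k < n) :
    Concave z i j k ↔ (z k - z j).arg ≤ (z k - z i).arg := by
  rw [Concave, ← cross_sub_right,
    cross_nonpos_iff (S.re_pos (hij.trans hjk) hk) (S.re_pos hjk hk)]

/-- The chord direction and the arcsine are each less than `π/2` in absolute value. This excludes
wraparound and later permits comparison through half-angle tangents. -/
theorem tangentDir_mem {r q : ℕ} (ρ τ : Side) (h : r < q) (hq : q < n) :
    -π < tangentDir z r ρ q τ ∧ tangentDir z r ρ q τ < π := by
  have h₁ := S.arg_mem h hq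
  have h₂ := bitangentAngle_lt_arg_add (S.two_lt r q h hq) (ρ.abs_sub_le τ)
  have h₃ := arg_sub_lt_bitangentAngle (S.two_lt r q h hq) (ρ.abs_sub_le τ)
  constructor <;> unfold tangentDir <;> linarith

theorem tangentDir_lt {r q : ℕ} (ρ τ : Side) (h : r < q) (hq : q < n) :
    tangentDir z r ρ q τ < (z q - z r).arg + π / 2 :=
  bitangentAngle_lt_arg_add (S.two_lt r q h hq) (ρ.abs_sub_le τ)

theorem lt_tangentDir {r q : ℕ} (ρ τ : Side) (h : r < q) (hq : q < n) :
    (z q - z r).arg - π / 2 < tangentDir z r ρ q τ :=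
  arg_sub_lt_bitangentAngle (S.two_lt r q h hq) (ρ.abs_sub_le τ)

theorem tangentDir_left_lt_right {r q : ℕ} (ρ : Side) (h : r < q) (hq : q < n) :
    tangentDir z r ρ q .left < tangentDir z r ρ q .right :=
  bitangentAngle_strictMono (S.two_lt r q h hq) (ρ.abs_sub_le _) (ρ.abs_sub_le _)
    (by linarith [Side.sign_left, Side.sign_right])

/-- Along the common tangent of `r` and `s`, the disk `b` is met on the left later from `r` if and
only if it is met later from `s`. -/
theorem le_tangentDir_iff {r s b : ℕ} {ρ : Side} (hrs : r < s) (hsb : s < b) (hb : b < n)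
    (hc : Concave z r s b) :
    tangentDir z r ρ s .left ≤ tangentDir z r ρ b .left ↔
      tangentDir z r ρ s .left ≤ tangentDir z s .left b .left := by
  have hs := hsb.trans hb
  have hrb := hrs.trans hsb
  have c₁ := (S.concave_iff_left hrs hsb hb).mp hc
  have c₂ := (S.concave_iff_right hrs hsb hb).mp hc
  have e₁ := lat_bitangentAngle (S.two_lt r s hrs hs) (ρ.abs_sub_le .left)
  have b₁ := S.lt_tangentDir ρ .left hrs hs
  have b₂ := tangentDir_to_left_le_arg z r s ρ
  have b₃ := S.arg_mem hrs hs
  have b₄ := S.arg_mem hsb hb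
  rw [tangentDir_left_left]
  set φ := tangentDir z r ρ s .left with hφ
  change lat φ _ = _ at e₁
  have el : lat φ (z b - z r) = lat φ (z s - z r) + lat φ (z b - z s) := by
    rw [← lat_add]; congr 1; ring
  have es := lat_eq_norm_mul_sin φ (z b - z s)
  have hn : 0 < ‖z b - z s‖ := by linarith [S.two_lt s b hsb hb]
  constructor
  · intro h
    have := neg_le_lat_of_le_bitangentAngle (S.two_lt r b hrb hb) (ρ.abs_sub_le .left) h
      (by linarith)
    by_contra! hlt
    have h' := sin_neg_of_neg_of_neg_pi_lt (x := (z b - z s).arg - φ) (by linarith) (by linarith)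
    nlinarith
  · intro h
    by_contra! hlt
    have := lat_lt_neg_of_bitangentAngle_lt (S.two_lt r b hrb hb) (ρ.abs_sub_le .left) hlt
      (by linarith)
    have h' := sin_nonneg_of_nonneg_of_le_pi (x := (z b - z s).arg - φ) (by linarith) (by linarith)
    nlinarith

/-- A shift to a disk `s` that is met earlier makes the final bitangent, which has the disk `b` on
its right, steeper. -/
theorem tangentDir_right_le {r s b : ℕ} {ρ : Side} (hrs : r < s) (hsb : s < b) (hb : b < n)
    (hc : Concave z r s b) (h : tangentDir z r ρ s .left ≤ tangentDir z r ρ b .right) :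
    tangentDir z r ρ b .right ≤ tangentDir z s .left b .right := by
  have hs := hsb.trans hb
  have hrb := hrs.trans hsb
  have c₁ := (S.concave_iff_left hrs hsb hb).mp hc
  have e₁ := lat_bitangentAngle (S.two_lt r b hrb hb) (ρ.abs_sub_le .right)
  have e₂ := lon_bitangentAngle_pos (S.two_lt r b hrb hb) (ρ.abs_sub_le .right)
  have b₁ := S.tangentDir_lt ρ .right hrb hb
  have b₂ := S.tangentDir_mem ρ .right hrb hb
  have b₃ := S.arg_mem hsb hb
  have b₄ := S.arg_mem hrs hs
  change lat (tangentDir z r ρ b .right) _ = _ at e₁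
  change 0 < lon (tangentDir z r ρ b .right) _ at e₂
  set ψ := tangentDir z r ρ b .right with hψ
  have h₁ := lat_le_neg_of_bitangentAngle_le (S.two_lt r s hrs hs) (ρ.abs_sub_le .left) h
    (by linarith)
  rw [Side.sign_left] at h₁
  rw [Side.sign_right] at e₁
  have el : lat ψ (z b - z r) = lat ψ (z s - z r) + lat ψ (z b - z s) := by
    rw [← lat_add]; congr 1; ring
  -- So far `lat ψ (z b - z s) ≥ -2`. An earlier tangency from `s` would make it less than `-2`,
  -- unless `b` lies behind `s` in direction `ψ`.
  by_contra! hlt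
  rcases le_or_gt (-(π / 2)) ((z b - z s).arg - ψ) with hy | hy
  · have := lat_lt_neg_of_bitangentAngle_lt (S.two_lt s b hsb hb) (Side.abs_sub_le _ _) hlt hy
    rw [Side.sign_left, Side.sign_right] at this
    linarith
  -- If `b` lies behind `s` but ahead of `r`, then the segment from `r` to `s` passes `b` at lateral
  -- distance at most two, against separation.
  · have hlon : lon ψ (z b - z s) < 0 := by
      rw [lon_eq_norm_mul_cos]
      have hn : 0 < ‖z b - z s‖ := by linarith [S.two_lt s b hsb hb]
      have : cos (ψ - (z b - z s).arg) < 0 :=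
        cos_neg_of_pi_div_two_lt_of_lt (by linarith) (by linarith)
      rw [← cos_neg, neg_sub] at this
      nlinarith
    refine two_lt_lat_of_cross_nonpos (φ := ψ) (S.two_lt_right r s b hrs hsb hb) ?_ ?_ ?_ ⟨?_, ?_⟩
    · rw [← neg_sub, lon_neg]; linarith
    · rw [← neg_sub, lon_neg]; linarith
    · have : cross (z r - z b) (z s - z b) = cross (z s - z r) (z b - z s) := by
        simp [cross]; ring
      rw [this]; exact hc
    · rw [← neg_sub, lat_neg]; linarith [ρ.sign_le_one]
    · rw [← neg_sub, lat_neg]; linarith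

/-- Among the disks of a concave chain, one of the first and the last is met first. -/
theorem not_tangentDir_lt_and_le {r f j m : ℕ} {ρ : Side} (hrf : r < f) (hfj : f < j) (hjm : j < m)
    (hm : m < n) (h₁ : Concave z r f j) (h₂ : Concave z f j m) (h₃ : Concave z r j m) :
    ¬ (tangentDir z r ρ j .left < tangentDir z r ρ f .left ∧
      tangentDir z r ρ j .left ≤ tangentDir z r ρ m .left) := by
  rintro ⟨lf, lm⟩
  have hj := hjm.trans hm
  have hf := hfj.trans hj
  have hrj := hrf.trans hfj
  have hrm := hrj.trans hjm
  have hfm := hfj.trans hjm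
  cases ρ with
  | left =>
    rw [tangentDir_left_left, tangentDir_left_left] at lf lm
    -- With `r` on the left all directions are chord directions. A strict right turn at `f` lowers
    -- the edge from `f` to `j` strictly below the chord from `r` to `j`; by concavity the edge from
    -- `j` to `m` is as low, so `m` is seen below `j`.
    have s₁ : cross (z f - z r) (z j - z f) < 0 := by
      rw [← cross_sub_left]; exact (cross_neg_iff (S.re_pos hrf hf) (S.re_pos hrj hj)).mpr lf
    rw [← cross_sub_right, cross_neg_iff (S.re_pos hrj hj) (S.re_pos hfj hj)] at s₁
    have s₂ := (S.concave_iff hfj hjm hm).mp h₂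
    have s₃ : cross (z j - z r) (z m - z j) < 0 :=
      (cross_neg_iff (S.re_pos hrj hj) (S.re_pos hjm hm)).mpr (by linarith)
    rw [← cross_sub_left, cross_neg_iff (S.re_pos hrj hj) (S.re_pos hrm hm)] at s₃
    linarith
  | right =>
    have c₁ := (S.concave_iff_left hrf hfj hj).mp h₁
    have c₁' := (S.concave_iff_right hrf hfj hj).mp h₁
    have c₂ := (S.concave_iff hfj hjm hm).mp h₂
    have c₃ := (S.concave_iff_left hrj hjm hm).mp h₃
    have c₃' := (S.concave_iff_right hrj hjm hm).mp h₃
    have e₁ := lat_bitangentAngle (S.two_lt r j hrj hj) (Side.right.abs_sub_le .left)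
    have e₂ := lon_bitangentAngle_pos (S.two_lt r j hrj hj) (Side.right.abs_sub_le .left)
    have b₁ := S.lt_tangentDir .right .left hrj hj
    have b₂ := tangentDir_le_arg_of_right z r j .left
    have b₃ := S.tangentDir_mem .right .left hrj hj
    have a₁ := S.arg_mem hrj hj
    have a₂ := S.arg_mem hjm hm
    have a₃ := S.arg_mem hrf hf
    have a₄ := S.arg_mem hfj hj
    change lat (tangentDir z r .right j .left) _ = _ at e₁
    change 0 < lon (tangentDir z r .right j .left) _ at e₂
    set φ := tangentDir z r .right j .left
    have l₁ := neg_le_lat_of_le_bitangentAngle (S.two_lt r m hrm hm) (Side.right.abs_sub_le .left)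
      lm (by linarith)
    rw [Side.sign_left, Side.sign_right] at l₁ e₁
    -- Here `lat φ (z j - z r) = 2`. By `lm` the edge from `j` to `m` does not descend relative to
    -- `φ`, hence by concavity neither does the edge from `f` to `j`, and `f` has height at most
    -- two. Since `f` has not been met yet, it should be higher.
    have el : lat φ (z m - z r) = lat φ (z j - z r) + lat φ (z m - z j) := by
      rw [← lat_add]; congr 1; ring
    have el' : lat φ (z j - z r) = lat φ (z f - z r) + lat φ (z j - z f) := by
      rw [← lat_add]; congr 1; ring
    have y₁ : φ ≤ (z m - z j).arg := by
      by_contra! hlt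
      have h' := sin_neg_of_neg_of_neg_pi_lt (x := (z m - z j).arg - φ) (by linarith) (by linarith)
      have es := lat_eq_norm_mul_sin φ (z m - z j)
      have hn : 0 < ‖z m - z j‖ := by linarith [S.two_lt j m hjm hm]
      nlinarith
    have y₂ : 0 ≤ lat φ (z j - z f) := by
      rw [lat_eq_norm_mul_sin]
      exact mul_nonneg (norm_nonneg _) (sin_nonneg_of_nonneg_of_le_pi (by linarith) (by linarith))
    rcases le_or_gt ((z f - z r).arg - φ) (π / 2) with hx | hx
    · have := neg_lt_lat_of_lt_bitangentAngle (S.two_lt r f hrf hf) (Side.right.abs_sub_le .left)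
        lf hx
      rw [Side.sign_left, Side.sign_right] at this
      linarith
    -- Now `f` lies behind `r` and `j` ahead of it, so the segment between them passes too close to
    -- `r`.
    · refine two_lt_lat_of_cross_nonpos (φ := φ) (S.two_lt_left r f j hrf hfj hj) ?_ e₂ ?_
        ⟨by linarith, by linarith⟩
      · rw [lon_eq_norm_mul_cos]
        have := cos_neg_of_pi_div_two_lt_of_lt hx (by linarith)
        nlinarith [norm_nonneg (z f - z r)]
      · rw [cross_sub_left]; exact h₁

/-- A ray in a direction before the first tangency to the disk `j` on its left misses that disk. -/
theorem one_lt_dist_of_lt_tangentDir {r j : ℕ} {ρ : Side} {θ t : ℝ} (hrj : r < j) (hj : j < n)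
    (h : θ < tangentDir z r ρ j .left) (hθ : -π < θ) (ht : 0 ≤ t) :
    1 < ‖touchPoint (z r) ρ θ + (t : ℂ) * dir θ - z j‖ := by
  set p := touchPoint (z r) ρ θ + (t : ℂ) * dir θ
  have d₀ := S.two_lt r j hrj hj
  have a₀ := S.arg_mem hrj hj
  have e₁ : lon θ (p - z j) = t - lon θ (z j - z r) := by
    simp only [p, lon_sub, lon_add, lon_touchPoint, lon_ofReal_mul, lon_dir, sub_self, sin_zero,
      cos_zero]; ring
  have e₂ : lat θ (p - z j) = -ρ.sign - lat θ (z j - z r) := by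
    simp only [p, lat_sub, lat_add, lat_touchPoint, lat_ofReal_mul, lat_dir, sub_self, sin_zero,
      cos_zero]; ring
  rcases le_or_gt ((z j - z r).arg - θ) (π / 2) with hx | hx
  · have h₁ := neg_lt_lat_of_lt_bitangentAngle d₀ (ρ.abs_sub_le .left) h hx
    rw [Side.sign_left] at h₁
    have := abs_le.mp (abs_lat_le θ (p - z j))
    linarith
  -- The disk lies behind the apex, and the ray runs away from it. Every point of the ray then has
  -- distance at least `‖z j - z r‖ - 1` from `z j`, which exceeds one.
  · have hl : lon θ (z j - z r) ≤ 0 := by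
      rw [lon_eq_norm_mul_cos]
      have := cos_neg_of_pi_div_two_lt_of_lt hx (by linarith)
      nlinarith [norm_nonneg (z j - z r)]
    have q₁ := lon_sq_add_lat_sq θ (p - z j)
    have q₂ := lon_sq_add_lat_sq θ (z j - z r)
    have q₃ := abs_le.mp (abs_lat_le θ (z j - z r))
    rw [e₁, e₂] at q₁
    have q₄ : -‖z j - z r‖ ≤ ρ.sign * lat θ (z j - z r) := by
      cases ρ <;> simp only [Side.sign] <;> linarith
    have q₅ := ρ.sign_sq
    have : 1 < ‖p - z j‖ ^ 2 := by nlinarith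
    nlinarith [norm_nonneg (p - z j)]

end SeparatedSeq

end
end ConveyorBelt

/-! ### The winding and unwinding processes follow greedy paths. -/

namespace ConveyorBelt
noncomputable section
open Real

/-! ### Greedy paths below a concave chain -/

/-- The contacts of the path that leaves the disk `r`, on its side `ρ`, is pulled tight below the
disks between `r` and `b`, and ends at the disk `b`, on its side `τ`. -/
inductive GapPath (z : ℕ → ℂ) (b : ℕ) (τ : Side) : ℕ → Side → List (ℕ × Side) → Prop
  | final {r : ℕ} {ρ : Side} : r < b →
      (∀ j, r < j → j < b → tangentDir z r ρ b τ < tangentDir z r ρ j .left) →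
      GapPath z b τ r ρ []
  | shift {r u : ℕ} {ρ : Side} {p : List (ℕ × Side)} : r < u → u < b →
      (∀ j, r < j → j < u → tangentDir z r ρ u .left < tangentDir z r ρ j .left) →
      (∀ j, u < j → j < b → tangentDir z r ρ u .left ≤ tangentDir z r ρ j .left) →
      tangentDir z r ρ u .left ≤ tangentDir z r ρ b τ →
      GapPath z b τ u .left p → GapPath z b τ r ρ ((u, .left) :: p)

/-- The disks from `a` to `b` form a concave chain. -/
structure ConcaveGap (z : ℕ → ℂ) (n a b : ℕ) : Prop where
  sep : SeparatedSeq z n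
  lt : a < b
  lt_size : b < n
  concave : ∀ i j k, a ≤ i → i < j → j < k → k ≤ b → Concave z i j k

/-- The invariants of a ray of the winding or unwinding process from `a` to `b`. -/
structure ProcessState (z : ℕ → ℂ) (a b : ℕ) (τ : Side) (r : ℕ) (ρ : Side) (φ : ℝ) : Prop where
  le : a ≤ r
  lt : r < b
  lower : ∀ j, r < j → j ≤ b → tangentDir z r ρ j .right - 2 * π < φ
  behind : ∀ j, a < j → j < r → (z r - z j).arg - π / 2 < φ
  ahead : ∀ j, r < j → j < b → φ ≤ tangentDir z r ρ j .left
  target : φ ≤ tangentDir z r ρ b τ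
  side : a < r → ρ = .left

section

variable {z : ℕ → ℂ} {n a b : ℕ} {τ : Side}

/-- A shift never jumps past a tangency: what is met from `r` no earlier than `u` is met from `u` no
earlier than the shift. For tangencies on the left this is `le_tangentDir_iff`, for a final tangency
on the right `tangentDir_right_le`. -/
theorem ConcaveGap.shift_le (G : ConcaveGap z n a b) {r u : ℕ} {ρ : Side} (har : a ≤ r)
    (hru : r < u) (hub : u < b)
    (hl : ∀ j, u < j → j < b → tangentDir z r ρ u .left ≤ tangentDir z r ρ j .left)
    (hb : tangentDir z r ρ u .left ≤ tangentDir z r ρ b τ) :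
    (∀ j, u < j → j < b → tangentDir z r ρ u .left ≤ tangentDir z u .left j .left) ∧
      tangentDir z r ρ u .left ≤ tangentDir z u .left b τ := by
  have S := G.sep
  refine ⟨fun j hj hjb => ?_, ?_⟩
  · exact (S.le_tangentDir_iff hru hj (hjb.trans G.lt_size)
      (G.concave r u j har hru hj hjb.le)).mp (hl j hj hjb)
  · have hc := G.concave r u b har hru hub le_rfl
    cases τ with
    | left => exact (S.le_tangentDir_iff hru hub G.lt_size hc).mp hb
    | right => exact hb.trans (S.tangentDir_right_le hru hub G.lt_size hc hb)

/-- The clauses on disks ahead come from `shift_le`. For those left behind, concavity orders the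
chord directions: into `u` they are no steeper from `j` than the chord into the previous apex, so
the old bound carries over as the angle grows. -/
theorem ConcaveGap.processState_shift (G : ConcaveGap z n a b) {r u : ℕ} {ρ : Side} {φ : ℝ}
    (P : ProcessState z a b τ r ρ φ) (hru : r < u) (hub : u < b)
    (hl : ∀ j, u < j → j < b → tangentDir z r ρ u .left ≤ tangentDir z r ρ j .left)
    (hb : tangentDir z r ρ u .left ≤ tangentDir z r ρ b τ) :
    ProcessState z a b τ u .left (tangentDir z r ρ u .left) := by
  have S := G.sep
  have hn := G.lt_size
  obtain ⟨h₁, h₂⟩ := G.shift_le P.le hru hub hl hb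
  refine ⟨P.le.trans hru.le, hub, fun j hj hjb => ?_, fun j hj hju => ?_, h₁, h₂, fun _ => rfl⟩
  · have := S.tangentDir_mem .left .right hj (hjb.trans_lt hn)
    have := S.tangentDir_mem ρ .left hru (hub.trans hn)
    linarith
  · have hφ := P.ahead u hru hub
    have hlt := S.lt_tangentDir ρ .left hru (hub.trans hn)
    rcases lt_trichotomy j r with h | rfl | h
    · have := (S.concave_iff_right h hru (hub.trans hn)).mp
        (G.concave j r u hj.le h hru hub.le)
      have h₃ := (S.concave_iff h hru (hub.trans hn)).mp
        (G.concave j r u hj.le h hru hub.le)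
      have h₄ := (S.concave_iff_left h hru (hub.trans hn)).mp
        (G.concave j r u hj.le h hru hub.le)
      have := P.behind j hj h
      linarith
    · exact hlt
    · have := (S.concave_iff_right h hju (hub.trans hn)).mp
        (G.concave r j u P.le h hju hub.le)
      linarith

/-- The factor `(1 - σ.sign) / 2` is `0` for winding and `1` for unwinding, so both start rays are
covered. Concavity puts the disks of the gap on or above the chord from `a` to `b`, hence the
starting angle precedes their tangencies. -/
theorem ConcaveGap.processState_start (G : ConcaveGap z n a b) (σ τ : Side) :
    ProcessState z a b τ a σ ((z b - z a).arg - (1 - σ.sign) / 2 * π) := by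
  have S := G.sep
  have hn := G.lt_size
  have hab := S.arg_mem G.lt hn
  have hc : ∀ j, a < j → j < b → (z b - z a).arg ≤ (z j - z a).arg := fun j h₁ h₂ =>
    (S.concave_iff_left h₁ h₂ hn).mp (G.concave a j b le_rfl h₁ h₂ le_rfl)
  refine ⟨le_rfl, G.lt, fun j hj hjb => ?_, fun j h₁ h₂ => absurd h₁ h₂.not_gt,
    fun j hj hjb => ?_, ?_, fun h => absurd h (lt_irrefl a)⟩
  · have h₁ := S.arg_mem hj (hjb.trans_lt hn)
    cases σ with
    | left =>
      have := S.tangentDir_mem .left .right hj (hjb.trans_lt hn)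
      rw [Side.sign_left]; linarith
    | right =>
      rw [Side.sign_right, tangentDir_same]; linarith
  · have h₁ := hc j hj hjb
    have h₂ := S.lt_tangentDir σ .left hj (hjb.trans hn)
    cases σ with
    | left => rw [Side.sign_left, tangentDir_same]; linarith
    | right => rw [Side.sign_right]; linarith [pi_pos]
  · have h₂ := S.lt_tangentDir σ τ G.lt hn
    cases σ with
    | left => rw [Side.sign_left]; linarith [arg_le_tangentDir_of_left z a b τ]
    | right => rw [Side.sign_right]; linarith [pi_pos]

/-! ### Tangencies of the rotating ray -/

/-- A disk left of the apex lies strictly behind the ray, by the clause `behind` and the upper bound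
on `ψ`. A disk right of it is tangent only at a bitangent angle plus a multiple of `2π`: negative
multiples are excluded by `lower`, the others because the first tangency has not been reached. -/
theorem ConcaveGap.not_tangent (G : ConcaveGap z n a b) {r j : ℕ} {ρ : Side} {φ ψ : ℝ}
    (P : ProcessState z a b τ r ρ φ) (hφ : φ ≤ ψ) (hb : ψ ≤ tangentDir z r ρ b τ) (haj : a < j)
    (hjb : j < b) (hjr : j ≠ r) (hj : r < j → ψ < tangentDir z r ρ j .left) (τ' : Side) :
    ¬ (lat ψ (z j - z r) = τ'.sign - ρ.sign ∧ 0 ≤ lon ψ (z j - z r)) := by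
  have S := G.sep
  have hn := G.lt_size
  rintro ⟨h₁, h₂⟩
  rcases hjr.lt_or_gt with h | h
  · have hr := P.lt.trans hn
    have hρ := P.side (haj.trans h)
    have e := P.behind j haj h
    have hc := G.concave j r b haj.le h P.lt le_rfl
    have c₁ := (S.concave_iff h P.lt hn).mp hc
    have e₂ := S.tangentDir_lt ρ τ P.lt hn
    have hpos : 0 < lon ψ (z r - z j) := by
      rw [lon_eq_norm_mul_cos]
      exact mul_pos (by linarith [S.two_lt j r h hr])
        (cos_pos_of_mem_Ioo ⟨by linarith, by linarith⟩)
    rw [← neg_sub, lon_neg] at h₂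
    linarith
  · have hj' := hj h
    obtain ⟨m, hm⟩ := exists_eq_bitangentAngle_add (k := ρ.sign - τ'.sign)
      (S.two_lt r j h (hjb.trans hn)) (ρ.abs_sub_le τ') (by linarith) h₂
    have e₁ := P.lower j h hjb.le
    have e₂ := tangentDir_left_le z r j ρ τ'
    have e₃ := tangentDir_le_right z r j ρ τ'
    change ψ = tangentDir z r ρ j τ' + 2 * π * m at hm
    have hp := pi_pos
    rcases le_or_gt 0 m with hm0 | hm0
    · have : (0 : ℝ) ≤ m := by exact_mod_cast hm0
      nlinarith
    · have : (m : ℝ) ≤ -1 := by exact_mod_cast Int.le_sub_one_of_lt hm0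
      nlinarith

/-- Tangencies of a former turn are excluded by `lower`, and those of a later turn come after every
angle in `(-π, π)`. So only the tangencies of the current turn occur before the right one. -/
theorem ConcaveGap.eq_or_le_of_tangent (G : ConcaveGap z n a b) {r : ℕ} {ρ τ' : Side} {φ ψ : ℝ}
    (P : ProcessState z a b τ r ρ φ) (hφ : φ ≤ ψ)
    (h : lat ψ (z b - z r) = τ'.sign - ρ.sign ∧ 0 ≤ lon ψ (z b - z r)) :
    ψ = tangentDir z r ρ b τ' ∨ tangentDir z r ρ b .right ≤ ψ := by
  have S := G.sep
  have hn := G.lt_size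
  obtain ⟨m, hm⟩ := exists_eq_bitangentAngle_add (k := ρ.sign - τ'.sign)
    (S.two_lt r b P.lt hn) (ρ.abs_sub_le τ') (by linarith) h.2
  have e₁ := P.lower b P.lt le_rfl
  have e₂ := S.tangentDir_mem ρ τ' P.lt hn
  have e₃ := tangentDir_le_right z r b ρ τ'
  have e₄ := S.tangentDir_mem ρ .right P.lt hn
  change ψ = tangentDir z r ρ b τ' + 2 * π * m at hm
  have hp := pi_pos
  rcases lt_trichotomy m 0 with hm0 | rfl | hm0
  · have : (m : ℝ) ≤ -1 := by exact_mod_cast Int.le_sub_one_of_lt hm0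
    nlinarith
  · left; simpa using hm
  · right
    have : (1 : ℝ) ≤ m := by exact_mod_cast hm0
    nlinarith

end

/-- Both coordinates along `φ` are compared: the lateral one gives the equation, and the
longitudinal one shows that the parameter on the ray must be `lon φ (c q - c x)`. -/
theorem Ray.tangentTo_iff {n : ℕ} (c : Fin n → ℂ) (x q : Fin n) (ρ τ : Side) (φ : ℝ) :
    (Ray.mk x ρ φ).TangentTo c q τ ↔
      lat φ (c q - c x) = τ.sign - ρ.sign ∧ 0 ≤ lon φ (c q - c x) := by
  constructor
  · rintro ⟨t, ht, h⟩
    have h₁ := congrArg (lat φ) h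
    have h₂ := congrArg (lon φ) h
    simp only [Ray.apex, lat_add, lon_add, lat_touchPoint, lon_touchPoint, lat_ofReal_mul,
      lon_ofReal_mul, lat_dir, lon_dir, sub_self, sin_zero, cos_zero] at h₁ h₂
    rw [lat_sub, lon_sub]
    constructor <;> linarith
  · rintro ⟨h₁, h₂⟩
    refine ⟨_, h₂, eq_of_lon_eq_of_lat_eq (φ := φ) ?_ ?_⟩
    · simp only [Ray.apex, lon_add, lon_touchPoint, lon_sub,
        lon_ofReal_mul, lon_dir, sub_self, sin_zero, cos_zero]
      ring
    · rw [lat_sub] at h₁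
      simp only [Ray.apex, lat_add, lat_touchPoint, lat_ofReal_mul, lat_dir, sub_self, sin_zero,
        cos_zero]
      linarith

theorem Shifts.angle_le {n : ℕ} {c : Fin n → ℂ} {V : Set (Fin n)} {r r' : Ray n}
    {p : List (Contact n)} (h : Shifts c V r p r') : r.angle ≤ r'.angle := by
  induction h with
  | nil => exact le_rfl
  | cons h _ ih => exact h.2.2.1.trans ih

theorem MeetsAt.angle_le {n : ℕ} {c : Fin n → ℂ} {V : Set (Fin n)} {e : Fin n} {r : Ray n}
    {θ : ℝ} {p : List (Contact n)} {τ : Side} (h : MeetsAt c V e r θ p τ) : r.angle ≤ θ := by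
  obtain ⟨r', h₁, h₂, -⟩ := h
  exact h₁.angle_le.trans h₂

theorem MeetsAt.cons {n : ℕ} {c : Fin n → ℂ} {V : Set (Fin n)} {e : Fin n} {r r' : Ray n}
    {θ : ℝ} {p : List (Contact n)} {τ : Side} (h : NextShift c V r r')
    (h' : MeetsAt c V e r' θ p τ) : MeetsAt c V e r θ ((r'.disk, r'.side) :: p) τ := by
  obtain ⟨r'', h₁, h₂⟩ := h'
  exact ⟨r'', .cons h h₁, h₂⟩

/-- A meeting either occurs at the first ray or after a shift. -/
theorem MeetsAt.cases_shift {n : ℕ} {c : Fin n → ℂ} {V : Set (Fin n)} {e : Fin n} {r : Ray n}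
    {θ : ℝ} {p : List (Contact n)} {τ : Side} (h : MeetsAt c V e r θ p τ) :
    (r.angle ≤ θ ∧ (∀ q ∈ V, q ≠ r.disk → ∀ φ ∈ Set.Icc r.angle θ, ∀ τ',
      ¬ (r.turn φ).TangentTo c q τ') ∧ (r.turn θ).TangentTo c e τ) ∨
    ∃ r' p', NextShift c V r r' ∧ MeetsAt c V e r' θ p' τ := by
  obtain ⟨r'', h₁, h₂⟩ := h
  cases h₁ with
  | nil => exact Or.inl h₂
  | cons h h' => exact Or.inr ⟨_, _, h, _, h', h₂⟩

/-- The disks of a concave gap as disks with indices in `Fin n`. -/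
structure GapModel {n : ℕ} (c : Fin n → ℂ) (z : ℕ → ℂ) (F : ℕ → Fin n) (V : Set (Fin n))
    (a b : ℕ) : Prop where
  gap : ConcaveGap z n a b
  center : ∀ q : Fin n, c q = z q
  val : ∀ i, i < n → (F i : ℕ) = i
  mem : ∀ q : Fin n, q ∈ V ↔ a < q ∧ (q : ℕ) < b

section

variable {n : ℕ} {c : Fin n → ℂ} {z : ℕ → ℂ} {F : ℕ → Fin n} {V : Set (Fin n)} {a b : ℕ}
  {τ ρ : Side} {r u : ℕ} {φ : ℝ}

theorem GapModel.center_eq (M : GapModel c z F V a b) {i : ℕ} (hi : i < n) : c (F i) = z i := by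
  rw [M.center, M.val i hi]

theorem GapModel.not_tangentTo (M : GapModel c z F V a b) (P : ProcessState z a b τ r ρ φ)
    {q : Fin n} (hq : q ∈ V) (hqr : q ≠ F r) {ψ : ℝ} (hφ : φ ≤ ψ)
    (hψ : ψ ≤ tangentDir z r ρ b τ) (hj : r < (q : ℕ) → ψ < tangentDir z r ρ q .left)
    (τ' : Side) : ¬ (Ray.mk (F r) ρ ψ).TangentTo c q τ' := by
  have hr : r < n := P.lt.trans M.gap.lt_size
  rw [Ray.tangentTo_iff, M.center_eq hr, M.center]
  obtain ⟨h₁, h₂⟩ := (M.mem q).mp hq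
  refine M.gap.not_tangent P hφ hψ h₁ h₂ (fun e => hqr ?_) hj τ'
  exact Fin.ext (by rw [e, M.val r hr])

theorem GapModel.tangentTo (M : GapModel c z F V a b) (hru : r < u) (hu : u < n) (τ' : Side) :
    (Ray.mk (F r) ρ (tangentDir z r ρ u τ')).TangentTo c (F u) τ' := by
  rw [Ray.tangentTo_iff, M.center_eq hu, M.center_eq (hru.trans hu)]
  have S := M.gap.sep
  exact ⟨(lat_bitangentAngle (S.two_lt r u hru hu) (ρ.abs_sub_le τ')).trans (neg_sub _ _),
    (lon_bitangentAngle_pos (S.two_lt r u hru hu) (ρ.abs_sub_le τ')).le⟩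

theorem GapModel.eq_or_le (M : GapModel c z F V a b) (P : ProcessState z a b τ r ρ φ) {ψ : ℝ}
    {τ' : Side} (hφ : φ ≤ ψ) (h : (Ray.mk (F r) ρ ψ).TangentTo c (F b) τ') :
    ψ = tangentDir z r ρ b τ' ∨ tangentDir z r ρ b .right ≤ ψ := by
  have hr : r < n := P.lt.trans M.gap.lt_size
  rw [Ray.tangentTo_iff, M.center_eq hr, M.center_eq M.gap.lt_size] at h
  exact M.gap.eq_or_le_of_tangent P hφ h

/-- This makes the process deterministic along a greedy path. The inequalities to the left of `u`
are strict, so among simultaneous tangencies `u` has the smallest index, which is the tie rule of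
`NextShift`. -/
theorem GapModel.nextShift_iff (M : GapModel c z F V a b) (P : ProcessState z a b τ r ρ φ)
    (hru : r < u) (hub : u < b)
    (h₁ : ∀ j, r < j → j < u → tangentDir z r ρ u .left < tangentDir z r ρ j .left)
    (h₂ : ∀ j, u < j → j < b → tangentDir z r ρ u .left ≤ tangentDir z r ρ j .left)
    (h₃ : tangentDir z r ρ u .left ≤ tangentDir z r ρ b τ) {r' : Ray n} :
    NextShift c V ⟨F r, ρ, φ⟩ r' ↔ r' = ⟨F u, .left, tangentDir z r ρ u .left⟩ := by
  have hn := M.gap.lt_size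
  have hr : r < n := P.lt.trans hn
  have hu : u < n := hub.trans hn
  have hru' : F u ≠ F r := fun e => by
    have := congrArg Fin.val e
    rw [M.val u hu, M.val r hr] at this
    omega
  have huV : F u ∈ V := (M.mem _).mpr (by
    rw [M.val u hu]; exact ⟨P.le.trans_lt hru, hub⟩)
  have hT : (Ray.mk (F r) ρ (tangentDir z r ρ u .left)).TangentTo c (F u) .left :=
    M.tangentTo hru hu .left
  have hle : ∀ q ∈ V, q ≠ F r → r < (q : ℕ) →
      tangentDir z r ρ u .left ≤ tangentDir z r ρ q .left := by
    intro q hq _ hrq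
    obtain ⟨-, hqb⟩ := (M.mem q).mp hq
    rcases lt_trichotomy (q : ℕ) u with h | h | h
    · exact (h₁ q hrq h).le
    · rw [h]
    · exact h₂ q h hqb
  have hmin : ∀ q ∈ V, q ≠ F r → ∀ τ',
      (Ray.mk (F r) ρ (tangentDir z r ρ u .left)).TangentTo c q τ' → F u ≤ q := by
    intro q hq hqr τ' h
    by_contra! hlt
    have hlt' : (q : ℕ) < u := by rw [← M.val u hu]; exact hlt
    exact M.not_tangentTo P hq hqr (P.ahead u hru hub) h₃ (fun h => h₁ q h hlt') τ' h
  have hfree : ∀ q ∈ V, q ≠ F r → ∀ ψ ∈ Set.Ico φ (tangentDir z r ρ u .left), ∀ τ',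
      ¬ (Ray.mk (F r) ρ ψ).TangentTo c q τ' := fun q hq hqr ψ hψ τ' =>
    M.not_tangentTo P hq hqr hψ.1 (hψ.2.le.trans h₃) (fun h => hψ.2.trans_le (hle q hq hqr h)) τ'
  constructor
  · rintro ⟨k₁, k₂, k₃, k₄, k₅, k₆⟩
    obtain ⟨q, s, ψ⟩ := r'
    dsimp only at k₁ k₂ k₃ k₄ k₅ k₆
    have hψ : ψ = tangentDir z r ρ u .left := by
      rcases lt_trichotomy ψ (tangentDir z r ρ u .left) with h | h | h
      · exact absurd k₄ (hfree q k₁ k₂ ψ ⟨k₃, h⟩ s)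
      · exact h
      · exact absurd hT (k₅ (F u) huV hru' _ ⟨P.ahead u hru hub, h⟩ .left)
    subst hψ
    have hq : q = F u := le_antisymm (k₆ (F u) huV hru' .left hT) (hmin q k₁ k₂ s k₄)
    subst hq
    have : s = .left := by
      have e₁ := ((Ray.tangentTo_iff ..).mp hT).1
      have e₂ := ((Ray.tangentTo_iff ..).mp k₄).1
      rw [e₁] at e₂
      cases s with
      | left => rfl
      | right => rw [Side.sign_left, Side.sign_right] at e₂; linarith
    rw [this]
  · rintro rfl
    exact ⟨huV, hru', P.ahead u hru hub, hT, hfree, hmin⟩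

theorem GapModel.lt_of_nextShift (M : GapModel c z F V a b) (P : ProcessState z a b τ r ρ φ)
    (h : ∀ j, r < j → j < b → tangentDir z r ρ b τ < tangentDir z r ρ j .left) {r' : Ray n}
    (hs : NextShift c V ⟨F r, ρ, φ⟩ r') : tangentDir z r ρ b τ < r'.angle := by
  by_contra! hle
  obtain ⟨k₁, k₂, k₃, k₄, -⟩ := hs
  exact M.not_tangentTo P k₁ k₂ k₃ hle
    (fun hr => hle.trans_lt (h _ hr ((M.mem _).mp k₁).2)) _ k₄

/-- The contacts of a path with indices in `Fin n`. -/
def finContacts {n : ℕ} (F : ℕ → Fin n) (p : List (ℕ × Side)) : List (Contact n) :=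
  p.map fun x => (F x.1, x.2)

/-- The condition `h` says that, for a target on the right, the left tangency to `b` is already
past. The first meeting from here on is then the one in demand, so the same induction serves lower
belts and the second half of upper ones. -/
theorem GapModel.exists_meetsAt (M : GapModel c z F V a b) {p : List (ℕ × Side)}
    (hp : GapPath z b τ r ρ p) (P : ProcessState z a b τ r ρ φ)
    (h : τ = .right → tangentDir z r ρ b .left < φ) :
    ∃ θ, φ ≤ θ ∧ MeetsAt c V (F b) ⟨F r, ρ, φ⟩ θ (finContacts F p) τ ∧
      ∀ θ' p' τ', MeetsAt c V (F b) ⟨F r, ρ, φ⟩ θ' p' τ' → θ ≤ θ' := by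
  have hn := M.gap.lt_size
  induction hp generalizing φ with
  | @final r ρ hrb hfinal =>
    refine ⟨tangentDir z r ρ b τ, P.target, ⟨_, .nil _, P.target, ?_, M.tangentTo hrb hn τ⟩, ?_⟩
    · intro q hq hqr ψ hψ τ'
      exact M.not_tangentTo P hq hqr hψ.1 hψ.2
        (fun hr => hψ.2.trans_lt (hfinal q hr ((M.mem q).mp hq).2)) τ'
    · intro θ' p' τ' hM
      rcases hM.cases_shift with ⟨k₁, -, k₃⟩ | ⟨r', p'', k₁, k₂⟩
      · rcases M.eq_or_le P k₁ k₃ with e | e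
        · cases τ with
          | left => rw [e]; exact tangentDir_left_le z r b ρ τ'
          | right =>
            cases τ' with
            | left => have := h rfl; rw [← e] at this; exact absurd k₁ this.not_ge
            | right => exact e.ge
        · exact (tangentDir_le_right z r b ρ τ).trans e
      · exact (M.lt_of_nextShift P hfinal k₁).le.trans k₂.angle_le
  | @shift r u ρ p hru hub h₁ h₂ h₃ hp ih =>
    have P' := M.gap.processState_shift P hru hub h₂ h₃
    have hφ := P.ahead u hru hub
    -- Seen from `u`, the left tangency to `b` is past as well, by `le_tangentDir_iff`.
    obtain ⟨θ, i₁, i₂, i₃⟩ := ih P' (fun hτ => by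
      have := (h hτ).trans_le hφ
      by_contra! hle
      exact absurd ((M.gap.sep.le_tangentDir_iff hru hub hn
        (M.gap.concave r u b P.le hru hub le_rfl)).mpr hle) this.not_ge)
    have hN := (M.nextShift_iff P hru hub h₁ h₂ h₃).mpr rfl
    refine ⟨θ, hφ.trans i₁, i₂.cons hN, ?_⟩
    intro θ' p' τ' hM
    rcases hM.cases_shift with ⟨k₁, k₂, k₃⟩ | ⟨r', p'', k₁, k₂⟩
    · have hlt : θ' < tangentDir z r ρ u .left := by
        by_contra! hle
        exact k₂ _ hN.1 hN.2.1 _ ⟨hφ, hle⟩ _ hN.2.2.2.1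
      have hR := h₃.trans (tangentDir_le_right z r b ρ τ)
      rcases M.eq_or_le P k₁ k₃ with e | e
      · cases τ with
        | left => have := tangentDir_left_le z r b ρ τ'; linarith
        | right =>
          cases τ' with
          | left => have := h rfl; rw [← e] at this; exact absurd k₁ this.not_ge
          | right => linarith
      · linarith
    · rw [M.nextShift_iff P hru hub h₁ h₂ h₃] at k₁
      subst k₁
      exact i₃ θ' p'' τ' k₂

/-- As long as the left tangency to `b` lies ahead, it moves along with the shifts. The first shift
that occurs after it hands over to `exists_meetsAt`; the greedy path itself is not affected by this
first meeting. -/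
theorem GapModel.exists_meetsAt_twice (M : GapModel c z F V a b) {p : List (ℕ × Side)}
    (hp : GapPath z b .right r ρ p) (P : ProcessState z a b .right r ρ φ)
    (h : φ ≤ tangentDir z r ρ b .left) :
    ∃ θ₁ p₁ θ, θ₁ < θ ∧ MeetsAt c V (F b) ⟨F r, ρ, φ⟩ θ₁ p₁ .left ∧
      MeetsAt c V (F b) ⟨F r, ρ, φ⟩ θ (finContacts F p) .right ∧
      ∀ θ' p' τ', MeetsAt c V (F b) ⟨F r, ρ, φ⟩ θ' p' τ' → θ' = θ₁ ∨ θ ≤ θ' := by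
  have hn := M.gap.lt_size
  induction hp generalizing φ with
  | @final r ρ hrb hfinal =>
    have hLR := M.gap.sep.tangentDir_left_lt_right ρ hrb hn
    have hfree : ∀ q ∈ V, q ≠ F r → ∀ ψ, φ ≤ ψ → ψ ≤ tangentDir z r ρ b .right → ∀ τ',
        ¬ (Ray.mk (F r) ρ ψ).TangentTo c q τ' := fun q hq hqr ψ hψ hψ' τ' =>
      M.not_tangentTo P hq hqr hψ hψ'
        (fun hr => hψ'.trans_lt (hfinal q hr ((M.mem q).mp hq).2)) τ'
    refine ⟨tangentDir z r ρ b .left, [], tangentDir z r ρ b .right, hLR,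
      ⟨_, .nil _, h, fun q hq hqr ψ hψ τ' => hfree q hq hqr ψ hψ.1 (hψ.2.trans hLR.le) τ',
        M.tangentTo hrb hn .left⟩,
      ⟨_, .nil _, P.target, fun q hq hqr ψ hψ τ' => hfree q hq hqr ψ hψ.1 hψ.2 τ',
        M.tangentTo hrb hn .right⟩, ?_⟩
    intro θ' p' τ' hM
    rcases hM.cases_shift with ⟨k₁, -, k₃⟩ | ⟨r', p'', k₁, k₂⟩
    · rcases M.eq_or_le P k₁ k₃ with e | e
      · cases τ' with
        | left => exact Or.inl e
        | right => exact Or.inr e.ge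
      · exact Or.inr e
    · exact Or.inr ((M.lt_of_nextShift P hfinal k₁).le.trans k₂.angle_le)
  | @shift r u ρ p hru hub h₁ h₂ h₃ hp ih =>
    have P' := M.gap.processState_shift P hru hub h₂ h₃
    have hφ := P.ahead u hru hub
    have hN := (M.nextShift_iff P hru hub h₁ h₂ h₃).mpr rfl
    have hiff := M.gap.sep.le_tangentDir_iff (ρ := ρ) hru hub hn
      (M.gap.concave r u b P.le hru hub le_rfl)
    have hfirst : ∀ θ' p' τ', MeetsAt c V (F b) ⟨F r, ρ, φ⟩ θ' p' τ' →
        (θ' < tangentDir z r ρ u .left ∧ θ' = tangentDir z r ρ b .left) ∨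
        ∃ p'', MeetsAt c V (F b) ⟨F u, .left, tangentDir z r ρ u .left⟩ θ' p'' τ' := by
      intro θ' p' τ' hM
      rcases hM.cases_shift with ⟨k₁, k₂, k₃⟩ | ⟨r', p'', k₁, k₂⟩
      · have hlt : θ' < tangentDir z r ρ u .left := by
          by_contra! hle
          exact k₂ _ hN.1 hN.2.1 _ ⟨hφ, hle⟩ _ hN.2.2.2.1
        rcases M.eq_or_le P k₁ k₃ with e | e
        · cases τ' with
          | left => exact Or.inl ⟨hlt, e⟩
          | right => linarith
        · linarith
      · rw [M.nextShift_iff P hru hub h₁ h₂ h₃] at k₁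
        subst k₁
        exact Or.inr ⟨p'', k₂⟩
    -- Either the first meeting with `b` precedes the shift to `u`, and no shift is recorded for it,
    -- or the shift comes first and both meetings happen after it.
    rcases lt_or_ge (tangentDir z r ρ b .left) (tangentDir z r ρ u .left) with hlt | hge
    · obtain ⟨θ, i₁, i₂, i₃⟩ := M.exists_meetsAt hp P' (fun _ => by
        by_contra! hle
        exact absurd (hiff.mpr hle) hlt.not_ge)
      refine ⟨tangentDir z r ρ b .left, [], θ, hlt.trans_le i₁, ⟨_, .nil _, h, ?_,
        M.tangentTo P.lt hn .left⟩, i₂.cons hN, ?_⟩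
      · intro q hq hqr ψ hψ τ'
        exact hN.2.2.2.2.1 q hq hqr ψ ⟨hψ.1, hψ.2.trans_lt hlt⟩ τ'
      · intro θ' p' τ' hM
        rcases hfirst θ' p' τ' hM with ⟨-, e⟩ | ⟨p'', h'⟩
        · exact Or.inl e
        · exact Or.inr (i₃ θ' p'' τ' h')
    · obtain ⟨θ₁, p₁, θ, i₁, i₂, i₃, i₄⟩ := ih P' (hiff.mp hge)
      refine ⟨θ₁, _, θ, i₁, i₂.cons hN, i₃.cons hN, ?_⟩
      intro θ' p' τ' hM
      rcases hfirst θ' p' τ' hM with ⟨e, e'⟩ | ⟨p'', h'⟩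
      · linarith
      · exact i₄ θ' p'' τ' h'

/-- The greedy path lists the contacts of a partial belt. -/
theorem GapModel.isPartialBelt {a b : ℕ} {σ τ : Side} {p : List (ℕ × Side)}
    (M : GapModel c z F (between c (F a) (F b)) a b) (hp : GapPath z b τ a σ p) :
    IsPartialBelt c (F a) σ (F b) τ (finContacts F p) := by
  have hn := M.gap.lt_size
  have hR : startRay c (F a) (F b) σ =
      ⟨F a, σ, (z b - z a).arg - (1 - σ.sign) / 2 * π⟩ := by
    cases σ <;> simp only [startRay, M.center_eq hn, M.center_eq (M.gap.lt.trans hn),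
      Side.sign_left, Side.sign_right, Ray.mk.injEq, true_and] <;> ring
  have P := M.gap.processState_start σ τ
  unfold IsPartialBelt
  rw [hR]
  cases τ with
  | left =>
    obtain ⟨θ, -, h₂, h₃⟩ := M.exists_meetsAt hp P (by simp)
    exact ⟨θ, h₂, h₃⟩
  | right =>
    obtain ⟨θ₁, p₁, θ, h⟩ := M.exists_meetsAt_twice hp P
      (M.gap.processState_start σ .left).target
    exact ⟨θ₁, p₁, .left, θ, h⟩

end

end
end ConveyorBelt

/-! ### Hull indices, supporting lines and the upper hull of the disks. -/

namespace ConveyorBelt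
noncomputable section
open Real

/-! ### The upper hull of a separated sequence -/

/-- The center `z i` lies on the upper convex hull of the centers. -/
def HullIndex (z : ℕ → ℂ) (n i : ℕ) : Prop :=
  ∀ a k, a < i → i < k → k < n → Concave z a i k

/-- The index of a lower disk. -/
def LowIndex (z : ℕ → ℂ) (n i : ℕ) : Prop := i = 0 ∨ i + 1 = n ∨ ¬ HullIndex z n i

/-- The centers `z p` and `z i` are consecutive on the upper convex hull. -/
structure HullStep (z : ℕ → ℂ) (n p i : ℕ) : Prop where
  lt : p < i
  lt_size : i < n
  left : HullIndex z n p
  right : HullIndex z n i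
  not_between : ∀ j, p < j → j < i → ¬ HullIndex z n j

/-- The center `z i` is extremal above a line of direction `s`. -/
structure Supports (z : ℕ → ℂ) (n : ℕ) (s : ℝ) (i : ℕ) : Prop where
  neg_lt : -(π / 2) < s
  lt : s < π / 2
  le : ∀ j, j < n → lat s (z j) ≤ lat s (z i)

theorem lat_nonpos_iff {w : ℂ} {s : ℝ} (hw : 0 < w.re) (h₁ : -(π / 2) < s) (h₂ : s < π / 2) :
    lat s w ≤ 0 ↔ w.arg ≤ s := by
  obtain ⟨a, b⟩ := abs_arg_lt hw
  have hn := norm_pos_of_re_pos hw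
  rw [lat_eq_norm_mul_sin]
  constructor
  · intro h
    by_contra! hlt
    have := sin_pos_of_pos_of_lt_pi (sub_pos.mpr hlt) (by linarith)
    nlinarith
  · intro h
    have := sin_nonpos_of_nonpos_of_neg_pi_le (sub_nonpos.mpr h) (by linarith)
    nlinarith

theorem lat_nonneg_iff {w : ℂ} {s : ℝ} (hw : 0 < w.re) (h₁ : -(π / 2) < s) (h₂ : s < π / 2) :
    0 ≤ lat s w ↔ s ≤ w.arg := by
  obtain ⟨a, b⟩ := abs_arg_lt hw
  have hn := norm_pos_of_re_pos hw
  rw [lat_eq_norm_mul_sin]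
  constructor
  · intro h
    by_contra! hlt
    have := sin_neg_of_neg_of_neg_pi_lt (sub_neg.mpr hlt) (by linarith)
    nlinarith
  · intro h
    have := sin_nonneg_of_nonneg_of_le_pi (sub_nonneg.mpr h) (by linarith)
    nlinarith

theorem lat_arg_self (w : ℂ) : lat w.arg w = 0 := by
  rw [lat_eq_norm_mul_sin]; simp

section
variable {z : ℕ → ℂ} {n : ℕ}

theorem Supports.arg_le (S : SeparatedSeq z n) {s : ℝ} {i j : ℕ} (h : Supports z n s i)
    (hij : i < j) (hj : j < n) : (z j - z i).arg ≤ s := by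
  rw [← lat_nonpos_iff (S.re_pos hij hj) h.neg_lt h.lt, lat_sub]
  linarith [h.le j hj]

theorem Supports.le_arg (S : SeparatedSeq z n) {s : ℝ} {i j : ℕ} (h : Supports z n s i)
    (hij : j < i) (hi : i < n) : s ≤ (z i - z j).arg := by
  rw [← lat_nonneg_iff (S.re_pos hij hi) h.neg_lt h.lt, lat_sub]
  linarith [h.le j (hij.trans hi)]

theorem supports_of_arg (S : SeparatedSeq z n) {s : ℝ} {i : ℕ} (hi : i < n) (h₁ : -(π / 2) < s)
    (h₂ : s < π / 2) (h₃ : ∀ j, i < j → j < n → (z j - z i).arg ≤ s)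
    (h₄ : ∀ j, j < i → s ≤ (z i - z j).arg) : Supports z n s i := by
  refine ⟨h₁, h₂, fun j hj => ?_⟩
  rcases lt_trichotomy i j with h | rfl | h
  · have := (lat_nonpos_iff (S.re_pos h hj) h₁ h₂).mpr (h₃ j h hj)
    rw [lat_sub] at this; linarith
  · exact le_rfl
  · have := (lat_nonneg_iff (S.re_pos h hi) h₁ h₂).mpr (h₄ j h)
    rw [lat_sub] at this; linarith

/-- A line of an intermediate direction supports the same center. -/
theorem Supports.between (S : SeparatedSeq z n) {s t u : ℝ} {i : ℕ} (hi : i < n)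
    (hs : Supports z n s i) (hu : Supports z n u i) (hst : s ≤ t) (htu : t ≤ u) :
    Supports z n t i :=
  supports_of_arg S hi (hs.neg_lt.trans_le hst) (htu.trans_lt hu.lt)
    (fun _ h₁ h₂ => (hs.arg_le S h₁ h₂).trans hst) (fun _ h => htu.trans (hu.le_arg S h hi))

/-- The supporting direction separates the directions of the chords that arrive at `i` from those of
the chords that leave it. -/
theorem Supports.hullIndex (S : SeparatedSeq z n) {s : ℝ} {i : ℕ} (h : Supports z n s i) :
    HullIndex z n i := fun _ _ ha hk hkn =>
  (S.concave_iff ha hk hkn).mpr ((h.arg_le S hk hkn).trans (h.le_arg S ha (hk.trans hkn)))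

theorem Supports.of_le {s : ℝ} {i j : ℕ} (h : Supports z n s i)
    (hij : lat s (z i) ≤ lat s (z j)) : Supports z n s j :=
  ⟨h.neg_lt, h.lt, fun k hk => (h.le k hk).trans hij⟩

theorem hullIndex_zero : HullIndex z n 0 := fun _ _ h => absurd h (Nat.not_lt_zero _)

theorem hullIndex_last : HullIndex z n (n - 1) := fun _ _ _ h₁ h₂ => by omega

/-- Let `j` be extremal for the direction of the step. It is a hull index, so it does not lie
strictly between `p` and `i`; outside, concavity at `p` or at `i` shows that it is not above the
line through both. Hence `i` is extremal too. -/
theorem HullStep.supports_right (S : SeparatedSeq z n) {p i : ℕ} (h : HullStep z n p i) :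
    Supports z n (z i - z p).arg i := by
  obtain ⟨hpi, hi, hp, hi', hno⟩ := h
  have hpn := hpi.trans hi
  obtain ⟨a₁, a₂⟩ := S.arg_mem hpi hi
  set s := (z i - z p).arg with hs
  obtain ⟨j, hj, hmax⟩ := Finset.exists_max_image (Finset.range n) (fun j => lat s (z j))
    ⟨i, Finset.mem_range.mpr hi⟩
  rw [Finset.mem_range] at hj
  have hS : Supports z n s j := ⟨a₁, a₂, fun k hk => hmax k (Finset.mem_range.mpr hk)⟩
  have e : lat s (z i) = lat s (z p) := by
    have := lat_arg_self (z i - z p)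
    rw [← hs, lat_sub] at this; linarith
  refine hS.of_le ?_
  rcases le_or_gt j p with h | h
  · rw [e]
    rcases h.eq_or_lt with rfl | h
    · exact le_rfl
    · have := (lat_nonneg_iff (S.re_pos h hpn) a₁ a₂).mpr
        ((S.concave_iff h hpi hi).mp (hp j i h hpi hi))
      rw [lat_sub] at this; linarith
  · rcases lt_or_ge j i with h' | h'
    · exact absurd (hS.hullIndex S) (hno j h h')
    · rcases h'.eq_or_lt with rfl | h'
      · exact le_rfl
      · have := (lat_nonpos_iff (S.re_pos h' hj) a₁ a₂).mpr
          ((S.concave_iff hpi h' hj).mp (hi' p j hpi h' hj))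
        rw [lat_sub] at this; linarith

theorem HullStep.supports_left (S : SeparatedSeq z n) {p i : ℕ} (h : HullStep z n p i) :
    Supports z n (z i - z p).arg p := by
  refine (h.supports_right S).of_le ?_
  have := lat_arg_self (z i - z p)
  rw [lat_sub] at this; linarith

/-- The steepest direction to a later center works, because concavity at `i` makes every chord from
an earlier center at least as steep. The bound on `i` guarantees that a later center exists. -/
theorem HullIndex.exists_supports (S : SeparatedSeq z n) {i : ℕ} (h : HullIndex z n i)
    (hi : i + 1 < n) : ∃ s, Supports z n s i := by
  obtain ⟨k, hk, hmax⟩ := Finset.exists_max_image (Finset.Ioo i n) (fun j => (z j - z i).arg)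
    ⟨i + 1, Finset.mem_Ioo.mpr ⟨i.lt_succ_self, hi⟩⟩
  rw [Finset.mem_Ioo] at hk
  obtain ⟨a₁, a₂⟩ := S.arg_mem hk.1 hk.2
  refine ⟨_, supports_of_arg S (by omega) a₁ a₂
    (fun j h₁ h₂ => hmax j (Finset.mem_Ioo.mpr ⟨h₁, h₂⟩))
    (fun j hj => (S.concave_iff hj hk.1 hk.2).mp (h j k hj hk.1 hk.2))⟩

/-! ### The incremental hull -/

/-- The center `z a` precedes `z i` on the upper convex hull of the centers up to `z i`. -/
structure HullPred (z : ℕ → ℂ) (a i : ℕ) : Prop where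
  lt : a < i
  between : ∀ j, a < j → j < i → ¬ Concave z a j i
  before : ∀ j, j < a → Concave z j a i

/-- A center strictly below the chord from `a` to `i` violates the hull condition, so none lies
between. That `a` is a hull index follows by comparing the chord from `a` to any later center with
the chord to `i`. -/
theorem HullPred.hullStep (S : SeparatedSeq z n) {a i : ℕ} (h : HullPred z a i) (hi : i < n)
    (hH : HullIndex z n i) : HullStep z n a i := by
  refine ⟨h.lt, hi, fun j l hj hl hln => ?_, hH, fun j h₁ h₂ hj => h.between j h₁ h₂
    (hj a i h₁ h₂ hi)⟩
  have e := (S.concave_iff hj h.lt hi).mp (h.before j hj)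
  rw [S.concave_iff hj hl hln]
  rcases lt_trichotomy l i with hli | rfl | hli
  · have := h.between l hl hli
    rw [S.concave_iff_left hl hli hi, not_le] at this
    linarith
  · exact e
  · have := hH a l h.lt hli hln
    rw [S.concave_iff_left h.lt hli hln] at this
    linarith

/-- This is the pop of the hull scan. If `t` is strictly below the chord from `p` to `i`, so is
everything that was strictly below the edge from `p` to `t` or the chord from `t` to `i`. -/
theorem HullPred.not_concave_of_not_concave (S : SeparatedSeq z n) {p t i : ℕ}
    (h : HullPred z p t) (hti : t < i) (hi : i < n) (ht : ∀ j, t < j → j < i → ¬ Concave z t j i)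
    (hc : ¬ Concave z p t i) : ∀ j, p < j → j < i → ¬ Concave z p j i := by
  intro j hpj hji
  rcases lt_trichotomy j t with hjt | rfl | hjt
  · have h₁ := h.between j hpj hjt
    rw [S.concave_iff_left hpj hjt (hti.trans hi), not_le] at h₁
    rw [S.concave_iff_left h.lt hti hi, not_le] at hc
    rw [S.concave_iff_left hpj hji hi, not_le]
    exact h₁.trans hc
  · exact hc
  · have h₁ := ht j hjt hji
    rw [S.concave_iff_right hjt hji hi, not_le] at h₁
    rw [S.concave_iff_right h.lt hti hi, not_le] at hc
    rw [S.concave_iff_right hpj hji hi, not_le]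
    exact hc.trans h₁

/-- This is why the scan tests only one triple before a push: among the chords from earlier centers
into `t`, the edge from the predecessor `p` has the smallest direction. -/
theorem HullPred.concave_of_concave (S : SeparatedSeq z n) {p t i : ℕ}
    (h : HullPred z p t) (hti : t < i) (hi : i < n) (hc : Concave z p t i) :
    ∀ j, j < t → Concave z j t i := by
  intro j hjt
  have ht := hti.trans hi
  rw [S.concave_iff h.lt hti hi] at hc
  rw [S.concave_iff hjt hti hi]
  rcases lt_trichotomy j p with hjp | rfl | hjp
  · have := h.before j hjp
    rw [S.concave_iff_right hjp h.lt ht] at this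
    exact hc.trans this
  · exact hc
  · have := h.between j hjp hjt
    rw [S.concave_iff_right hjp hjt ht, not_le] at this
    exact hc.trans this.le

end

/-! ### Comparison with the upper convex hull of the disks -/

theorem isLinearMap_lat (s : ℝ) : IsLinearMap ℝ (lat s) :=
  ⟨lat_add s, fun r v => by rw [Complex.real_smul, lat_ofReal_mul, smul_eq_mul]⟩

section
variable {n : ℕ} {c : Fin n → ℂ} {z : ℕ → ℂ}

theorem lat_le_of_mem_hull (hz : ∀ q : Fin n, c q = z q) {s : ℝ} {i : ℕ}
    (h : Supports z n s i) {x : ℂ} (hx : x ∈ hull c) : lat s x ≤ lat s (z i) + 1 := by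
  have hsub : hull c ⊆ {x | lat s x ≤ lat s (z i) + 1} := by
    refine convexHull_min ?_ (convex_halfSpace_le (isLinearMap_lat s) _)
    intro y hy
    obtain ⟨q, hq⟩ := Set.mem_iUnion.mp hy
    have h₁ := h.le q q.2
    have h₂ : ‖y - c q‖ ≤ 1 := mem_closedBall_iff_norm.mp hq
    have h₃ := (abs_le.mp (abs_lat_le s (y - c q))).2
    rw [lat_sub, hz] at h₃
    rw [hz] at h₂
    change lat s y ≤ _
    linarith
  exact hsub hx

/-- All disks are translates of each other. If `z q` is strictly below a chord, a contact of its
disk with the upper hull can be translated to the ends of the chord, and the segment between the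
copies passes vertically above the contact. Conversely, a supporting line at `z q`, moved by its
unit normal, touches the disk at a topmost point of the hull. -/
theorem isUpperHullDisk_iff (S : SeparatedSeq z n) (hz : ∀ q : Fin n, c q = z q) (q : Fin n) :
    IsUpperHullDisk c q ↔ 0 < (q : ℕ) ∧ (q : ℕ) + 1 < n ∧ HullIndex z n q := by
  have hdisk : ∀ (j : Fin n) (x : ℂ), ‖x - z j‖ ≤ 1 → x ∈ hull c := fun j x hx =>
    subset_convexHull ℝ _ (Set.mem_iUnion.mpr ⟨j, mem_closedBall_iff_norm.mpr (by rwa [hz])⟩)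
  constructor
  · rintro ⟨⟨j, hj⟩, ⟨k, hk⟩, ⟨p, hp, hpu⟩⟩
    refine ⟨by have : (j : ℕ) < q := hj; omega, by have : (q : ℕ) < k := hk; omega, ?_⟩
    intro a k ha hk hkn
    by_contra hc
    have hcr : 0 < cross (z q - z a) (z k - z q) := not_le.mp hc
    have x₁ := S.re_lt a q ha (hk.trans hkn)
    have x₂ := S.re_lt q k hk hkn
    set D := (z k).re - (z a).re with hD
    have hDpos : 0 < D := by linarith
    -- The parameter of the point on the chord with the abscissa of `z q`.
    set t := ((z q).re - (z a).re) / D with ht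
    have ht0 : 0 ≤ t := div_nonneg (by linarith) hDpos.le
    have ht1 : t ≤ 1 := by rw [ht, div_le_one hDpos]; linarith
    have htD : t * D = (z q).re - (z a).re := by rw [ht]; field_simp
    have hpv : ‖p - z q‖ ≤ 1 := by rw [← hz]; exact mem_closedBall_iff_norm.mp hp
    have m₁ : z a + (p - z q) ∈ hull c :=
      hdisk ⟨a, by omega⟩ _ (by simpa using hpv)
    have m₂ : z k + (p - z q) ∈ hull c := hdisk ⟨k, hkn⟩ _ (by simpa using hpv)
    have m₃ := (convex_convexHull ℝ (⋃ i, disk (c i))) m₁ m₂ (sub_nonneg.mpr ht1) ht0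
      (sub_add_cancel 1 t)
    have := hpu.2.2.2 _ m₃ (by
      simp only [Complex.add_re, Complex.real_smul, Complex.re_ofReal_mul, Complex.sub_re]
      linear_combination htD + t * hD)
    simp only [Complex.add_im, Complex.real_smul, Complex.im_ofReal_mul, Complex.sub_im] at this
    have e : (1 - t) * (z a).im + t * (z k).im ≤ (z q).im := by linarith
    have e' : D * ((1 - t) * (z a).im + t * (z k).im) ≤ D * (z q).im :=
      mul_le_mul_of_nonneg_left e hDpos.le
    have : cross (z q - z a) (z k - z q) =
        D * ((1 - t) * (z a).im + t * (z k).im) - D * (z q).im := by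
      simp only [cross, Complex.sub_re, Complex.sub_im]
      linear_combination ((z a).im - (z k).im) * htD + ((z q).im - (z a).im) * hD
    linarith
  · rintro ⟨h₁, h₂, h₃⟩
    refine ⟨⟨⟨0, by omega⟩, h₁⟩, ⟨⟨q + 1, h₂⟩, Nat.lt_succ_self _⟩, ?_⟩
    obtain ⟨s, hs⟩ := h₃.exists_supports S h₂
    have hcos : 0 < cos s := cos_pos_of_mem_Ioo ⟨hs.neg_lt, hs.lt⟩
    have hsin₁ := sin_lt_sin_of_lt_of_le_pi_div_two hs.neg_lt.le le_rfl hs.lt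
    have hsin₂ := sin_lt_sin_of_lt_of_le_pi_div_two le_rfl hs.lt.le hs.neg_lt
    rw [sin_pi_div_two] at hsin₁
    rw [sin_neg, sin_pi_div_two] at hsin₂
    -- The point of the disk in the direction of the upper normal; as `|sin s| < 1`, it is strictly
    -- between the extreme abscissas of the hull.
    set p : ℂ := z q + Complex.I * dir s with hp
    have hpn : ‖p - z q‖ ≤ 1 := by
      rw [hp, add_sub_cancel_left, norm_mul, Complex.norm_I, norm_dir, one_mul]
    have hre : p.re = (z q).re - sin s := by simp [hp, dir_im]; ring
    have hlat : lat s p = lat s (z q) + 1 := by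
      rw [hp, lat_add]
      congr 1
      simp only [lat, Complex.mul_re, Complex.mul_im, Complex.I_re, Complex.I_im, dir_re, dir_im]
      linear_combination sin_sq_add_cos_sq s
    refine ⟨p, mem_closedBall_iff_norm.mpr (by rwa [hz]), hdisk q p hpn, ?_, ?_, ?_⟩
    · refine ⟨z 0 - 1, hdisk ⟨0, by omega⟩ _ (by simp), ?_⟩
      have := S.re_lt 0 q h₁ q.2
      rw [hre]; simp only [Complex.sub_re, Complex.one_re]; linarith
    · refine ⟨z (q + 1) + 1, hdisk ⟨q + 1, h₂⟩ _ (by simp), ?_⟩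
      have := S.re_lt q (q + 1) (Nat.lt_succ_self _) h₂
      rw [hre]; simp only [Complex.add_re, Complex.one_re]; linarith
    · intro x hx hxre
      have := lat_le_of_mem_hull hz hs hx
      rw [← hlat, lat, lat, hxre] at this
      nlinarith

end

end
end ConveyorBelt

/-! ### From cyclic lists of contacts to closed curves of class `C¹`. -/

namespace ConveyorBelt
noncomputable section
open Real

/-! ### Closed curves from cyclic lists of contacts -/

/-- A closed sequence of contacts `K 0, …, K N = K 0`, where `θ j` is the direction in which the
`j`th contact is reached, `δ j` the angle of the arc and `l j` the length of the segment that
follows. -/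
structure BeltData {n : ℕ} (c : Fin n → ℂ) (N : ℕ) (K : ℕ → Contact n) (θ δ l : ℕ → ℝ) :
    Prop where
  angle_nonneg : ∀ j, 0 ≤ δ j
  length_nonneg : ∀ j, 0 ≤ l j
  angle_succ : ∀ j, j < N → θ (j + 1) = θ j + (K j).2.sign * δ j
  segment : ∀ j, j < N →
    touchPoint (c (K j).1) (K j).2 (θ (j + 1)) + (l j : ℂ) * dir (θ (j + 1)) =
      touchPoint (c (K (j + 1)).1) (K (j + 1)).2 (θ (j + 1))
  closed : K N = K 0
  angle_closed : θ N = θ 0 + 2 * π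
  length_pos : 0 < ∑ j ∈ Finset.range N, (δ j + l j)

/-- The time at which the `j`th contact is reached. -/
def arrival (δ l : ℕ → ℝ) (j : ℕ) : ℝ := ∑ i ∈ Finset.range j, (δ i + l i)

theorem arrival_zero (δ l : ℕ → ℝ) : arrival δ l 0 = 0 := by simp [arrival]

theorem arrival_succ (δ l : ℕ → ℝ) (j : ℕ) :
    arrival δ l (j + 1) = arrival δ l j + δ j + l j := by
  rw [arrival, Finset.sum_range_succ, ← arrival]; ring

theorem dir_add_two_pi (θ : ℝ) : dir (θ + 2 * π) = dir θ := by
  apply Complex.ext <;> simp [dir_re, dir_im]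

theorem dir_eq_of_abs_sub_lt {a b : ℝ} (h : dir a = dir b) (hab : |a - b| < 2 * π) : a = b := by
  have h₁ : cos a = cos b := by simpa [dir_re] using congrArg Complex.re h
  have h₂ : sin a = sin b := by simpa [dir_im] using congrArg Complex.im h
  have h₃ : cos (a - b) = 1 := by
    rw [cos_sub, h₁, h₂]; nlinarith [sin_sq_add_cos_sq b]
  obtain ⟨h₄, h₅⟩ := abs_lt.mp hab
  have := (cos_eq_one_iff_of_lt_of_lt h₄ h₅).mp h₃
  linarith

theorem touchPoint_injective {z : ℂ} {σ : Side} {a b : ℝ}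
    (h : touchPoint z σ a = touchPoint z σ b) : dir a = dir b := by
  have hσ : (σ.sign : ℂ) ≠ 0 := by
    have := σ.sign_sq
    intro h0
    rw [Complex.ofReal_eq_zero.mp h0] at this
    norm_num at this
  simpa [touchPoint, hσ] using h

theorem hasDerivAt_dir (θ : ℝ) : HasDerivAt dir (Complex.I * dir θ) θ := by
  have h : HasDerivAt (fun x : ℝ => (x : ℂ) * Complex.I) Complex.I θ := by
    simpa using (Complex.ofRealCLM.hasDerivAt (x := θ)).mul_const Complex.I
  have := h.cexp
  rw [mul_comm] at this
  exact this

theorem continuous_dir : Continuous dir :=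
  continuous_iff_continuousAt.mpr fun θ => (hasDerivAt_dir θ).continuousAt

theorem hasDerivAt_touchPoint (z : ℂ) (σ : Side) (θ a t : ℝ) :
    HasDerivAt (fun t => touchPoint z σ (θ + σ.sign * (t - a)))
      (dir (θ + σ.sign * (t - a))) t := by
  have h₁ : HasDerivAt (fun t => θ + σ.sign * (t - a)) σ.sign t := by
    simpa using (((hasDerivAt_id t).sub_const a).const_mul σ.sign).const_add θ
  have h₂ := (hasDerivAt_dir (θ + σ.sign * (t - a))).scomp t h₁
  have h₃ := ((h₂.const_mul Complex.I).const_mul (σ.sign : ℂ)).const_sub z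
  refine HasDerivAt.congr_deriv h₃ ?_
  have e : ((σ.sign : ℂ)) * σ.sign = 1 := by
    rw [← Complex.ofReal_mul, σ.sign_sq, Complex.ofReal_one]
  rw [Complex.real_smul]
  linear_combination (-dir (θ + σ.sign * (t - a))) * (Complex.I * Complex.I * e + Complex.I_mul_I)

theorem hasDerivAt_segment (p v : ℂ) (a t : ℝ) :
    HasDerivAt (fun t : ℝ => p + ((t - a : ℝ) : ℂ) * v) v t := by
  have h : HasDerivAt (fun t : ℝ => ((t - a : ℝ) : ℂ)) 1 t := by
    simpa using ((hasDerivAt_id t).sub_const a).ofReal_comp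
  simpa using (h.mul_const v).const_add p

section
variable {n : ℕ} {c : Fin n → ℂ} {N : ℕ} {K : ℕ → Contact n} {θ δ l : ℕ → ℝ}

/-- The direction of the belt at time `t`. -/
def beltAngle (N : ℕ) (K : ℕ → Contact n) (θ δ l : ℕ → ℝ) (t : ℝ) : ℝ :=
  θ 0 + ∑ k ∈ Finset.range N, (K k).2.sign * min (max (t - arrival δ l k) 0) (δ k)

theorem continuous_beltAngle : Continuous (beltAngle N K θ δ l) := by
  unfold beltAngle; fun_prop

namespace BeltData

variable (D : BeltData c N K θ δ l)
include D

theorem arrival_mono : Monotone (arrival δ l) :=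
  monotone_nat_of_le_succ fun j => by
    rw [arrival_succ]; linarith [D.angle_nonneg j, D.length_nonneg j]

theorem angle_eq_sum {j : ℕ} (hj : j ≤ N) :
    θ j = θ 0 + ∑ k ∈ Finset.range j, (K k).2.sign * δ k := by
  induction j with
  | zero => simp
  | succ j ih => rw [D.angle_succ j hj, ih (by omega), Finset.sum_range_succ]; ring

/-- During the `j`th phase the earlier summands are saturated at their full angles and the later
ones are still zero. The remaining minimum stops growing at the end of the arc, so the direction is
constant on the segment. -/
theorem beltAngle_eq {j : ℕ} (hj : j < N) {t : ℝ} (h₁ : arrival δ l j ≤ t)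
    (h₂ : t ≤ arrival δ l (j + 1)) :
    beltAngle N K θ δ l t = θ j + (K j).2.sign * min (t - arrival δ l j) (δ j) := by
  rw [beltAngle, D.angle_eq_sum hj.le, add_assoc]
  congr 1
  have hsplit : Finset.range N = Finset.range (j + 1) ∪ Finset.Ico (j + 1) N := by
    ext x; simp only [Finset.mem_range, Finset.mem_union, Finset.mem_Ico]; omega
  rw [hsplit, Finset.sum_union (by
    rw [Finset.disjoint_left]; intro x hx hx'
    simp only [Finset.mem_range, Finset.mem_Ico] at hx hx'; omega), Finset.sum_range_succ]
  have e₁ : ∑ k ∈ Finset.Ico (j + 1) N,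
      (K k).2.sign * min (max (t - arrival δ l k) 0) (δ k) = 0 := by
    refine Finset.sum_eq_zero fun k hk => ?_
    have := D.arrival_mono (Finset.mem_Ico.mp hk).1
    rw [max_eq_right (by linarith), min_eq_left (D.angle_nonneg k), mul_zero]
  have e₂ : ∑ k ∈ Finset.range j, (K k).2.sign * min (max (t - arrival δ l k) 0) (δ k) =
      ∑ k ∈ Finset.range j, (K k).2.sign * δ k := by
    refine Finset.sum_congr rfl fun k hk => ?_
    have h₃ := D.arrival_mono (Finset.mem_range.mp hk)
    rw [Nat.succ_eq_add_one, arrival_succ] at h₃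
    have := D.length_nonneg k
    have := D.angle_nonneg k
    rw [max_eq_left (by linarith), min_eq_right (by linarith)]
  rw [e₁, e₂, max_eq_left (by linarith)]; ring

/-- The closed curve of the belt. -/
theorem exists_curve : ∃ γ : ℝ → ℂ, Function.Periodic γ (arrival δ l N) ∧ ContDiff ℝ 1 γ ∧
    (∀ t, deriv γ t ≠ 0) ∧
    (∀ j < N, ∀ t ∈ Set.Icc 0 (δ j), γ (arrival δ l j + t) =
      touchPoint (c (K j).1) (K j).2 (θ j + (K j).2.sign * t)) ∧
    (∀ j < N, ∀ t ∈ Set.Icc 0 (l j), γ (arrival δ l j + δ j + t) =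
      touchPoint (c (K j).1) (K j).2 (θ (j + 1)) + (t : ℂ) * dir (θ (j + 1))) := by
  set T := arrival δ l N with hT
  have hTpos : 0 < T := D.length_pos
  have hN : 0 < N := by
    rcases Nat.eq_zero_or_pos N with h | h
    · rw [hT, h, arrival_zero] at hTpos; exact absurd hTpos (lt_irrefl 0)
    · exact h
  set Θ := beltAngle N K θ δ l with hΘ
  have hΘ0 : Θ 0 = θ 0 := by
    have := D.beltAngle_eq hN (t := 0) (by rw [arrival_zero])
      (by rw [← arrival_zero δ l]; exact D.arrival_mono (Nat.zero_le _))
    rw [arrival_zero, sub_zero, min_eq_left (D.angle_nonneg 0), mul_zero, add_zero] at this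
    exact this
  have hΘT : Θ T = θ 0 + 2 * π := by
    obtain ⟨M, rfl⟩ : ∃ M, N = M + 1 := ⟨N - 1, by omega⟩
    have := D.beltAngle_eq (Nat.lt_succ_self M) (t := T) (D.arrival_mono (Nat.le_succ _)) le_rfl
    rw [hT, arrival_succ, min_eq_right (by linarith [D.length_nonneg M]),
      ← D.angle_succ M (Nat.lt_succ_self M), D.angle_closed] at this
    rw [hT, arrival_succ]; exact this
  -- One period of the tangent, rescaled to `[0, 1]`. Its ends agree because the total turning is
  -- `2π`, so composition with the fractional part is continuous and periodic.
  set f : ℝ → ℂ := fun x => dir (Θ (T * x)) with hf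
  have hfc : Continuous f :=
    continuous_dir.comp (continuous_beltAngle.comp (continuous_const.mul continuous_id))
  have hf01 : f 0 = f 1 := by
    simp only [hf, mul_zero, mul_one, hΘ0, hΘT, dir_add_two_pi]
  set V : ℝ → ℂ := fun t => f (Int.fract (t / T)) with hV
  have hVc : Continuous V :=
    (ContinuousOn.comp_fract'' hfc.continuousOn hf01).comp (continuous_id.div_const T)
  have hVp : Function.Periodic V T := fun t => by
    simp only [hV]; rw [add_div, div_self hTpos.ne', Int.fract_add_one]
  have hVeq : ∀ t, 0 ≤ t → t < T → V t = dir (Θ t) := by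
    intro t h₁ h₂
    have : Int.fract (t / T) = t / T :=
      Int.fract_eq_self.mpr ⟨div_nonneg h₁ hTpos.le, by rwa [div_lt_one hTpos]⟩
    simp only [hV, hf, this]
    congr 2; field_simp
  have hint : ∀ a b, IntervalIntegrable V MeasureTheory.volume a b :=
    fun a b => hVc.intervalIntegrable a b
  -- Integration of the unit tangent makes the curve continuously differentiable and regular at
  -- once. The formulas on arcs and segments are then recovered from their derivatives.
  set γ : ℝ → ℂ := fun t => touchPoint (c (K 0).1) (K 0).2 (θ 0) + ∫ x in (0 : ℝ)..t, V x with hγ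
  have hstep : ∀ a b, γ b = γ a + ∫ x in a..b, V x := fun a b => by
    simp only [hγ]
    rw [← intervalIntegral.integral_add_adjacent_intervals (hint 0 a) (hint a b), add_assoc]
  have hderiv : ∀ t, HasDerivAt γ (V t) t := fun t =>
    (intervalIntegral.integral_hasDerivAt_right (hint 0 t)
      (hVc.stronglyMeasurableAtFilter _ _) hVc.continuousAt).const_add _
  have hVne : ∀ t, V t ≠ 0 := fun t h => by
    have := norm_dir (Θ (T * Int.fract (t / T)))
    rw [show dir (Θ (T * Int.fract (t / T))) = V t from rfl, h, norm_zero] at this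
    exact zero_ne_one this
  have harc : ∀ j < N, γ (arrival δ l j) = touchPoint (c (K j).1) (K j).2 (θ j) →
      ∀ t ∈ Set.Icc 0 (δ j), γ (arrival δ l j + t) =
        touchPoint (c (K j).1) (K j).2 (θ j + (K j).2.sign * t) := by
    intro j hj h0 t ht
    set a := arrival δ l j with ha
    have ha0 : 0 ≤ a := by
      rw [← arrival_zero δ l]; exact D.arrival_mono (Nat.zero_le _)
    have haT := D.arrival_mono (show j + 1 ≤ N from hj)
    have hs := arrival_succ δ l j
    have hl := D.length_nonneg j
    rw [hstep a (a + t), h0, intervalIntegral.integral_eq_sub_of_hasDerivAt_of_le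
      (f := fun x => touchPoint (c (K j).1) (K j).2 (θ j + (K j).2.sign * (x - a)))
      (by linarith [ht.1])
      (fun x _ => (hasDerivAt_touchPoint _ _ _ _ x).continuousAt.continuousWithinAt)
      ?_ (hint _ _)]
    · simp
    · intro x hx
      have hx₁ := hx.1
      have hx₂ := hx.2
      have ht₂ := ht.2
      rw [hVeq x (by linarith) (by linarith), hΘ,
        D.beltAngle_eq hj hx₁.le (by linarith), min_eq_left (by linarith)]
      exact hasDerivAt_touchPoint _ _ _ _ x
  have hseg : ∀ j < N, γ (arrival δ l j) = touchPoint (c (K j).1) (K j).2 (θ j) →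
      ∀ t ∈ Set.Icc 0 (l j), γ (arrival δ l j + δ j + t) =
        touchPoint (c (K j).1) (K j).2 (θ (j + 1)) + (t : ℂ) * dir (θ (j + 1)) := by
    intro j hj h0 t ht
    have h1 := harc j hj h0 (δ j) ⟨D.angle_nonneg j, le_rfl⟩
    rw [← D.angle_succ j hj] at h1
    set a := arrival δ l j + δ j with ha
    have ha0 : 0 ≤ arrival δ l j := by
      rw [← arrival_zero δ l]; exact D.arrival_mono (Nat.zero_le _)
    have haT := D.arrival_mono (show j + 1 ≤ N from hj)
    have hs := arrival_succ δ l j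
    have hδ := D.angle_nonneg j
    rw [hstep a (a + t), h1, intervalIntegral.integral_eq_sub_of_hasDerivAt_of_le
      (f := fun x => (0 : ℂ) + ((x - a : ℝ) : ℂ) * dir (θ (j + 1)))
      (by linarith [ht.1])
      (fun x _ => (hasDerivAt_segment _ _ _ x).continuousAt.continuousWithinAt)
      ?_ (hint _ _)]
    · simp
    · intro x hx
      have hx₁ := hx.1
      have hx₂ := hx.2
      have ht₂ := ht.2
      rw [hVeq x (by linarith) (by linarith), hΘ,
        D.beltAngle_eq hj (by linarith) (by linarith), min_eq_right (by linarith),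
        ← D.angle_succ j hj]
      exact hasDerivAt_segment _ _ _ x
  have hpos : ∀ j ≤ N, γ (arrival δ l j) = touchPoint (c (K j).1) (K j).2 (θ j) := by
    intro j
    induction j with
    | zero => intro _; simp [hγ, arrival_zero]
    | succ j ih =>
      intro hj
      have := hseg j hj (ih (by omega)) (l j) ⟨D.length_nonneg j, le_rfl⟩
      rw [D.segment j hj, ← arrival_succ] at this
      exact this
  have hclosed : γ T = γ 0 := by
    rw [hT, hpos N le_rfl, D.closed, D.angle_closed, touchPoint, dir_add_two_pi, ← touchPoint]
    simp [hγ]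
  refine ⟨γ, fun t => ?_, ?_, fun t => ?_, fun j hj => harc j hj (hpos j hj.le),
    fun j hj => hseg j hj (hpos j hj.le)⟩
  -- The last contact agrees with the first one, so the tangent has integral zero over one period
  -- and the curve inherits its periodicity.
  · have e := hstep 0 T
    rw [hclosed, left_eq_add] at e
    rw [hstep t (t + T), hVp.intervalIntegral_add_eq t 0, zero_add, e, add_zero]
  · rw [contDiff_one_iff_deriv]
    refine ⟨fun t => (hderiv t).differentiableAt, ?_⟩
    rwa [show deriv γ = V from funext fun t => (hderiv t).deriv]
  · rw [(hderiv t).deriv]; exact hVne t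

end BeltData

/-- The half-open arc of the `j`th contact. -/
def arcSet (c : Fin n → ℂ) (K : ℕ → Contact n) (θ δ : ℕ → ℝ) (j : ℕ) : Set ℂ :=
  {x | ∃ t, 0 ≤ t ∧ t < δ j ∧ x = touchPoint (c (K j).1) (K j).2 (θ j + (K j).2.sign * t)}

/-- The half-open segment that follows the `j`th contact. -/
def segSet (c : Fin n → ℂ) (K : ℕ → Contact n) (θ l : ℕ → ℝ) (j : ℕ) : Set ℂ :=
  {x | ∃ t, 0 ≤ t ∧ t < l j ∧
    x = touchPoint (c (K j).1) (K j).2 (θ (j + 1)) + (t : ℂ) * dir (θ (j + 1))}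

/-- A closed sequence of contacts whose arcs and segments are disjoint from each other and from the
open disks specifies a conveyor belt. -/
theorem BeltData.exists_conveyorBelt (D : BeltData c N K θ δ l) (hδ : ∀ j, δ j ≤ 2 * π)
    (hvisit : ∀ i, ∃ j < N, (K j).1 = i)
    (hne : ∀ j < N, (K j).1 ≠ (K (j + 1)).1 ∨ l j = 0)
    (havoid : ∀ i, ∀ j < N, Disjoint (segSet c K θ l j) (Metric.ball (c i) 1))
    (hdisj : ∀ i j, i ≠ j → Disjoint (disk (c i)) (disk (c j)))
    (haa : ∀ i < N, ∀ j < N, i ≠ j → Disjoint (arcSet c K θ δ i) (arcSet c K θ δ j))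
    (has : ∀ i < N, ∀ j < N, Disjoint (arcSet c K θ δ i) (segSet c K θ l j))
    (hss : ∀ i < N, ∀ j < N, i ≠ j → Disjoint (segSet c K θ l i) (segSet c K θ l j))
    {B : List (Contact n)} (hB : B.length = N) (hBK : ∀ j : Fin B.length, B.get j = K j) :
    ∃ (γ : ℝ → ℂ) (T : ℝ), Traces c B γ T ∧ IsConveyorBelt c γ T := by
  obtain ⟨γ, hper, hC, hreg, harc, hseg⟩ := D.exists_curve
  set T := arrival δ l N with hT
  have hTpos : 0 < T := D.length_pos
  -- The pieces are half-open, so consecutive ones share no end point; thereby injectivity follows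
  -- from disjointness of distinct pieces.
  have hloc : ∀ M ≤ N, ∀ t, 0 ≤ t → t < arrival δ l M → ∃ j < N,
      (∃ u, 0 ≤ u ∧ u < δ j ∧ t = arrival δ l j + u) ∨
      (∃ u, 0 ≤ u ∧ u < l j ∧ t = arrival δ l j + δ j + u) := by
    intro M
    induction M with
    | zero => intro _ t h₁ h₂; rw [arrival_zero] at h₂; linarith
    | succ M ih =>
      intro hM t h₁ h₂
      rcases lt_or_ge t (arrival δ l M) with h | h
      · exact ih (by omega) t h₁ h
      · rw [arrival_succ] at h₂
        refine ⟨M, hM, ?_⟩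
        rcases lt_or_ge t (arrival δ l M + δ M) with h' | h'
        · exact Or.inl ⟨t - arrival δ l M, by linarith, by linarith, by ring⟩
        · exact Or.inr ⟨t - (arrival δ l M + δ M), by linarith, by linarith, by ring⟩
  have hptA : ∀ j < N, ∀ u, 0 ≤ u → u < δ j → γ (arrival δ l j + u) ∈ arcSet c K θ δ j :=
    fun j hj u h₁ h₂ => ⟨u, h₁, h₂, harc j hj u ⟨h₁, h₂.le⟩⟩
  have hptS : ∀ j < N, ∀ u, 0 ≤ u → u < l j → γ (arrival δ l j + δ j + u) ∈ segSet c K θ l j :=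
    fun j hj u h₁ h₂ => ⟨u, h₁, h₂, hseg j hj u ⟨h₁, h₂.le⟩⟩
  refine ⟨γ, T, ⟨hper, arrival δ l, θ, δ, l, arrival_zero δ l, by rw [hB], fun j => ?_⟩,
    hTpos, hper, hC, hreg, ?_, fun i => ?_, fun i t => ?_, ?_⟩
  · have hj : (j : ℕ) < N := by rw [← hB]; exact j.2
    rw [hBK j]
    exact ⟨D.angle_nonneg j, hδ j, D.length_nonneg j, arrival_succ δ l j, D.angle_succ j hj,
      harc j hj, hseg j hj⟩
  · intro t ht t' ht' he
    obtain ⟨j, hj, h⟩ := hloc N le_rfl t ht.1 ht.2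
    obtain ⟨j', hj', h'⟩ := hloc N le_rfl t' ht'.1 ht'.2
    rcases h with ⟨u, h₁, h₂, rfl⟩ | ⟨u, h₁, h₂, rfl⟩ <;>
      rcases h' with ⟨u', h₁', h₂', rfl⟩ | ⟨u', h₁', h₂', rfl⟩
    · by_cases hjj : j = j'
      · subst hjj
        rw [harc j hj u ⟨h₁, h₂.le⟩, harc j hj u' ⟨h₁', h₂'.le⟩] at he
        have h3 := hδ j
        have h4 := dir_eq_of_abs_sub_lt (touchPoint_injective he) (by
          rw [add_sub_add_left_eq_sub, ← mul_sub, abs_mul, Side.abs_sign, one_mul, abs_lt]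
          constructor <;> linarith)
        have h5 := (K j).2.sign_sq
        have : (K j).2.sign * (u - u') = 0 := by linarith
        rcases mul_eq_zero.mp this with h | h
        · rw [h] at h5; norm_num at h5
        · linarith
      · exact absurd he (Set.disjoint_iff_forall_ne.mp (haa j hj j' hj' hjj)
          (hptA j hj u h₁ h₂) (hptA j' hj' u' h₁' h₂'))
    · exact absurd he (Set.disjoint_iff_forall_ne.mp (has j hj j' hj')
          (hptA j hj u h₁ h₂) (hptS j' hj' u' h₁' h₂'))
    · exact absurd he.symm (Set.disjoint_iff_forall_ne.mp (has j' hj' j hj)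
          (hptA j' hj' u' h₁' h₂') (hptS j hj u h₁ h₂))
    · by_cases hjj : j = j'
      · subst hjj
        rw [hseg j hj u ⟨h₁, h₂.le⟩, hseg j hj u' ⟨h₁', h₂'.le⟩] at he
        have hd : dir (θ (j + 1)) ≠ 0 := fun h => by
          have := norm_dir (θ (j + 1)); rw [h, norm_zero] at this; exact zero_ne_one this
        have := mul_right_cancel₀ hd (add_left_cancel he)
        rw [Complex.ofReal_inj.mp this]
      · exact absurd he (Set.disjoint_iff_forall_ne.mp (hss j hj j' hj' hjj)
          (hptS j hj u h₁ h₂) (hptS j' hj' u' h₁' h₂'))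
  · obtain ⟨j, hj, rfl⟩ := hvisit i
    refine ⟨arrival δ l j + 0, ?_⟩
    rw [harc j hj 0 ⟨le_rfl, D.angle_nonneg j⟩]
    exact touchPoint_mem_sphere _ _ _
  · obtain ⟨t', ht', e⟩ := hper.exists_mem_Ico₀ hTpos t
    rw [e]
    obtain ⟨j, hj, h⟩ := hloc N le_rfl t' ht'.1 ht'.2
    rcases h with ⟨u, h₁, h₂, rfl⟩ | ⟨u, h₁, h₂, rfl⟩
    · intro hb
      rw [harc j hj u ⟨h₁, h₂.le⟩] at hb
      have hs := touchPoint_mem_sphere (c (K j).1) (K j).2 (θ j + (K j).2.sign * u)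
      by_cases hi : i = (K j).1
      · rw [hi, Metric.mem_ball, Metric.mem_sphere.mp hs] at hb
        exact lt_irrefl 1 hb
      · exact Set.disjoint_left.mp (hdisj _ _ hi) (Metric.ball_subset_closedBall hb)
          (Metric.sphere_subset_closedBall hs)
    · exact Set.disjoint_left.mp (havoid i j hj) (hptS j hj u h₁ h₂)
  -- Even break points are arrivals at contacts and odd ones are ends of arcs, so the `2 * N` pieces
  -- alternate between arcs and segments.
  · set s : ℕ → ℝ := fun k => if k % 2 = 0 then arrival δ l (k / 2)
      else arrival δ l (k / 2) + δ (k / 2) with hs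
    have hs0 : ∀ j, s (2 * j) = arrival δ l j := fun j => by simp [hs]
    have hs1 : ∀ j, s (2 * j + 1) = arrival δ l j + δ j := fun j => by
      have h1 : (2 * j + 1) % 2 = 1 := by omega
      have h2 : (2 * j + 1) / 2 = j := by omega
      simp [hs, h1, h2]
    refine ⟨2 * N, s, ?_, fun k hk => ?_⟩
    · rw [hs0, show s 0 = s (2 * 0) from rfl, hs0, arrival_zero, zero_add]
    · obtain ⟨j, rfl | rfl⟩ : ∃ j, k = 2 * j ∨ k = 2 * j + 1 := ⟨k / 2, by omega⟩
      · have hj : j < N := by omega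
        rw [hs0, hs1]
        refine ⟨by linarith [D.angle_nonneg j], Or.inl ⟨(K j).1, ?_⟩⟩
        rintro _ ⟨t, ht, rfl⟩
        have := harc j hj (t - arrival δ l j) ⟨by linarith [ht.1], by linarith [ht.2]⟩
        rw [add_sub_cancel] at this
        rw [this]
        exact touchPoint_mem_sphere _ _ _
      · have hj : j < N := by omega
        rw [hs1, show 2 * j + 1 + 1 = 2 * (j + 1) by ring, hs0, arrival_succ]
        have hl := D.length_nonneg j
        refine ⟨by linarith, ?_⟩
        have p0 := hseg j hj 0 ⟨le_rfl, hl⟩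
        have p1 := hseg j hj (l j) ⟨hl, le_rfl⟩
        rw [add_zero] at p0
        rcases hne j hj with h | h
        · right
          refine ⟨(K j).1, (K (j + 1)).1, h, ?_, ?_⟩
          · rw [p1, p0, Complex.ofReal_zero, zero_mul, add_zero]
            have q : ∀ σ : Side, inner ℝ ((l j : ℂ) * dir (θ (j + 1)))
                (-((σ.sign : ℂ) * (Complex.I * dir (θ (j + 1))))) = 0 := by
              intro σ
              simp only [Complex.inner, Complex.mul_re, Complex.mul_im, Complex.conj_re,
                Complex.conj_im, Complex.neg_re, Complex.neg_im, Complex.ofReal_re,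
                Complex.ofReal_im, Complex.I_re, Complex.I_im]
              ring
            refine ⟨touchPoint_mem_sphere _ _ _, ?_, ?_, ?_⟩
            · rw [D.segment j hj]; exact touchPoint_mem_sphere _ _ _
            · rw [add_sub_cancel_left, touchPoint, sub_sub_cancel_left]; exact q _
            · rw [add_sub_cancel_left, D.segment j hj, touchPoint, sub_sub_cancel_left]
              exact q _
          · rw [p0, p1, segment_eq_image']
            ext x
            constructor
            · rintro ⟨t, ht, rfl⟩
              have ht₁ := ht.1
              have ht₂ := ht.2
              have := hseg j hj (t - (arrival δ l j + δ j)) ⟨by linarith, by linarith⟩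
              rw [add_sub_cancel] at this
              rw [this]
              rcases hl.eq_or_lt with h0 | h0
              · refine ⟨0, ⟨le_rfl, zero_le_one⟩, ?_⟩
                have : t - (arrival δ l j + δ j) = 0 := by linarith
                rw [this]; simp
              · refine ⟨(t - (arrival δ l j + δ j)) / l j,
                  ⟨div_nonneg (by linarith) h0.le, by rw [div_le_one h0]; linarith⟩, ?_⟩
                have h0' : (l j : ℂ) ≠ 0 := by exact_mod_cast h0.ne'
                simp only [Complex.real_smul, Complex.ofReal_div]
                field_simp
                simp
                ring
            · rintro ⟨u, hu, rfl⟩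
              have h₁ : 0 ≤ u * l j := mul_nonneg hu.1 hl
              have h₂ : u * l j ≤ l j := mul_le_of_le_one_left hl hu.2
              refine ⟨arrival δ l j + δ j + u * l j, ⟨by linarith, by linarith⟩, ?_⟩
              rw [hseg j hj (u * l j) ⟨h₁, h₂⟩]
              simp only [Complex.real_smul, Complex.ofReal_mul, Complex.ofReal_zero]
              ring
        · left
          refine ⟨(K j).1, ?_⟩
          rintro _ ⟨t, ht, rfl⟩
          have : t = arrival δ l j + δ j := by
            rw [h, add_zero] at ht; exact le_antisymm ht.2 ht.1
          rw [this, p0, Complex.ofReal_zero, zero_mul, add_zero]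
          exact touchPoint_mem_sphere _ _ _

end

end
end ConveyorBelt

/-! ### Disjointness of bitangent segments. -/

namespace ConveyorBelt
noncomputable section
open Real

/-! ### Distances between segments -/

/-- The point that divides the segment from `u` to `v` in the ratio `t : 1 - t`. -/
def lerp (u v : ℂ) (t : ℝ) : ℂ := ((1 - t : ℝ) : ℂ) * u + (t : ℂ) * v

/-- The point `x` has distance at most one from the segment between `u` and `v`. -/
def NearSegment (u v x : ℂ) : Prop := ∃ t : ℝ, 0 ≤ t ∧ t ≤ 1 ∧ ‖x - lerp u v t‖ ≤ 1

theorem lerp_sub_const (u v w : ℂ) (t : ℝ) : lerp (u - w) (v - w) t = lerp u v t - w := by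
  simp only [lerp, Complex.ofReal_sub, Complex.ofReal_one]; ring

theorem NearSegment.symm {u v x : ℂ} (h : NearSegment u v x) : NearSegment v u x := by
  obtain ⟨t, h₁, h₂, h₃⟩ := h
  refine ⟨1 - t, by linarith, by linarith, ?_⟩
  convert h₃ using 2
  simp only [lerp, Complex.ofReal_sub, Complex.ofReal_one]; ring

theorem nearSegment_lerp {u v p q : ℂ} (hp : ‖p - u‖ ≤ 1) (hq : ‖q - v‖ ≤ 1) {t : ℝ} (h₀ : 0 ≤ t)
    (h₁ : t ≤ 1) : NearSegment u v (lerp p q t) := by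
  refine ⟨t, h₀, h₁, ?_⟩
  have : lerp p q t - lerp u v t = ((1 - t : ℝ) : ℂ) * (p - u) + (t : ℂ) * (q - v) := by
    simp only [lerp]; ring
  rw [this]
  refine (norm_add_le _ _).trans ?_
  rw [norm_mul, norm_mul, Complex.norm_real, Complex.norm_real, Real.norm_of_nonneg h₀,
    Real.norm_of_nonneg (sub_nonneg.mpr h₁)]
  nlinarith

/-- If two segments in the plane, the first one left of the second one, are close to each other,
then an end of one of them is close to the other one. -/
theorem exists_end_close {A B C D : ℂ} (hAB : A.re < B.re) (hBC : B.re < C.re) (hCD : C.re < D.re)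
    {s t d : ℝ} (hs₀ : 0 ≤ s) (hs₁ : s ≤ 1) (ht₀ : 0 ≤ t) (ht₁ : t ≤ 1)
    (h : ‖lerp A B s - lerp C D t‖ ≤ d) :
    ∃ s t : ℝ, 0 ≤ s ∧ s ≤ 1 ∧ 0 ≤ t ∧ t ≤ 1 ∧ (s = 0 ∨ s = 1 ∨ t = 0 ∨ t = 1) ∧
      ‖lerp A B s - lerp C D t‖ ≤ d := by
  set W := lerp A B s - lerp C D t with hW
  have hre : ∀ s t : ℝ, 0 ≤ s → s ≤ 1 → 0 ≤ t → t ≤ 1 → (lerp A B s - lerp C D t).re < 0 := by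
    intro s t h₁ h₂ h₃ h₄
    simp only [lerp, Complex.sub_re, Complex.add_re, Complex.re_ofReal_mul]
    nlinarith
  have hWre := hre s t hs₀ hs₁ ht₀ ht₁
  rw [← hW] at hWre
  -- The coefficients `p`, `q` tell how to move the two points along their segments so that their
  -- difference only shrinks, by a multiple of itself. They come from the linear dependence `hid` of
  -- three plane vectors, with signs chosen to make `κ` nonnegative.
  obtain ⟨κ, p, q, hκ, hpq, he⟩ : ∃ κ p q : ℝ, 0 ≤ κ ∧ (p ≠ 0 ∨ q ≠ 0) ∧
      (p : ℂ) * (B - A) - (q : ℂ) * (D - C) = -(κ : ℂ) * W := by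
    have hid : (cross (D - C) W : ℂ) * (B - A) + (cross W (B - A) : ℂ) * (D - C) =
        -(cross (B - A) (D - C) : ℂ) * W := by
      apply Complex.ext <;>
        simp only [cross, Complex.add_re, Complex.add_im, Complex.re_ofReal_mul,
          Complex.im_ofReal_mul, ← Complex.ofReal_neg, Complex.sub_re, Complex.sub_im] <;> ring
    by_cases h0 : cross (D - C) W = 0 ∧ cross W (B - A) = 0
    -- Degenerate case: both segments are parallel to `W`, hence to each other, and sliding both
    -- points in parallel leaves the difference unchanged.
    · refine ⟨0, D.re - C.re, B.re - A.re, le_rfl, Or.inl (by linarith), ?_⟩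
      have h1 : cross (B - A) (D - C) = 0 := by
        rw [h0.1, h0.2] at hid
        have := congrArg Complex.re hid
        simp only [Complex.ofReal_zero, zero_mul, add_zero, Complex.zero_re, ← Complex.ofReal_neg,
          Complex.re_ofReal_mul] at this
        rcases mul_eq_zero.mp this.symm with h | h
        · linarith
        · exact absurd h hWre.ne
      simp only [cross, Complex.sub_re, Complex.sub_im] at h1
      apply Complex.ext
      · simp; ring
      · simp; linarith
    · rw [not_and_or] at h0
      rcases le_total 0 (cross (B - A) (D - C)) with hκ | hκ
      · refine ⟨_, cross (D - C) W, -cross W (B - A), hκ, h0.imp_right neg_ne_zero.mpr, ?_⟩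
        rw [← hid]; push_cast; ring
      · refine ⟨-cross (B - A) (D - C), -cross (D - C) W, cross W (B - A), by linarith,
          h0.imp_left neg_ne_zero.mpr, ?_⟩
        push_cast; linear_combination -hid
  -- The smallest distance of the two moving parameters from the ends of `[0, 1]`. A zero of `g` is
  -- the moment at which one point reaches an end of its segment.
  set g : ℝ → ℝ := fun μ => min (min (s + μ * p) (1 - (s + μ * p)))
    (min (t + μ * q) (1 - (t + μ * q))) with hg
  have hgc : Continuous g := by simp only [hg]; fun_prop
  have hg0 : 0 ≤ g 0 := by
    simp only [hg, zero_mul, add_zero, le_min_iff]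
    exact ⟨⟨hs₀, by linarith⟩, ht₀, by linarith⟩
  obtain ⟨M, hM, hgM⟩ : ∃ M, 0 ≤ M ∧ g M ≤ 0 := by
    rcases hpq with h0 | h0
    · refine ⟨1 / |p|, by positivity, ?_⟩
      have : 1 / |p| * p = 1 ∨ 1 / |p| * p = -1 := by
        rcases abs_choice p with h | h <;> rw [h]
        · left; field_simp
        · right; field_simp
      rcases this with h | h <;> simp only [hg, h, min_le_iff]
      · left; right; linarith
      · left; left; linarith
    · refine ⟨1 / |q|, by positivity, ?_⟩
      have : 1 / |q| * q = 1 ∨ 1 / |q| * q = -1 := by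
        rcases abs_choice q with h | h <;> rw [h]
        · left; field_simp
        · right; field_simp
      rcases this with h | h <;> simp only [hg, h, min_le_iff]
      · right; right; linarith
      · right; left; linarith
  obtain ⟨μ, ⟨hμ, -⟩, hgμ⟩ := intermediate_value_Icc' hM hgc.continuousOn ⟨hgM, hg0⟩
  have hin : (0 ≤ s + μ * p ∧ 0 ≤ 1 - (s + μ * p)) ∧ 0 ≤ t + μ * q ∧ 0 ≤ 1 - (t + μ * q) := by
    have := hgμ.ge
    simpa only [hg, le_min_iff] using this
  have hbd : s + μ * p = 0 ∨ s + μ * p = 1 ∨ t + μ * q = 0 ∨ t + μ * q = 1 := by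
    have := hgμ.le
    simp only [hg, min_le_iff] at this
    rcases this with (h | h) | (h | h)
    · exact Or.inl (le_antisymm h hin.1.1)
    · right; left; linarith [hin.1.2]
    · right; right; left; exact le_antisymm h hin.2.1
    · right; right; right; linarith [hin.2.2]
  have hWμ : lerp A B (s + μ * p) - lerp C D (t + μ * q) = ((1 - μ * κ : ℝ) : ℂ) * W := by
    have : lerp A B (s + μ * p) - lerp C D (t + μ * q) =
        W + (μ : ℂ) * ((p : ℂ) * (B - A) - (q : ℂ) * (D - C)) := by
      rw [hW]; simp only [lerp]; push_cast; ring
    rw [this, he]; push_cast; ring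
  have hlt := hre _ _ hin.1.1 (by linarith [hin.1.2]) hin.2.1 (by linarith [hin.2.2])
  rw [hWμ, Complex.re_ofReal_mul] at hlt
  -- The first segment stays left of the second one, so the difference cannot shrink through zero
  -- and change its sign.
  have h1 : 0 ≤ 1 - μ * κ := by
    by_contra! hneg
    nlinarith [mul_pos_of_neg_of_neg hneg hWre]
  refine ⟨_, _, hin.1.1, by linarith [hin.1.2], hin.2.1, by linarith [hin.2.2], hbd, ?_⟩
  rw [hWμ, norm_mul, Complex.norm_real, Real.norm_of_nonneg h1]
  have : 0 ≤ μ * κ := mul_nonneg hμ hκ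
  nlinarith [norm_nonneg W]

/-- The inner product conditions put the foot of the perpendicular from `u` onto the segment from
`0` to `v`, and the distance to the foot is `|cross u v| / ‖v‖`. -/
theorem exists_close_of_inner {u v : ℂ} (h₀ : 0 ≤ u.re * v.re + u.im * v.im)
    (h₁ : u.re * v.re + u.im * v.im ≤ ‖v‖ ^ 2) (hv : 0 < ‖v‖) (h₂ : cross u v ^ 2 ≤ 4 * ‖v‖ ^ 2) :
    ∃ t : ℝ, 0 ≤ t ∧ t ≤ 1 ∧ ‖u - (t : ℂ) * v‖ ≤ 2 := by
  have hv2 : 0 < ‖v‖ ^ 2 := by positivity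
  refine ⟨(u.re * v.re + u.im * v.im) / ‖v‖ ^ 2, by positivity, by rwa [div_le_one hv2], ?_⟩
  set t := (u.re * v.re + u.im * v.im) / ‖v‖ ^ 2 with ht
  have htv : t * ‖v‖ ^ 2 = u.re * v.re + u.im * v.im := by rw [ht]; field_simp
  have e : ‖u - (t : ℂ) * v‖ ^ 2 * ‖v‖ ^ 2 = cross u v ^ 2 := by
    have e₁ : ‖v‖ ^ 2 = v.re ^ 2 + v.im ^ 2 := by
      rw [Complex.sq_norm, Complex.normSq_apply]; ring
    have e₂ : ‖u - (t : ℂ) * v‖ ^ 2 = (u.re - t * v.re) ^ 2 + (u.im - t * v.im) ^ 2 := by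
      rw [Complex.sq_norm, Complex.normSq_apply]
      simp only [Complex.sub_re, Complex.sub_im, Complex.re_ofReal_mul, Complex.im_ofReal_mul]
      ring
    rw [e₁] at htv
    rw [e₁, e₂, cross]
    linear_combination (t * (v.re ^ 2 + v.im ^ 2) - (u.re * v.re + u.im * v.im)) * htv
  have : ‖u - (t : ℂ) * v‖ ^ 2 ≤ 4 := by
    by_contra! hlt
    nlinarith
  nlinarith [norm_nonneg (u - (t : ℂ) * v)]

/-- At a sharp angle of `π - 2 * h`, the end of the shorter side is close to the longer one. -/
theorem exists_close_of_mul_cos_le {u v : ℂ} {h : ℝ} (hu : 2 < ‖u‖) (huv : ‖u‖ ≤ ‖v‖)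
    (hc : ‖u‖ * cos h ≤ 1) (hcos : 0 < cos h)
    (hi : u.re * v.re + u.im * v.im = -(‖u‖ * ‖v‖ * (2 * cos h ^ 2 - 1)))
    (hx : cross u v ^ 2 = (‖u‖ * ‖v‖ * (2 * sin h * cos h)) ^ 2) :
    ∃ t : ℝ, 0 ≤ t ∧ t ≤ 1 ∧ ‖u - (t : ℂ) * v‖ ≤ 2 := by
  have hv : 0 < ‖v‖ := by linarith
  have hc2 : cos h < 1 / 2 := by nlinarith
  have hc3 : 0 ≤ 1 - 2 * cos h ^ 2 := by nlinarith
  have huv' : 0 ≤ ‖u‖ * ‖v‖ := by positivity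
  have hsin : sin h ^ 2 ≤ 1 := sin_sq_le_one h
  refine exists_close_of_inner ?_ ?_ hv ?_
  · rw [hi]
    have := mul_nonneg huv' hc3
    linarith
  · rw [hi]
    have h₁ : ‖u‖ * ‖v‖ ≤ ‖v‖ ^ 2 := by
      rw [sq]; exact mul_le_mul_of_nonneg_right huv hv.le
    have h₂ := mul_le_of_le_one_right huv' (show 1 - 2 * cos h ^ 2 ≤ 1 by
      linarith [sq_nonneg (cos h)])
    linarith
  · rw [hx]
    -- The end of `u` has distance `2 * ‖u‖ * cos h * |sin h|` from the line of `v`, and `‖u‖ * cos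
    -- h ≤ 1`.
    have e : (‖u‖ * ‖v‖ * (2 * sin h * cos h)) ^ 2 =
        4 * ‖v‖ ^ 2 * ((‖u‖ * cos h) ^ 2 * sin h ^ 2) := by ring
    have e₁ : (‖u‖ * cos h) ^ 2 ≤ 1 := pow_le_one₀ (by positivity) hc
    have e₂ : (‖u‖ * cos h) ^ 2 * sin h ^ 2 ≤ 1 := mul_le_one₀ e₁ (sq_nonneg _) hsin
    rw [e]
    exact mul_le_of_le_one_right (by positivity) e₂

/-- A ray that ends at a unit circle as a tangent and a ray that leaves the circle as a tangent
after less than half a turn are disjoint. -/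
theorem tangent_rays_disjoint {z : ℂ} {τ : Side} {θ₁ θ₂ t₁ t₂ : ℝ}
    (h₀ : 0 ≤ τ.sign * (θ₂ - θ₁)) (hπ : τ.sign * (θ₂ - θ₁) < π) (ht₁ : 0 < t₁) (ht₂ : 0 ≤ t₂) :
    touchPoint z τ θ₁ - (t₁ : ℂ) * dir θ₁ ≠ touchPoint z τ θ₂ + (t₂ : ℂ) * dir θ₂ := by
  intro h
  have e₁ := congrArg (lat θ₁) h
  have e₂ := congrArg (lon θ₁) h
  simp only [lat_sub, lon_sub, lat_add, lon_add, lat_touchPoint, lon_touchPoint, lat_ofReal_mul,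
    lon_ofReal_mul, lat_dir, lon_dir, sub_self, sin_zero, cos_zero] at e₁ e₂
  rcases h₀.eq_or_lt with h | h
  · have : θ₂ - θ₁ = 0 := by
      rcases mul_eq_zero.mp h.symm with h' | h'
      · have := τ.sign_sq; rw [h'] at this; norm_num at this
      · exact h'
    rw [this, sin_zero, cos_zero] at e₂
    linarith
  · have hs : 0 < τ.sign * sin (θ₂ - θ₁) := by
      cases τ with
      | left =>
        rw [Side.sign_left, one_mul] at *
        exact sin_pos_of_pos_of_lt_pi h hπ
      | right =>
        rw [Side.sign_right, neg_one_mul] at *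
        rw [← sin_neg]
        exact sin_pos_of_pos_of_lt_pi h hπ
    have h2 := τ.sign_sq
    have h3 := cos_le_one (θ₂ - θ₁)
    have h4 : t₂ * (τ.sign * sin (θ₂ - θ₁)) = cos (θ₂ - θ₁) - 1 := by
      linear_combination (-τ.sign) * e₁ + (cos (θ₂ - θ₁) - 1) * h2
    have h5 := mul_nonneg ht₂ hs.le
    have h6 : cos (θ₂ - θ₁) = 1 := by linarith
    have h7 : sin (θ₂ - θ₁) = 0 := by
      have := sin_sq_add_cos_sq (θ₂ - θ₁)
      rw [h6] at this
      nlinarith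
    rw [h7, mul_zero] at hs
    exact lt_irrefl 0 hs

namespace SeparatedSeq

variable {z : ℕ → ℂ} {n : ℕ} (S : SeparatedSeq z n)
include S

theorem two_lt_lerp_right {i j k : ℕ} (hij : i < j) (hjk : j < k) (hk : k < n) {t : ℝ}
    (h₀ : 0 ≤ t) (h₁ : t ≤ 1) : 2 < ‖lerp (z i) (z j) t - z k‖ := by
  have := S.two_lt_right i j k hij hjk hk t h₀ h₁
  rwa [← lerp, lerp_sub_const] at this

theorem two_lt_lerp_left {i j k : ℕ} (hij : i < j) (hjk : j < k) (hk : k < n) {t : ℝ}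
    (h₀ : 0 ≤ t) (h₁ : t ≤ 1) : 2 < ‖lerp (z j) (z k) t - z i‖ := by
  have := S.two_lt_left i j k hij hjk hk t h₀ h₁
  rwa [← lerp, lerp_sub_const] at this

theorem one_lt_norm_of_nearSegment {r q j : ℕ} (hrq : r < q) (hq : q < n) (hj : j < n)
    (h : j < r ∨ q < j) {x : ℂ} (hx : NearSegment (z r) (z q) x) : 1 < ‖x - z j‖ := by
  obtain ⟨t, h₀, h₁, ht⟩ := hx
  have h2 : 2 < ‖lerp (z r) (z q) t - z j‖ := by
    rcases h with h | h
    · exact S.two_lt_lerp_left h hrq hq h₀ h₁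
    · exact S.two_lt_lerp_right hrq h hj h₀ h₁
  have h3 : ‖lerp (z r) (z q) t - z j‖ ≤ ‖x - lerp (z r) (z q) t‖ + ‖x - z j‖ := by
    rw [norm_sub_rev x]
    exact norm_sub_le_norm_sub_add_norm_sub _ _ _
  linarith

/-- A common point would bring the two center segments within distance two. By `exists_end_close` an
end of one is then that close to the other, which separation forbids in each of the four cases. -/
theorem not_nearSegment {i j k l : ℕ} (hij : i < j) (hjk : j < k) (hkl : k < l) (hl : l < n)
    {x : ℂ} (h₁ : NearSegment (z i) (z j) x) : ¬ NearSegment (z k) (z l) x := by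
  rintro ⟨t, ht₀, ht₁, ht⟩
  obtain ⟨s, hs₀, hs₁, hs⟩ := h₁
  have hk := hkl.trans hl
  have hj := hjk.trans hk
  have h : ‖lerp (z i) (z j) s - lerp (z k) (z l) t‖ ≤ 2 := by
    have := norm_sub_le_norm_sub_add_norm_sub (lerp (z i) (z j) s) x (lerp (z k) (z l) t)
    rw [norm_sub_rev _ x] at this
    linarith
  obtain ⟨s, t, a₁, a₂, a₃, a₄, a₅, a₆⟩ := exists_end_close (S.re_lt i j hij hj)
    (S.re_lt j k hjk hk) (S.re_lt k l hkl hl) hs₀ hs₁ ht₀ ht₁ h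
  have e₀ : ∀ u v : ℂ, lerp u v 0 = u := fun u v => by simp [lerp]
  have e₁ : ∀ u v : ℂ, lerp u v 1 = v := fun u v => by simp [lerp]
  rcases a₅ with rfl | rfl | rfl | rfl
  · rw [e₀, norm_sub_rev] at a₆
    exact a₆.not_gt (S.two_lt_lerp_left (hij.trans hjk) hkl hl a₃ a₄)
  · rw [e₁, norm_sub_rev] at a₆
    exact a₆.not_gt (S.two_lt_lerp_left hjk hkl hl a₃ a₄)
  · rw [e₀] at a₆
    exact a₆.not_gt (S.two_lt_lerp_right hij hjk hk a₁ a₂)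
  · rw [e₁] at a₆
    exact a₆.not_gt (S.two_lt_lerp_right hij (hjk.trans hkl) hl a₁ a₂)

/-- The disks `r` and `w` are disjoint from the bisector of the angle at `q`. -/
theorem one_lt_mul_cos {r q w : ℕ} (hrq : r < q) (hqw : q < w) (hw : w < n) :
    1 < ‖z q - z r‖ * cos (((z w - z q).arg - (z q - z r).arg) / 2) ∧
      1 < ‖z w - z q‖ * cos (((z w - z q).arg - (z q - z r).arg) / 2) := by
  have hq := hqw.trans hw
  have a₁ := S.arg_mem hrq hq
  have a₂ := S.arg_mem hqw hw
  have d₁ := S.two_lt r q hrq hq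
  have d₂ := S.two_lt q w hqw hw
  have l₁ := fun t => S.two_lt_lerp_right hrq hqw hw (t := t)
  have l₂ := fun t => S.two_lt_lerp_left hrq hqw hw (t := t)
  have x₁ := Complex.norm_mul_cos_arg (z q - z r)
  have y₁ := Complex.norm_mul_sin_arg (z q - z r)
  have x₂ := Complex.norm_mul_cos_arg (z w - z q)
  have y₂ := Complex.norm_mul_sin_arg (z w - z q)
  set a := z q - z r with ha
  set b := z w - z q with hb
  set h := (b.arg - a.arg) / 2 with hh
  have hba : b.arg - a.arg = 2 * h := by rw [hh]; ring
  have hcos : 0 < cos h := cos_pos_of_mem_Ioo ⟨by rw [hh]; linarith, by rw [hh]; linarith⟩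
  have hinner : a.re * b.re + a.im * b.im = ‖a‖ * ‖b‖ * (2 * cos h ^ 2 - 1) := by
    rw [← cos_two_mul, ← hba, cos_sub, ← x₁, ← x₂, ← y₁, ← y₂]; ring
  have hcross : cross a b = ‖a‖ * ‖b‖ * (2 * sin h * cos h) := by
    rw [← sin_two_mul, ← hba, cross_eq_norm_mul_sin]
  -- The quantity `‖a‖ * cos h` is the distance of `z r` from the bisector at `z q`. If it were at
  -- most one, the end of the shorter side would be within two of the longer side. The bound for the
  -- longer side then follows from that for the shorter one.
  have hA : ‖a‖ ≤ ‖b‖ → 1 < ‖a‖ * cos h := by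
    intro hab
    by_contra! hc
    obtain ⟨t, t₀, t₁, ht⟩ := exists_close_of_mul_cos_le (u := -a) (v := b) (h := h)
      (by rwa [norm_neg]) (by rwa [norm_neg]) (by rwa [norm_neg]) hcos
      (by rw [norm_neg, ← hinner, Complex.neg_re, Complex.neg_im]; ring)
      (by rw [norm_neg, ← hcross, cross, cross, Complex.neg_re, Complex.neg_im]; ring)
    refine ht.not_gt ?_
    have e : lerp (z q) (z w) t - z r = -(-a - (t : ℂ) * b) := by
      rw [ha, hb]; simp only [lerp, Complex.ofReal_sub, Complex.ofReal_one]; ring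
    have := l₂ t t₀ t₁
    rwa [e, norm_neg] at this
  have hB : ‖b‖ ≤ ‖a‖ → 1 < ‖b‖ * cos h := by
    intro hab
    by_contra! hc
    obtain ⟨t, t₀, t₁, ht⟩ := exists_close_of_mul_cos_le (u := b) (v := -a) (h := h)
      d₂ (by rwa [norm_neg]) hc hcos
      (by rw [norm_neg, mul_comm ‖b‖, ← hinner, Complex.neg_re, Complex.neg_im]; ring)
      (by rw [norm_neg, mul_comm ‖b‖, ← hcross, cross, cross, Complex.neg_re, Complex.neg_im]; ring)
    refine ht.not_gt ?_
    have e : lerp (z r) (z q) (1 - t) - z w = -(b - (t : ℂ) * -a) := by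
      rw [ha, hb]; simp only [lerp, Complex.ofReal_sub, Complex.ofReal_one]; ring
    have := l₁ (1 - t) (by linarith) (by linarith)
    rwa [e, norm_neg] at this
  rcases le_total ‖a‖ ‖b‖ with hab | hab
  · have := hA hab
    exact ⟨this, by nlinarith⟩
  · have := hB hab
    exact ⟨by nlinarith, this⟩

/-- The segment of a tangent from `r` to `q` ends on the disk `q`. -/
theorem touchPoint_add_lon {r q : ℕ} (ρ τ : Side) (hrq : r < q) (hq : q < n) :
    touchPoint (z r) ρ (tangentDir z r ρ q τ) +
      (lon (tangentDir z r ρ q τ) (z q - z r) : ℂ) * dir (tangentDir z r ρ q τ) =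
    touchPoint (z q) τ (tangentDir z r ρ q τ) := by
  have := lat_bitangentAngle (S.two_lt r q hrq hq) (ρ.abs_sub_le τ)
  change lat (tangentDir z r ρ q τ) _ = _ at this
  set θ := tangentDir z r ρ q τ
  rw [lat_sub] at this
  refine eq_of_lon_eq_of_lat_eq (φ := θ) ?_ ?_
  · simp only [lon_add, lon_touchPoint, lon_sub, lon_ofReal_mul, lon_dir, sub_self, sin_zero,
      cos_zero]
    ring
  · simp only [lat_add, lat_touchPoint, lat_ofReal_mul, lat_dir, sub_self, sin_zero, cos_zero]
    linarith

theorem lon_tangentDir_pos {r q : ℕ} (ρ τ : Side) (hrq : r < q) (hq : q < n) :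
    0 < lon (tangentDir z r ρ q τ) (z q - z r) :=
  lon_bitangentAngle_pos (S.two_lt r q hrq hq) (ρ.abs_sub_le τ)

/-- Consecutive segments of a tight path are disjoint. -/
theorem consecutive_segments_disjoint {r q w : ℕ} {ρ τ υ : Side} (hrq : r < q) (hqw : q < w)
    (hw : w < n)
    (h : 0 ≤ τ.sign * (tangentDir z q τ w υ - tangentDir z r ρ q τ)) {t₁ t₂ : ℝ} (ht₁ : 0 < t₁)
    (ht₁' : t₁ ≤ lon (tangentDir z r ρ q τ) (z q - z r)) (ht₂ : 0 ≤ t₂)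
    (ht₂' : t₂ ≤ lon (tangentDir z q τ w υ) (z w - z q)) :
    touchPoint (z q) τ (tangentDir z r ρ q τ) - (t₁ : ℂ) * dir (tangentDir z r ρ q τ) ≠
      touchPoint (z q) τ (tangentDir z q τ w υ) + (t₂ : ℂ) * dir (tangentDir z q τ w υ) := by
  have hq := hqw.trans hw
  have a₁ := S.arg_mem hrq hq
  have a₂ := S.arg_mem hqw hw
  have b₁ := S.lt_tangentDir ρ τ hrq hq
  have b₁' := S.tangentDir_lt ρ τ hrq hq
  have b₂ := S.lt_tangentDir τ υ hqw hw
  have b₂' := S.tangentDir_lt τ υ hqw hw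
  rcases lt_or_ge (τ.sign * ((z w - z q).arg - (z q - z r).arg)) 0 with hlt | hge
  -- The center path turns the other way, so the turn of the belt on the common disk stays below
  -- `π`.
  · refine tangent_rays_disjoint h ?_ ht₁ ht₂
    cases τ with
    | left => rw [Side.sign_left, one_mul] at *; linarith
    | right => rw [Side.sign_right, neg_one_mul] at *; linarith
  · intro e
    -- The bisector is the line through `z q` normal to the mean direction `m`. The first segment
    -- lies strictly before it and the second one on it or beyond it, since the outer disks do not
    -- reach it.
    obtain ⟨c₁, c₂⟩ := S.one_lt_mul_cos hrq hqw hw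
    have p₁ := S.touchPoint_add_lon ρ τ hrq hq
    have p₂ := S.touchPoint_add_lon τ υ hqw hw
    have f₁ : 0 ≤ τ.sign * ((z q - z r).arg - tangentDir z r ρ q τ) := by
      cases τ with
      | left => rw [Side.sign_left]; linarith [tangentDir_to_left_le_arg z r q ρ]
      | right => rw [Side.sign_right]; linarith [arg_le_tangentDir_to_right z r q ρ]
    have f₂ : 0 ≤ τ.sign * (tangentDir z q τ w υ - (z w - z q).arg) := by
      cases τ with
      | left => rw [Side.sign_left]; linarith [arg_le_tangentDir_of_left z q w υ]
      | right => rw [Side.sign_right]; linarith [tangentDir_le_arg_of_right z q w υ]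
    set α := (z q - z r).arg with hα
    set β := (z w - z q).arg with hβ
    set θ₁ := tangentDir z r ρ q τ
    set θ₂ := tangentDir z q τ w υ
    set m := (α + β) / 2 with hm
    -- the disk `q` is touched on the correct sides of the bisector
    have g₁ : τ.sign * sin (θ₁ - m) ≤ 0 := by
      cases τ with
      | left =>
        rw [Side.sign_left, one_mul] at *
        exact sin_nonpos_of_nonpos_of_neg_pi_le (by linarith) (by linarith)
      | right =>
        rw [Side.sign_right, neg_one_mul] at *
        linarith [sin_nonneg_of_nonneg_of_le_pi (x := θ₁ - m) (by linarith) (by linarith)]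
    have g₂ : 0 ≤ τ.sign * sin (θ₂ - m) := by
      cases τ with
      | left =>
        rw [Side.sign_left, one_mul] at *
        exact sin_nonneg_of_nonneg_of_le_pi (by linarith) (by linarith)
      | right =>
        rw [Side.sign_right, neg_one_mul] at *
        linarith [sin_nonpos_of_nonpos_of_neg_pi_le (x := θ₂ - m) (by linarith) (by linarith)]
    have k₁ : lon m (z q - z r) = ‖z q - z r‖ * cos ((β - α) / 2) := by
      rw [lon_eq_norm_mul_cos, ← cos_neg, ← hα, hm]; congr 2; ring
    have k₂ : lon m (z w - z q) = ‖z w - z q‖ * cos ((β - α) / 2) := by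
      rw [lon_eq_norm_mul_cos, ← hβ, hm]; congr 2; ring
    rw [lon_sub] at k₁ k₂
    have q₁ := congrArg (lon m) p₁
    have q₂ := congrArg (lon m) p₂
    have e' := congrArg (lon m) e
    simp only [lon_add, lon_sub, lon_touchPoint, lon_ofReal_mul, lon_dir] at q₁ q₂ e'
    have s₁ : ρ.sign * sin (θ₁ - m) ≤ 1 := by
      have := abs_le.mp (abs_sin_le_one (θ₁ - m))
      cases ρ <;> simp only [Side.sign] <;> linarith
    have s₂ : -1 ≤ υ.sign * sin (θ₂ - m) := by
      have := abs_le.mp (abs_sin_le_one (θ₂ - m))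
      cases υ <;> simp only [Side.sign] <;> linarith
    set L₁ := lon θ₁ (z q) - lon θ₁ (z r)
    set L₂ := lon θ₂ (z w) - lon θ₂ (z q)
    rw [lon_sub] at ht₁' ht₂'
    have hL₁ : 0 < L₁ := ht₁.trans_le ht₁'
    -- both points on their sides
    have u₁ : τ.sign * sin (θ₁ - m) - t₁ * cos (θ₁ - m) < 0 := by
      have : τ.sign * sin (θ₁ - m) - L₁ * cos (θ₁ - m) < 0 := by linarith
      by_contra! hcon
      nlinarith [mul_nonneg hL₁.le hcon, mul_nonneg (sub_nonneg.mpr ht₁') (neg_nonneg.mpr g₁)]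
    have u₂ : 0 ≤ τ.sign * sin (θ₂ - m) + t₂ * cos (θ₂ - m) := by
      have : 0 < τ.sign * sin (θ₂ - m) + L₂ * cos (θ₂ - m) := by linarith
      rcases ht₂.eq_or_lt with h0 | h0
      · rw [← h0]; linarith
      · have hL₂ : 0 < L₂ := h0.trans_le ht₂'
        by_contra! hcon
        nlinarith [mul_nonneg (sub_nonneg.mpr ht₂') g₂]
    linarith

end SeparatedSeq

end
end ConveyorBelt

/-! ### A tight lower path and the upper hull form a simple closed belt. -/

namespace ConveyorBelt
noncomputable section
open Real

/-! ### Belts that follow a tight lower path and the upper hull -/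

/-- A cyclic sequence of contacts that leads from the first disk along a tight path to the last one
and back along the upper hull. -/
structure BeltSeq (z : ℕ → ℂ) (n m N : ℕ) (K : ℕ → ℕ × Side) : Prop where
  sep : SeparatedSeq z n
  pos : 0 < m
  lt : m < N
  first : K 0 = (0, .left)
  last : K m = (n - 1, .left)
  closed : K N = (0, .left)
  index_lt : ∀ k, k < m → (K k).1 < (K (k + 1)).1
  avoid : ∀ k, k < m → ∀ j, (K k).1 < j → j < (K (k + 1)).1 →
    tangentDir z (K k).1 (K k).2 (K (k + 1)).1 (K (k + 1)).2 < tangentDir z (K k).1 (K k).2 j .left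
  tight : ∀ k, k + 1 < m → 0 ≤ (K (k + 1)).2.sign *
    (tangentDir z (K (k + 1)).1 (K (k + 1)).2 (K (k + 2)).1 (K (k + 2)).2 -
      tangentDir z (K k).1 (K k).2 (K (k + 1)).1 (K (k + 1)).2)
  right : ∀ k, k < m → (K k).2 = .right → ¬ HullIndex z n (K k).1
  upper : ∀ k, m ≤ k → k < N → HullStep z n (K (k + 1)).1 (K k).1
  upper_left : ∀ k, m ≤ k → k < N → (K k).2 = .left
  visit : ∀ i, i < n → ∃ k < N, (K k).1 = i

/-- The point `x` lies strictly below all upper supporting lines of the disks. -/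
def BelowHull (z : ℕ → ℂ) (n : ℕ) (x : ℂ) : Prop :=
  ∀ s i, i < n → Supports z n s i → lat s x < lat s (z i) + 1

/-- The point `x` lies on an upper supporting line of the disks. -/
def OnHull (z : ℕ → ℂ) (n : ℕ) (x : ℂ) : Prop :=
  ∃ s i, i < n ∧ Supports z n s i ∧ lat s x = lat s (z i) + 1

theorem BelowHull.not_onHull {z : ℕ → ℂ} {n : ℕ} {x : ℂ} (h : BelowHull z n x) :
    ¬ OnHull z n x := by
  rintro ⟨s, i, hi, hs, e⟩
  exact (h s i hi hs).ne e

theorem OnHull.one_le {z : ℕ → ℂ} {n : ℕ} {x : ℂ} (h : OnHull z n x) {j : ℕ} (hj : j < n) :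
    1 ≤ ‖x - z j‖ := by
  obtain ⟨s, i, -, hs, e⟩ := h
  have h₁ := (abs_le.mp (abs_lat_le s (x - z j))).2
  rw [lat_sub] at h₁
  linarith [hs.le j hj]

theorem neg_one_lt_cos {x : ℝ} (h₁ : -π < x) (h₂ : x < π) : -1 < cos x := by
  have h : 0 < cos (x / 2) := cos_pos_of_mem_Ioo ⟨by linarith, by linarith⟩
  have e : cos x = 2 * cos (x / 2) ^ 2 - 1 := by rw [← cos_two_mul]; congr 1; ring
  rw [e]; nlinarith

/-- A point of a disk kept on the left reaches a supporting line of that disk only when the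
direction is opposite to that of the line, which `h₁` excludes. A disk kept on the right is not on
the hull, so its center is already strictly below every supporting line. -/
theorem belowHull_touchPoint {z : ℕ → ℂ} {n r : ℕ} (S : SeparatedSeq z n) (hr : r < n) {ρ : Side}
    {θ : ℝ} (h₁ : ρ = .left → ∀ s, Supports z n s r → s - π < θ ∧ θ < s + π)
    (h₂ : ρ = .right → ¬ HullIndex z n r) : BelowHull z n (touchPoint (z r) ρ θ) := by
  intro s i _ hs
  rw [lat_touchPoint]
  have hc := abs_le.mp (abs_cos_le_one (θ - s))
  rcases (hs.le r hr).eq_or_lt with e | e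
  · have hsr := hs.of_le e.ge
    cases ρ with
    | left =>
      obtain ⟨a, b⟩ := h₁ rfl s hsr
      have := neg_one_lt_cos (x := θ - s) (by linarith) (by linarith)
      rw [Side.sign_left]; linarith
    | right => exact absurd (hsr.hullIndex S) (h₂ rfl)
  · cases ρ with
    | left => rw [Side.sign_left]; linarith
    | right => rw [Side.sign_right]; linarith

/-! ### Points of a common tangent segment -/

section
variable {u v : ℂ} {ρ τ : Side} {θ L : ℝ}

theorem tangent_point_eq_lerp (hL : 0 < L)
    (h : touchPoint u ρ θ + (L : ℂ) * dir θ = touchPoint v τ θ) (t : ℝ) :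
    touchPoint u ρ θ + (t : ℂ) * dir θ = lerp (touchPoint u ρ θ) (touchPoint v τ θ) (t / L) := by
  have : (L : ℂ) ≠ 0 := by exact_mod_cast hL.ne'
  rw [← h, lerp, Complex.ofReal_sub, Complex.ofReal_one, Complex.ofReal_div]
  field_simp
  ring

theorem nearSegment_tangent (hL : 0 < L)
    (h : touchPoint u ρ θ + (L : ℂ) * dir θ = touchPoint v τ θ) {t : ℝ} (h₀ : 0 ≤ t)
    (h₁ : t ≤ L) : NearSegment u v (touchPoint u ρ θ + (t : ℂ) * dir θ) := by
  rw [tangent_point_eq_lerp hL h]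
  exact nearSegment_lerp (mem_sphere_iff_norm.mp (touchPoint_mem_sphere u ρ θ)).le
    (mem_sphere_iff_norm.mp (touchPoint_mem_sphere v τ θ)).le (div_nonneg h₀ hL.le)
    (by rwa [div_le_one hL])

theorem norm_sq_tangent (t : ℝ) :
    ‖touchPoint u ρ θ + (t : ℂ) * dir θ - u‖ ^ 2 = 1 + t ^ 2 := by
  rw [← lon_sq_add_lat_sq θ]
  simp only [lat_sub, lon_sub, lat_add, lon_add, lat_touchPoint, lon_touchPoint, lat_ofReal_mul,
    lon_ofReal_mul, lat_dir, lon_dir, sub_self, sin_zero, cos_zero]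
  linear_combination ρ.sign_sq

theorem tangent_point_eq_sub (h : touchPoint u ρ θ + (L : ℂ) * dir θ = touchPoint v τ θ) (t : ℝ) :
    touchPoint u ρ θ + (t : ℂ) * dir θ = touchPoint v τ θ - ((L - t : ℝ) : ℂ) * dir θ := by
  rw [← h, Complex.ofReal_sub]; ring

theorem one_lt_norm_tangent_end (h : touchPoint u ρ θ + (L : ℂ) * dir θ = touchPoint v τ θ) {t : ℝ}
    (h₁ : t < L) : 1 < ‖touchPoint u ρ θ + (t : ℂ) * dir θ - v‖ := by
  have e := norm_sq_tangent (u := v) (ρ := τ) (θ := θ) (-(L - t))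
  rw [Complex.ofReal_neg, neg_mul, ← sub_eq_add_neg, ← tangent_point_eq_sub h] at e
  nlinarith [norm_nonneg (touchPoint u ρ θ + (t : ℂ) * dir θ - v)]

theorem one_le_norm_tangent_start (t : ℝ) : 1 ≤ ‖touchPoint u ρ θ + (t : ℂ) * dir θ - u‖ := by
  have e := norm_sq_tangent (u := u) (ρ := ρ) (θ := θ) t
  nlinarith [norm_nonneg (touchPoint u ρ θ + (t : ℂ) * dir θ - u)]

theorem eq_zero_of_norm_tangent_start {t : ℝ}
    (h : ‖touchPoint u ρ θ + (t : ℂ) * dir θ - u‖ = 1) : t = 0 := by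
  have e := norm_sq_tangent (u := u) (ρ := ρ) (θ := θ) t
  rw [h] at e
  nlinarith

end

/-! ### The directions of the segments -/

/-- The direction of the segment after the `k`th contact. -/
def segDir (z : ℕ → ℂ) (m : ℕ) (K : ℕ → ℕ × Side) (k : ℕ) : ℝ :=
  if k < m then tangentDir z (K k).1 (K k).2 (K (k + 1)).1 (K (k + 1)).2
  else (z (K k).1 - z (K (k + 1)).1).arg + π

/-- The direction in which the `k`th contact is reached. -/
def reachDir (z : ℕ → ℂ) (m N : ℕ) (K : ℕ → ℕ × Side) : ℕ → ℝ
  | 0 => segDir z m K (N - 1) - 2 * π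
  | k + 1 => segDir z m K k

/-- The angle of the arc of the `k`th contact. -/
def arcAngle (z : ℕ → ℂ) (m N : ℕ) (K : ℕ → ℕ × Side) (k : ℕ) : ℝ :=
  if k < N then (K k).2.sign * (reachDir z m N K (k + 1) - reachDir z m N K k) else 0

/-- The length of the segment after the `k`th contact. -/
def segLength (z : ℕ → ℂ) (m N : ℕ) (K : ℕ → ℕ × Side) (k : ℕ) : ℝ :=
  if k < N then lon (segDir z m K k) (z (K (k + 1)).1 - z (K k).1) else 0

namespace BeltSeq

variable {z : ℕ → ℂ} {n m N : ℕ} {K : ℕ → ℕ × Side}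

theorem segDir_lower {k : ℕ} (hk : k < m) :
    segDir z m K k = tangentDir z (K k).1 (K k).2 (K (k + 1)).1 (K (k + 1)).2 := if_pos hk

theorem segDir_upper {k : ℕ} (hk : m ≤ k) :
    segDir z m K k = (z (K k).1 - z (K (k + 1)).1).arg + π := if_neg hk.not_gt

theorem segLength_eq {k : ℕ} (hk : k < N) :
    segLength z m N K k = lon (segDir z m K k) (z (K (k + 1)).1 - z (K k).1) := if_pos hk

variable (Q : BeltSeq z n m N K)
include Q

theorem lower_lt {i j : ℕ} (hij : i < j) (hj : j ≤ m) : (K i).1 < (K j).1 := by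
  induction j with
  | zero => omega
  | succ j ih =>
    rcases (Nat.lt_succ_iff.mp hij).eq_or_lt with rfl | h
    · exact Q.index_lt i hj
    · exact (ih h (by omega)).trans (Q.index_lt j hj)

theorem upper_lt {i j : ℕ} (hi : m ≤ i) (hij : i < j) (hj : j ≤ N) : (K j).1 < (K i).1 := by
  induction j with
  | zero => omega
  | succ j ih =>
    have := (Q.upper j (by omega) hj).lt
    rcases (Nat.lt_succ_iff.mp hij).eq_or_lt with rfl | h
    · exact this
    · exact this.trans (ih h (by omega))

theorem size_pos : 0 < n := by
  have := Q.upper m le_rfl Q.lt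
  have := this.lt_size
  omega

theorem index_lt_size {k : ℕ} (hk : k ≤ N) : (K k).1 < n := by
  have hn := Q.size_pos
  rcases le_or_gt k m with h | h
  · rcases h.eq_or_lt with rfl | h
    · rw [Q.last]; dsimp only; omega
    · have := Q.lower_lt h le_rfl
      rw [Q.last] at this; dsimp only at this; omega
  · have := Q.upper_lt le_rfl h hk
    rw [Q.last] at this; dsimp only at this; omega

theorem left_of_upper {k : ℕ} (hk : m ≤ k) (hkN : k ≤ N) : (K k).2 = .left := by
  rcases hkN.eq_or_lt with rfl | h
  · rw [Q.closed]
  · exact Q.upper_left k hk h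

theorem hull_of_upper {k : ℕ} (hk : m ≤ k) (hkN : k ≤ N) : HullIndex z n (K k).1 := by
  rcases hkN.eq_or_lt with rfl | h
  · rw [Q.closed]; exact hullIndex_zero
  · exact (Q.upper k hk h).right

/-- The line of an upper segment supports the disks at both ends. -/
theorem supports_start {k : ℕ} (hk : m ≤ k) (hkN : k < N) :
    Supports z n (segDir z m K k - π) (K k).1 := by
  rw [segDir_upper hk, add_sub_cancel_right]
  exact (Q.upper k hk hkN).supports_right Q.sep

theorem supports_end {k : ℕ} (hk : m ≤ k) (hkN : k < N) :
    Supports z n (segDir z m K k - π) (K (k + 1)).1 := by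
  rw [segDir_upper hk, add_sub_cancel_right]
  exact (Q.upper k hk hkN).supports_left Q.sep

/-- The chord to a later center is no steeper than a supporting line, and a left contact only raises
the bitangent above the chord, by less than `π/2`. So the departure stays away from the directions
`s ± π`. -/
theorem start_bounds {k : ℕ} (hk : k < m) (hl : (K k).2 = .left) {s : ℝ}
    (hs : Supports z n s (K k).1) : s - π < segDir z m K k ∧ segDir z m K k < s + π / 2 := by
  have h₁ := Q.index_lt k hk
  have h₂ := Q.index_lt_size (show k + 1 ≤ N by have := Q.lt; omega)
  rw [segDir_lower hk, hl]
  have h₃ := hs.arg_le Q.sep h₁ h₂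
  have h₄ := Q.sep.arg_mem h₁ h₂
  have h₅ := arg_le_tangentDir_of_left z (K k).1 (K (k + 1)).1 (K (k + 1)).2
  have h₆ := Q.sep.tangentDir_lt .left (K (k + 1)).2 h₁ h₂
  constructor <;> linarith [hs.lt]

theorem end_bounds {k : ℕ} (hk : k < m) (hl : (K (k + 1)).2 = .left) {s : ℝ}
    (hs : Supports z n s (K (k + 1)).1) :
    s - π / 2 < segDir z m K k ∧ segDir z m K k < s + π := by
  have h₁ := Q.index_lt k hk
  have h₂ := Q.index_lt_size (show k + 1 ≤ N by have := Q.lt; omega)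
  rw [segDir_lower hk, hl]
  have h₃ := hs.le_arg Q.sep h₁ h₂
  have h₄ := Q.sep.arg_mem h₁ h₂
  have h₅ := tangentDir_to_left_le_arg z (K k).1 (K (k + 1)).1 (K k).2
  have h₆ := Q.sep.lt_tangentDir (K k).2 .left h₁ h₂
  constructor <;> linarith [hs.neg_lt]

theorem lower_mem {k : ℕ} (hk : k < m) : -π < segDir z m K k ∧ segDir z m K k < π := by
  rw [segDir_lower hk]
  exact Q.sep.tangentDir_mem _ _ (Q.index_lt k hk)
    (Q.index_lt_size (by have := Q.lt; omega))

theorem upper_turn {k : ℕ} (hk : m < k) (hkN : k < N) :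
    0 ≤ segDir z m K k - segDir z m K (k - 1) ∧
      segDir z m K k - segDir z m K (k - 1) < π := by
  obtain ⟨j, rfl⟩ : ∃ j, k = j + 1 := ⟨k - 1, by omega⟩
  rw [Nat.add_sub_cancel]
  have h₁ := Q.supports_start hk.le hkN
  have h₂ := Q.supports_end (show m ≤ j by omega) (by omega)
  have h₃ := Q.upper j (by omega) (by omega)
  have h₄ := h₁.arg_le Q.sep h₃.lt h₃.lt_size
  rw [segDir_upper (show m ≤ j by omega)] at *
  constructor
  · linarith
  · linarith [h₁.lt, h₂.neg_lt]

/-- At inner lower contacts nonnegativity is tightness, and both directions lie in `(-π, π)`. At the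
two extreme disks a supporting direction separates the lower direction from the upper one; at `k =
0` the arrival is taken one full turn earlier. Along the hull the supporting directions are
monotone. -/
theorem turn {k : ℕ} (hk : k < N) :
    0 ≤ (K k).2.sign * (reachDir z m N K (k + 1) - reachDir z m N K k) ∧
      (K k).2.sign * (reachDir z m N K (k + 1) - reachDir z m N K k) < 2 * π := by
  have hm := Q.lt
  have hp := Q.pos
  cases k with
  | zero =>
    have h₁ := Q.supports_end (show m ≤ N - 1 by omega) (by omega)
    rw [Nat.sub_add_cancel (by omega : 1 ≤ N), Q.closed] at h₁
    have hK : (K 0).1 = 0 := by rw [Q.first]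
    have hK' : (K 0).2 = .left := by rw [Q.first]
    have h₂ := Q.start_bounds hp hK' (by rw [hK]; exact h₁)
    simp only [reachDir]
    rw [hK', Side.sign_left, one_mul]
    constructor <;> linarith [pi_pos]
  | succ k =>
    simp only [reachDir]
    rcases lt_trichotomy (k + 1) m with h | h | h
    · have h₁ := Q.tight k h
      have h₂ := Q.lower_mem h
      have h₃ := Q.lower_mem (show k < m by omega)
      refine ⟨by rw [segDir_lower h, segDir_lower (by omega : k < m)]; exact h₁, ?_⟩
      cases (K (k + 1)).2 with
      | left => rw [Side.sign_left]; linarith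
      | right => rw [Side.sign_right]; linarith
    · have h₁ := Q.supports_start h.ge hk
      have hl := Q.upper_left (k + 1) h.ge hk
      have h₂ := Q.end_bounds (show k < m by omega) hl h₁
      rw [hl, Side.sign_left, one_mul]
      constructor <;> linarith
    · have h₁ := Q.upper_turn h hk
      rw [Nat.add_sub_cancel] at h₁
      rw [Q.upper_left (k + 1) h.le hk, Side.sign_left, one_mul]
      exact ⟨h₁.1, by linarith [pi_pos]⟩

theorem segLength_pos {k : ℕ} (hk : k < N) : 0 < segLength z m N K k := by
  rw [segLength_eq hk]
  rcases lt_or_ge k m with h | h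
  · rw [segDir_lower h]
    exact Q.sep.lon_tangentDir_pos _ _ (Q.index_lt k h) (Q.index_lt_size hk)
  · have h₁ := Q.upper k h hk
    rw [segDir_upper h, ← neg_sub (z (K k).1) (z (K (k + 1)).1), lon_neg,
      lon_eq_norm_mul_cos, sub_add_cancel_left, cos_neg, cos_pi]
    linarith [Q.sep.two_lt _ _ h₁.lt h₁.lt_size]

theorem segment_eq {k : ℕ} (hk : k < N) :
    touchPoint (z (K k).1) (K k).2 (segDir z m K k) +
      (segLength z m N K k : ℂ) * dir (segDir z m K k) =
      touchPoint (z (K (k + 1)).1) (K (k + 1)).2 (segDir z m K k) := by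
  rw [segLength_eq hk]
  rcases lt_or_ge k m with h | h
  · rw [segDir_lower h]
    exact Q.sep.touchPoint_add_lon _ _ (Q.index_lt k h) (Q.index_lt_size hk)
  · have e := lat_arg_self (z (K k).1 - z (K (k + 1)).1)
    rw [Q.left_of_upper h hk.le, Q.left_of_upper (h.trans k.le_succ) hk]
    have e' : lat (segDir z m K k) (z (K k).1 - z (K (k + 1)).1) = 0 := by
      rw [segDir_upper h]
      rw [lat] at e ⊢
      rw [cos_add_pi, sin_add_pi]
      linarith
    rw [lat_sub] at e'
    refine eq_of_lon_eq_of_lat_eq (φ := segDir z m K k) ?_ ?_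
    · simp only [lon_add, lon_touchPoint, lon_sub, lon_ofReal_mul, lon_dir, sub_self, sin_zero,
        cos_zero]
      ring
    · simp only [lat_add, lat_touchPoint, lat_ofReal_mul, lat_dir, sub_self, sin_zero, cos_zero]
      linarith

/-! ### Positions of the points of the belt -/

theorem lower_start_below {k : ℕ} (hk : k < m) :
    BelowHull z n (touchPoint (z (K k).1) (K k).2 (segDir z m K k)) :=
  belowHull_touchPoint Q.sep (Q.index_lt_size (hk.le.trans Q.lt.le))
    (fun hl _ hs => ⟨(Q.start_bounds hk hl hs).1, by
      linarith [(Q.start_bounds hk hl hs).2, pi_pos]⟩) (Q.right k hk)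

theorem lower_end_below {k : ℕ} (hk : k < m) :
    BelowHull z n (touchPoint (z (K (k + 1)).1) (K (k + 1)).2 (segDir z m K k)) := by
  refine belowHull_touchPoint Q.sep (Q.index_lt_size (hk.trans Q.lt))
    (fun hl _ hs => ⟨by linarith [(Q.end_bounds hk hl hs).1, pi_pos], (Q.end_bounds hk hl hs).2⟩)
    (fun hr => ?_)
  rcases (show k + 1 ≤ m from hk).eq_or_lt with h | h
  · rw [h, Q.last] at hr; exact absurd hr (by simp)
  · exact Q.right (k + 1) h hr

/-- Both ends are strictly below every supporting line, and a half-plane is convex. -/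
theorem lower_segment_below {k : ℕ} (hk : k < m) {t : ℝ} (h₀ : 0 ≤ t)
    (h₁ : t < segLength z m N K k) :
    BelowHull z n (touchPoint (z (K k).1) (K k).2 (segDir z m K k) +
      (t : ℂ) * dir (segDir z m K k)) := by
  intro s i hi hs
  have hkN := hk.trans Q.lt
  have hL := Q.segLength_pos hkN
  rw [tangent_point_eq_lerp hL (Q.segment_eq hkN), lerp, lat_add, lat_ofReal_mul, lat_ofReal_mul]
  have e₁ := Q.lower_start_below hk s i hi hs
  have e₂ := Q.lower_end_below hk s i hi hs
  have e₃ : 0 ≤ t / segLength z m N K k := div_nonneg h₀ hL.le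
  have e₄ : t / segLength z m N K k < 1 := by rwa [div_lt_one hL]
  nlinarith

theorem upper_segment_on {k : ℕ} (hk : m ≤ k) (hkN : k < N) (t : ℝ) :
    OnHull z n (touchPoint (z (K k).1) (K k).2 (segDir z m K k) +
      (t : ℂ) * dir (segDir z m K k)) := by
  refine ⟨_, _, Q.index_lt_size hkN.le, Q.supports_start hk hkN, ?_⟩
  rw [Q.upper_left k hk hkN, lat_add, lat_touchPoint, lat_ofReal_mul, lat_dir, sub_sub_cancel,
    sin_pi, cos_pi, Side.sign_left]
  ring

theorem lower_arc_below {k : ℕ} (h0 : 0 < k) (hk : k < m) {t : ℝ} (h₀ : 0 ≤ t)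
    (h₁ : t < (K k).2.sign * (reachDir z m N K (k + 1) - reachDir z m N K k)) :
    BelowHull z n (touchPoint (z (K k).1) (K k).2
      (reachDir z m N K k + (K k).2.sign * t)) := by
  obtain ⟨j, rfl⟩ : ∃ j, k = j + 1 := ⟨k - 1, by omega⟩
  refine belowHull_touchPoint Q.sep (Q.index_lt_size (hk.le.trans Q.lt.le))
    (fun hl s hs => ?_) (Q.right _ hk)
  have e₁ := Q.start_bounds hk hl hs
  have e₂ := Q.end_bounds (show j < m by omega) hl hs
  simp only [reachDir] at h₁ ⊢
  rw [hl, Side.sign_left, one_mul] at h₁ ⊢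
  constructor <;> linarith [pi_pos]

/-- The directions on an upper arc run between those of two supporting lines of its disk, so each of
them is a supporting direction by `Supports.between`. -/
theorem upper_arc_on {k : ℕ} (hk : m < k) (hkN : k < N) {t : ℝ} (h₀ : 0 ≤ t)
    (h₁ : t < (K k).2.sign * (reachDir z m N K (k + 1) - reachDir z m N K k)) :
    OnHull z n (touchPoint (z (K k).1) (K k).2
      (reachDir z m N K k + (K k).2.sign * t)) := by
  obtain ⟨j, rfl⟩ : ∃ j, k = j + 1 := ⟨k - 1, by omega⟩
  have hl := Q.upper_left _ hk.le hkN
  simp only [reachDir] at h₁ ⊢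
  rw [hl, Side.sign_left, one_mul] at h₁ ⊢
  have e₁ := Q.supports_start hk.le hkN
  have e₂ := Q.supports_end (show m ≤ j by omega) (by omega)
  refine ⟨segDir z m K j + t - π, _, Q.index_lt_size hkN.le,
    e₂.between Q.sep (Q.index_lt_size hkN.le) e₁ (by linarith) (by linarith), ?_⟩
  rw [lat_touchPoint, sub_sub_cancel, cos_pi, Side.sign_left]
  ring

theorem segment_near {k : ℕ} (hk : k < N) {t : ℝ} (h₀ : 0 ≤ t)
    (h₁ : t < segLength z m N K k) :
    NearSegment (z (K k).1) (z (K (k + 1)).1) (touchPoint (z (K k).1) (K k).2 (segDir z m K k) +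
      (t : ℂ) * dir (segDir z m K k)) :=
  nearSegment_tangent (Q.segLength_pos hk) (Q.segment_eq hk) h₀ h₁.le

/-- A segment misses the other disks, except those that lie above the belt between the ends of an
upper segment. -/
theorem one_lt_norm_segment {k j : ℕ} (hk : k < N) (hj : j < n) (h₁ : j ≠ (K k).1)
    (h₂ : j ≠ (K (k + 1)).1) (h₃ : m ≤ k → HullIndex z n j) {t : ℝ} (ht₀ : 0 ≤ t)
    (ht₁ : t < segLength z m N K k) :
    1 < ‖touchPoint (z (K k).1) (K k).2 (segDir z m K k) + (t : ℂ) * dir (segDir z m K k) -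
      z j‖ := by
  have hnear := Q.segment_near hk ht₀ ht₁
  rcases lt_or_ge k m with h | h
  · have hlt := Q.index_lt k h
    have hn := Q.index_lt_size hk
    by_cases hb : j < (K k).1 ∨ (K (k + 1)).1 < j
    · exact Q.sep.one_lt_norm_of_nearSegment hlt hn hj hb hnear
    · have := Q.avoid k h j (by omega) (by omega)
      rw [← segDir_lower h] at this
      exact Q.sep.one_lt_dist_of_lt_tangentDir (by omega) hj this (Q.lower_mem h).1 ht₀
  · have hs := Q.upper k h hk
    by_cases hb : j < (K (k + 1)).1 ∨ (K k).1 < j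
    · exact Q.sep.one_lt_norm_of_nearSegment hs.lt hs.lt_size hj hb hnear.symm
    · exact absurd (h₃ h) (hs.not_between j (by omega) (by omega))

theorem one_le_norm_segment {k j : ℕ} (hk : k < N) (hj : j < n) {t : ℝ} (ht₀ : 0 ≤ t)
    (ht₁ : t < segLength z m N K k) :
    1 ≤ ‖touchPoint (z (K k).1) (K k).2 (segDir z m K k) + (t : ℂ) * dir (segDir z m K k) -
      z j‖ := by
  rcases lt_or_ge k m with h | h
  · by_cases h₁ : j = (K k).1
    · rw [h₁]; exact one_le_norm_tangent_start t
    · by_cases h₂ : j = (K (k + 1)).1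
      · rw [h₂]; exact (one_lt_norm_tangent_end (Q.segment_eq hk) ht₁).le
      · exact (Q.one_lt_norm_segment hk hj h₁ h₂ (fun h' => absurd h h'.not_gt) ht₀ ht₁).le
  · exact (Q.upper_segment_on h hk t).one_le hj

/-- A lower and an upper segment are distinguished by `BelowHull`. Two segments on the same part
that are not consecutive have disjoint index ranges. Consecutive lower ones need
`consecutive_segments_disjoint`, consecutive upper ones only a turn below `π`. -/
theorem segments_disjoint {i j : ℕ} (hij : i < j) (hj : j < N) {t u : ℝ} (ht₀ : 0 ≤ t)
    (ht₁ : t < segLength z m N K i) (hu₀ : 0 ≤ u) (hu₁ : u < segLength z m N K j) :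
    touchPoint (z (K i).1) (K i).2 (segDir z m K i) + (t : ℂ) * dir (segDir z m K i) ≠
      touchPoint (z (K j).1) (K j).2 (segDir z m K j) + (u : ℂ) * dir (segDir z m K j) := by
  intro e
  have hi := hij.trans hj
  have n₁ := Q.segment_near hi ht₀ ht₁
  have n₂ := Q.segment_near hj hu₀ hu₁
  rcases (Nat.succ_le_iff.mpr hij).eq_or_lt with h | h
  · rw [Nat.succ_eq_add_one] at h
    subst h
    rw [tangent_point_eq_sub (Q.segment_eq hi)] at e
    rcases lt_or_ge (i + 1) m with hm | hm
    · have hi' : i < m := by omega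
      rw [segLength_eq hi] at ht₁ e
      rw [segLength_eq hj] at hu₁
      rw [segDir_lower hm, segDir_lower hi'] at *
      exact Q.sep.consecutive_segments_disjoint (Q.index_lt i hi') (Q.index_lt (i + 1) hm)
        (Q.index_lt_size hj) (Q.tight i hm) (by linarith) (by linarith) hu₀ hu₁.le e
    · rcases hm.eq_or_lt with hm | hm
      · refine (Q.lower_segment_below (show i < m by omega) ht₀ ht₁).not_onHull ?_
        rw [tangent_point_eq_sub (Q.segment_eq hi), e]
        exact Q.upper_segment_on hm.le hj u
      · have h₁ := Q.upper_turn hm hj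
        rw [Nat.add_sub_cancel] at h₁
        refine tangent_rays_disjoint ?_ ?_ (sub_pos.mpr ht₁) hu₀ e
        · rw [Q.upper_left _ hm.le hj, Side.sign_left, one_mul]; exact h₁.1
        · rw [Q.upper_left _ hm.le hj, Side.sign_left, one_mul]; exact h₁.2
  · rcases lt_or_ge j m with hm | hm
    · rw [← e] at n₂
      exact Q.sep.not_nearSegment (Q.index_lt i (by omega)) (Q.lower_lt h hm.le) (Q.index_lt j hm)
        (Q.index_lt_size hj) n₁ n₂
    · rcases lt_or_ge i m with hm' | hm'
      · refine (Q.lower_segment_below hm' ht₀ ht₁).not_onHull ?_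
        rw [e]
        exact Q.upper_segment_on hm hj u
      · rw [← e] at n₂
        exact Q.sep.not_nearSegment (Q.upper j hm hj).lt
          (Q.upper_lt (by omega) h hj.le) (Q.upper i hm' hi).lt
          (Q.upper i hm' hi).lt_size n₂.symm n₁.symm

/-- Two contacts of the same disk are equal, or one of them is lower and the other one upper. -/
theorem eq_of_index_eq {i j : ℕ} (hi : i < N) (hj : j < N) (h : (K i).1 = (K j).1) :
    i = j ∨ (0 < i ∧ i < m ∧ m < j) ∨ (0 < j ∧ j < m ∧ m < i) := by
  rcases lt_trichotomy i j with hij | hij | hij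
  · right; left
    have h₁ : m < j := by
      by_contra! hle
      exact (Q.lower_lt hij hle).ne h
    have h₂ : i < m := by
      by_contra! hle
      exact (Q.upper_lt hle hij hj.le).ne h.symm
    refine ⟨Nat.pos_of_ne_zero ?_, h₂, h₁⟩
    rintro rfl
    have := Q.upper_lt h₁.le hj le_rfl
    rw [Q.closed, ← h, Q.first] at this
    exact lt_irrefl _ this
  · exact Or.inl hij
  · right; right
    have h₁ : m < i := by
      by_contra! hle
      exact (Q.lower_lt hij hle).ne h.symm
    have h₂ : j < m := by
      by_contra! hle
      exact (Q.upper_lt hle hij hi.le).ne h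
    refine ⟨Nat.pos_of_ne_zero ?_, h₂, h₁⟩
    rintro rfl
    have := Q.upper_lt h₁.le hi le_rfl
    rw [Q.closed, h, Q.first] at this
    exact lt_irrefl _ this

end BeltSeq

/-- A tight path and the upper hull together form a conveyor belt. -/
theorem BeltSeq.exists_conveyorBelt {z : ℕ → ℂ} {n m N : ℕ} {K : ℕ → ℕ × Side}
    (Q : BeltSeq z n m N K) {c : Fin n → ℂ} {F : ℕ → Fin n} (hF : ∀ i, i < n → (F i : ℕ) = i)
    (hc : ∀ q : Fin n, c q = z q) {B : List (Contact n)} (hB : B.length = N)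
    (hBK : ∀ j : Fin B.length, B.get j = (F (K j).1, (K j).2)) :
    ∃ (γ : ℝ → ℂ) (T : ℝ), Traces c B γ T ∧ IsConveyorBelt c γ T := by
  set K' : ℕ → Contact n := fun k => (F (K k).1, (K k).2) with hK'
  set θ := reachDir z m N K with hθ
  set δ := arcAngle z m N K with hδ
  set l := segLength z m N K with hl
  have hcF : ∀ i, i < n → c (F i) = z i := fun i hi => by rw [hc, hF i hi]
  have hcK : ∀ k, k ≤ N → c (K' k).1 = z (K k).1 := fun k hk => hcF _ (Q.index_lt_size hk)
  have hδeq : ∀ k, k < N → δ k = (K k).2.sign * (θ (k + 1) - θ k) := fun k hk => if_pos hk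
  have hδlt : ∀ k, k < N → δ k < 2 * π := fun k hk => by rw [hδeq k hk]; exact (Q.turn hk).2
  have hNpos : 0 < N := Q.pos.trans Q.lt
  have D : BeltData c N K' θ δ l := by
    refine ⟨fun j => ?_, fun j => ?_, fun j hj => ?_, fun j hj => ?_, ?_, ?_, ?_⟩
    · by_cases h : j < N
      · rw [hδeq j h]; exact (Q.turn h).1
      · rw [hδ, arcAngle, if_neg h]
    · by_cases h : j < N
      · exact (Q.segLength_pos h).le
      · rw [hl, segLength, if_neg h]
    · rw [hδeq j hj]
      linear_combination (-(θ (j + 1) - θ j)) * (K j).2.sign_sq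
    · rw [hcK j hj.le, hcK (j + 1) hj]
      exact Q.segment_eq hj
    · simp only [hK', Q.first, Q.closed]
    · obtain ⟨M, rfl⟩ : ∃ M, N = M + 1 := ⟨N - 1, by omega⟩
      simp only [hθ, reachDir, Nat.add_sub_cancel]; ring
    · refine Finset.sum_pos (fun j hj => ?_) ⟨0, Finset.mem_range.mpr hNpos⟩
      have hj := Finset.mem_range.mp hj
      have := Q.segLength_pos hj
      rw [hδeq j hj]
      linarith [(Q.turn hj).1]
  have harc : ∀ k < N, ∀ x ∈ arcSet c K' θ δ k, ∃ t, 0 ≤ t ∧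
      t < (K k).2.sign * (reachDir z m N K (k + 1) - reachDir z m N K k) ∧
      x = touchPoint (z (K k).1) (K k).2 (reachDir z m N K k + (K k).2.sign * t) := by
    rintro k hk x ⟨t, h₁, h₂, rfl⟩
    rw [hδeq k hk] at h₂
    exact ⟨t, h₁, h₂, by rw [hcK k hk.le]⟩
  have hseg : ∀ k < N, ∀ x ∈ segSet c K' θ l k, ∃ t, 0 ≤ t ∧ t < segLength z m N K k ∧
      x = touchPoint (z (K k).1) (K k).2 (segDir z m K k) + (t : ℂ) * dir (segDir z m K k) := by
    rintro k hk x ⟨t, h₁, h₂, rfl⟩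
    exact ⟨t, h₁, h₂, by rw [hcK k hk.le]; rfl⟩
  -- A disk may be visited twice, once from below and once on the hull. The two arcs differ because
  -- one lies strictly below the supporting lines and the other one on them.
  have hmixed : ∀ i j, 0 < i → i < m → m < j → j < N →
      Disjoint (arcSet c K' θ δ i) (arcSet c K' θ δ j) := by
    intro i j h₀ h₁ h₂ h₃
    rw [Set.disjoint_left]
    intro x hx hx'
    obtain ⟨t, a₁, a₂, rfl⟩ := harc i (by omega) x hx
    obtain ⟨u, b₁, b₂, e⟩ := harc j h₃ _ hx'
    exact (Q.lower_arc_below h₀ h₁ a₁ a₂).not_onHull (by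
      rw [e]; exact Q.upper_arc_on h₂ h₃ b₁ b₂)
  have hnear : ∀ i j, i < n → j < n → ∀ x : ℂ, ‖x - z i‖ ≤ 1 → ‖x - z j‖ ≤ 1 → i = j := by
    intro i j hi hj x h₁ h₂
    have h₃ := norm_sub_le_norm_sub_add_norm_sub (z i) x (z j)
    rw [norm_sub_rev _ x] at h₃
    rcases lt_trichotomy i j with h | h | h
    · have := Q.sep.two_lt i j h hj
      rw [norm_sub_rev] at this
      linarith
    · exact h
    · have := Q.sep.two_lt j i h hi
      linarith
  refine D.exists_conveyorBelt (fun j => ?_) (fun i => ?_) (fun j hj => Or.inl ?_)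
    (fun i j hj => ?_) (fun i j hij => ?_) (fun i hi j hj hij => ?_) (fun i hi j hj => ?_)
    (fun i hi j hj hij => ?_) hB hBK
  · by_cases h : j < N
    · exact (hδlt j h).le
    · rw [hδ, arcAngle, if_neg h]; positivity
  · obtain ⟨k, hk, e⟩ := Q.visit i i.2
    exact ⟨k, hk, Fin.ext (by simp only [hK']; rw [hF _ (Q.index_lt_size hk.le), e])⟩
  · intro e
    have := congrArg Fin.val e
    simp only [hK'] at this
    rw [hF _ (Q.index_lt_size hj.le), hF _ (Q.index_lt_size hj)] at this
    rcases lt_or_ge j m with h | h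
    · exact (Q.index_lt j h).ne this
    · exact (Q.upper j h hj).lt.ne this.symm
  · rw [Set.disjoint_left]
    intro x hx hx'
    obtain ⟨t, h₁, h₂, rfl⟩ := hseg j hj x hx
    rw [mem_ball_iff_norm, hc] at hx'
    exact hx'.not_ge (Q.one_le_norm_segment hj i.2 h₁ h₂)
  · rw [Set.disjoint_left]
    intro x hx hx'
    rw [disk, mem_closedBall_iff_norm, hc] at hx hx'
    exact hij (Fin.ext (hnear i j i.2 j.2 x hx hx'))
  · rw [Set.disjoint_left]
    intro x hx hx'
    obtain ⟨t, -, -, e₁⟩ := harc i hi x hx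
    obtain ⟨u, -, -, e₂⟩ := harc j hj x hx'
    have h₁ := mem_sphere_iff_norm.mp (touchPoint_mem_sphere (z (K i).1) (K i).2
      (reachDir z m N K i + (K i).2.sign * t))
    have h₂ := mem_sphere_iff_norm.mp (touchPoint_mem_sphere (z (K j).1) (K j).2
      (reachDir z m N K j + (K j).2.sign * u))
    rw [← e₁] at h₁
    rw [← e₂] at h₂
    rcases Q.eq_of_index_eq hi hj (hnear _ _ (Q.index_lt_size hi.le) (Q.index_lt_size hj.le) x
      h₁.le h₂.le) with h | ⟨a, b, d⟩ | ⟨a, b, d⟩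
    · exact hij h
    · exact Set.disjoint_left.mp (hmixed i j a b d hj) hx hx'
    · exact Set.disjoint_left.mp (hmixed j i a b d hi) hx' hx
  · rw [Set.disjoint_left]
    intro x hx hx'
    obtain ⟨t, a₁, a₂, e₁⟩ := harc i hi x hx
    obtain ⟨u, b₁, b₂, e₂⟩ := hseg j hj x hx'
    have h₁ := mem_sphere_iff_norm.mp (touchPoint_mem_sphere (z (K i).1) (K i).2
      (reachDir z m N K i + (K i).2.sign * t))
    rw [← e₁, e₂] at h₁
    by_cases hlh : 0 < i ∧ i < m ∧ m ≤ j
    · refine (Q.lower_arc_below hlh.1 hlh.2.1 a₁ a₂).not_onHull ?_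
      rw [← e₁, e₂]
      exact Q.upper_segment_on hlh.2.2 hj u
    by_cases hhl : m < i ∧ j < m
    · refine (Q.lower_segment_below hhl.2 b₁ b₂).not_onHull ?_
      rw [← e₂, e₁]
      exact Q.upper_arc_on hhl.1 hi a₁ a₂
    by_cases hs : (K i).1 = (K j).1
    · rcases Q.eq_of_index_eq hi hj hs with h | h | h
      · subst h
        rw [hs] at h₁
        -- A segment meets its own disk only at its starting point, which is the excluded end of the
        -- half-open arc.
        have hu := eq_zero_of_norm_tangent_start h₁
        have e := e₁.symm.trans e₂
        rw [hu, Complex.ofReal_zero, zero_mul, add_zero] at e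
        have h₃ := (Q.turn hi).2
        set ω := (K i).2.sign * (reachDir z m N K (i + 1) - reachDir z m N K i) with hω
        have hr : segDir z m K i = reachDir z m N K i + (K i).2.sign * ω := by
          rw [hω]; change reachDir z m N K (i + 1) = _
          linear_combination (-(reachDir z m N K (i + 1) - reachDir z m N K i)) * (K i).2.sign_sq
        rw [hr] at e
        have h₄ := dir_eq_of_abs_sub_lt (touchPoint_injective e) (by
          rw [add_sub_add_left_eq_sub, ← mul_sub, abs_mul, Side.abs_sign, one_mul, abs_lt]
          constructor <;> linarith)
        have h₅ : (K i).2.sign * (t - ω) = 0 := by linarith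
        rcases mul_eq_zero.mp h₅ with h | h
        · have := (K i).2.sign_sq; rw [h] at this; norm_num at this
        · linarith
      · omega
      · omega
    by_cases he : (K i).1 = (K (j + 1)).1
    · rw [he] at h₁
      exact (one_lt_norm_tangent_end (Q.segment_eq hj) b₂).ne' h₁
    -- If the segment is upper, the earlier cases leave only `i = 0` or `i ≥ m`, so the disk of the
    -- arc is on the hull and cannot hide between the ends of the segment.
    · refine (Q.one_lt_norm_segment hj (Q.index_lt_size hi.le) hs he (fun hmj => ?_) b₁ b₂).ne' h₁
      rcases Nat.eq_zero_or_pos i with rfl | h0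
      · rw [Q.first]; exact hullIndex_zero
      · exact Q.hull_of_upper (by omega) hi.le
  · have key : ∀ i j, i < j → j < N → Disjoint (segSet c K' θ l i) (segSet c K' θ l j) := by
      intro i j hij hj
      rw [Set.disjoint_left]
      intro x hx hx'
      obtain ⟨t, a₁, a₂, e₁⟩ := hseg i (hij.trans hj) x hx
      obtain ⟨u, b₁, b₂, e₂⟩ := hseg j hj x hx'
      exact Q.segments_disjoint hij hj a₁ a₂ b₁ b₂ (e₁.symm.trans e₂)
    rcases lt_or_gt_of_ne hij with h | h
    · exact key i j h hj
    · exact (key j i h hi).symm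

end
end ConveyorBelt

/-! ### The greedy path in a gap and the taut path through all lower disks. -/

namespace ConveyorBelt
noncomputable section
open Real

/-! ### The greedy path in a gap -/

open Classical in
/-- The disk between `r` and `b` that is met first. -/
def firstMet (z : ℕ → ℂ) (r : ℕ) (ρ : Side) (b : ℕ) : ℕ :=
  if tangentDir z r ρ (r + 1) .left ≤ tangentDir z r ρ (b - 1) .left then r + 1 else b - 1

theorem firstMet_mem (z : ℕ → ℂ) {r b : ℕ} (ρ : Side) (h : r + 1 < b) :
    r < firstMet z r ρ b ∧ firstMet z r ρ b < b := by
  unfold firstMet; split_ifs <;> omega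

open Classical in
/-- The contacts of the greedy path from the disk `r` to the disk `b`. -/
def gapList (z : ℕ → ℂ) (b : ℕ) (τ : Side) (r : ℕ) (ρ : Side) : List (ℕ × Side) :=
  if _h : r + 1 < b then
    if tangentDir z r ρ (firstMet z r ρ b) .left ≤ tangentDir z r ρ b τ then
      (firstMet z r ρ b, .left) :: gapList z b τ (firstMet z r ρ b) .left
    else []
  else []
termination_by b - r
decreasing_by have := firstMet_mem z ρ _h; omega

section
variable {z : ℕ → ℂ} {n a b : ℕ}

/-- No inner disk can be met before both extreme ones, by `not_tangentDir_lt_and_le`. In a tie the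
extreme disk on the left is taken, whence the strict inequality in the first part. This replaces a
search in the gap by one comparison. -/
theorem ConcaveGap.tangentDir_firstMet (G : ConcaveGap z n a b) {r : ℕ} (ρ : Side) (har : a ≤ r) :
    (∀ j, r < j → j < firstMet z r ρ b →
      tangentDir z r ρ (firstMet z r ρ b) .left < tangentDir z r ρ j .left) ∧
    (∀ j, r < j → j < b →
      tangentDir z r ρ (firstMet z r ρ b) .left ≤ tangentDir z r ρ j .left) := by
  have key : ∀ j, r + 1 < j → j < b - 1 →
      ¬ (tangentDir z r ρ j .left < tangentDir z r ρ (r + 1) .left ∧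
        tangentDir z r ρ j .left ≤ tangentDir z r ρ (b - 1) .left) := fun j h₁ h₂ =>
    G.sep.not_tangentDir_lt_and_le (Nat.lt_succ_self r) h₁ h₂ (by have := G.lt_size; omega)
      (G.concave _ _ _ har (by omega) h₁ (by omega))
      (G.concave _ _ _ (by omega) h₁ h₂ (by omega))
      (G.concave _ _ _ har (by omega) h₂ (by omega))
  unfold firstMet
  split_ifs with h
  · refine ⟨fun j h₁ h₂ => by omega, fun j h₁ h₂ => ?_⟩
    rcases (show r + 1 ≤ j from h₁).eq_or_lt with rfl | h₃
    · exact le_rfl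
    rcases (show j ≤ b - 1 by omega).eq_or_lt with rfl | h₄
    · exact h
    by_contra! h₅
    exact key j h₃ h₄ ⟨h₅, h₅.le.trans h⟩
  · rw [not_le] at h
    have h₀ : ∀ j, r < j → j < b - 1 →
        tangentDir z r ρ (b - 1) .left < tangentDir z r ρ j .left := by
      intro j h₁ h₂
      rcases (show r + 1 ≤ j from h₁).eq_or_lt with rfl | h₃
      · exact h
      by_contra! h₅
      exact key j h₃ h₂ ⟨h₅.trans_lt h, h₅⟩
    refine ⟨h₀, fun j h₁ h₂ => ?_⟩
    rcases (show j ≤ b - 1 by omega).eq_or_lt with rfl | h₄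
    · exact le_rfl
    · exact (h₀ j h₁ h₄).le

theorem ConcaveGap.gapPath_gapList (G : ConcaveGap z n a b) (τ : Side) {r : ℕ} (ρ : Side)
    (har : a ≤ r) (hrb : r < b) : GapPath z b τ r ρ (gapList z b τ r ρ) := by
  induction hk : b - r using Nat.strong_induction_on generalizing r ρ with
  | _ k ih =>
    rw [gapList]
    split_ifs with h₁ h₂
    · obtain ⟨m₁, m₂⟩ := firstMet_mem z ρ h₁
      obtain ⟨t₁, t₂⟩ := G.tangentDir_firstMet ρ har
      exact .shift m₁ m₂ t₁ (fun j hj hjb => t₂ j (by omega) hjb) h₂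
        (ih _ (by omega) _ (by omega) m₂ rfl)
    · obtain ⟨t₁, t₂⟩ := G.tangentDir_firstMet ρ har
      exact .final hrb fun j hj hjb => (not_le.mp h₂).trans_le (t₂ j hj hjb)
    · exact .final hrb fun j hj hjb => by omega

end

/-! ### Taut paths -/

/-- A path of bitangents that visits the given contacts from left to right after the contact `x`,
runs strictly below the other disks and turns towards every disk it visits. The contact `x` is
reached in the direction `φ`. -/
inductive TautPath (z : ℕ → ℂ) (n : ℕ) : ℝ → ℕ × Side → List (ℕ × Side) → Prop
  | nil (φ : ℝ) (x : ℕ × Side) : TautPath z n φ x []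
  | cons {φ : ℝ} {x y : ℕ × Side} {l : List (ℕ × Side)} : x.1 < y.1 → y.1 < n →
      (∀ j, x.1 < j → j < y.1 → tangentDir z x.1 x.2 y.1 y.2 < tangentDir z x.1 x.2 j .left) →
      0 ≤ x.2.sign * (tangentDir z x.1 x.2 y.1 y.2 - φ) →
      TautPath z n (tangentDir z x.1 x.2 y.1 y.2) y l → TautPath z n φ x (y :: l)

section
variable {z : ℕ → ℂ} {n a b : ℕ}

/-- The continuation `hl` needs to know only how the direction of arrival at `b` compares with the
chord from `a` to `b`: at most the chord if `b` is kept on the left, at least the chord on the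
right. This lets the side chosen from the turn of three lower centers guarantee a turn of the belt
towards `b`. -/
theorem GapPath.tautPath (G : ConcaveGap z n a b) {τ : Side} {r : ℕ} {ρ : Side}
    {p l : List (ℕ × Side)} (hp : GapPath z b τ r ρ p) (har : a ≤ r) {φ : ℝ}
    (hL : ρ = .left → (∀ j, r < j → j < b → φ ≤ tangentDir z r ρ j .left) ∧
      φ ≤ tangentDir z r ρ b τ)
    (hR : ρ = .right → tangentDir z r ρ b τ ≤ φ)
    (hτ : τ = .right → (z b - z a).arg ≤ tangentDir z r ρ b .right)
    (hl : ∀ ψ, (τ = .left → ψ ≤ (z b - z a).arg) → (τ = .right → (z b - z a).arg ≤ ψ) →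
      TautPath z n ψ (b, τ) l) : TautPath z n φ (r, ρ) (p ++ (b, τ) :: l) := by
  have S := G.sep
  have hn := G.lt_size
  induction hp generalizing φ with
  | @final r ρ hrb hfinal =>
    refine .cons hrb hn hfinal ?_ (hl _ (fun h => ?_) (fun h => ?_))
    · cases ρ with
      | left => have := (hL rfl).2; rw [Side.sign_left]; dsimp only; linarith
      | right => have := hR rfl; rw [Side.sign_right]; dsimp only; linarith
    · subst h
      refine (tangentDir_to_left_le_arg z r b ρ).trans ?_
      rcases har.eq_or_lt with rfl | h
      · exact le_rfl
      · exact (S.concave_iff_right h hrb hn).mp (G.concave _ _ _ le_rfl h hrb le_rfl)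
    · subst h; exact hτ rfl
  | @shift r u ρ p hru hub h₁ h₂ h₃ hp ih =>
    obtain ⟨k₁, k₂⟩ := G.shift_le har hru hub h₂ h₃
    refine .cons hru (hub.trans hn) h₁ ?_ (ih (har.trans hru.le) (fun _ => ⟨k₁, k₂⟩)
      (fun h => by simp at h) (fun h => ?_))
    · cases ρ with
      | left => have := (hL rfl).1 u hru hub; rw [Side.sign_left]; dsimp only; linarith
      | right => have := hR rfl; rw [Side.sign_right]; dsimp only; linarith
    · subst h
      exact (hτ rfl).trans (S.tangentDir_right_le hru hub hn
        (G.concave _ _ _ har hru hub le_rfl) h₃)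

theorem TautPath.getElem {φ : ℝ} {x : ℕ × Side} {l : List (ℕ × Side)} (h : TautPath z n φ x l)
    {k : ℕ} (hk : k < l.length) {y w : ℕ × Side} (hy : (x :: l)[k]? = some y)
    (hw : l[k]? = some w) :
    y.1 < w.1 ∧ w.1 < n ∧ (∀ j, y.1 < j → j < w.1 →
      tangentDir z y.1 y.2 w.1 w.2 < tangentDir z y.1 y.2 j .left) ∧
    ∀ v, l[k + 1]? = some v →
      0 ≤ w.2.sign * (tangentDir z w.1 w.2 v.1 v.2 - tangentDir z y.1 y.2 w.1 w.2) := by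
  induction h generalizing k with
  | nil => simp at hk
  | @cons φ x x' l h₁ h₂ h₃ h₄ h₅ ih =>
    cases k with
    | zero =>
      simp only [List.getElem?_cons_zero, Option.some.injEq] at hy hw
      subst hy hw
      refine ⟨h₁, h₂, h₃, fun v hv => ?_⟩
      cases h₅ with
      | nil => simp at hv
      | cons _ _ _ h _ =>
        simp only [zero_add, List.getElem?_cons_succ, List.getElem?_cons_zero,
          Option.some.injEq] at hv
        subst hv; exact h
    | succ k =>
      simp only [List.getElem?_cons_succ] at hy hw
      refine ih (by simpa using hk) hy hw |>.imp_right fun h => h.imp_right fun h => h.imp_right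
        fun h v hv => h v (by simpa using hv)

end

/-! ### The path along the lower disks -/

/-- The lower disks `a` and `b` are consecutive. -/
structure NextLow (z : ℕ → ℂ) (n a b : ℕ) : Prop where
  low_left : LowIndex z n a
  low_right : LowIndex z n b
  lt : a < b
  lt_size : b < n
  not_between : ∀ j, a < j → j < b → ¬ LowIndex z n j

open Classical in
/-- The side on which the belt keeps a lower disk. -/
def lowSide (z : ℕ → ℂ) (n b : ℕ) : Side :=
  if ∃ a d, NextLow z n a b ∧ NextLow z n b d ∧ cross (z b - z a) (z d - z b) < 0 then .right
  else .left

/-- The contacts of the belt after the lower disk `a`, where `nl` yields the next lower disk. -/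
def lowerList (z : ℕ → ℂ) (n : ℕ) (nl : ℕ → ℕ) (a : ℕ) : List (ℕ × Side) :=
  if _h : a < nl a ∧ nl a < n then
    gapList z (nl a) (lowSide z n (nl a)) a (lowSide z n a) ++
      (nl a, lowSide z n (nl a)) :: lowerList z n nl (nl a)
  else []
termination_by n - a

/-- The lower disks after the lower disk `a`. -/
def lowList (n : ℕ) (nl : ℕ → ℕ) (a : ℕ) : List ℕ :=
  if _h : a < nl a ∧ nl a < n then nl a :: lowList n nl (nl a) else []
termination_by n - a

section
variable {z : ℕ → ℂ} {n a b d : ℕ} {nl : ℕ → ℕ}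

theorem NextLow.right_unique (h : NextLow z n a b) (h' : NextLow z n a d) : b = d := by
  rcases lt_trichotomy b d with k | k | k
  · exact absurd h.low_right (h'.not_between b h.lt k)
  · exact k
  · exact absurd h'.low_right (h.not_between d h'.lt k)

theorem NextLow.left_unique (h : NextLow z n a d) (h' : NextLow z n b d) : a = b := by
  rcases lt_trichotomy a b with k | k | k
  · exact absurd h'.low_left (h.not_between b k h'.lt)
  · exact k
  · exact absurd h.low_left (h'.not_between a k h.lt)

theorem lowSide_zero : lowSide z n 0 = .left :=
  if_neg fun ⟨_, _, h, _⟩ => absurd h.lt (Nat.not_lt_zero _)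

theorem lowSide_last (h : b + 1 = n) : lowSide z n b = .left :=
  if_neg fun ⟨_, _, _, h', _⟩ => by have := h'.lt; have := h'.lt_size; omega

open Classical in
theorem NextLow.lowSide_eq (h : NextLow z n a b) (h' : NextLow z n b d) :
    lowSide z n b = if 0 ≤ cross (z b - z a) (z d - z b) then .left else .right := by
  unfold lowSide
  split_ifs with h₁ h₂ h₂
  · obtain ⟨a', d', k₁, k₂, k₃⟩ := h₁
    rw [k₁.left_unique h, k₂.right_unique h'] at k₃
    exact absurd h₂ k₃.not_ge
  · rfl
  · rfl
  · exact absurd ⟨a, d, h, h', not_le.mp h₂⟩ h₁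

theorem lowSide_right (h : lowSide z n b = .right) : 0 < b ∧ b + 1 < n ∧ ¬ HullIndex z n b := by
  unfold lowSide at h
  split_ifs at h with h₁
  obtain ⟨a, d, k₁, k₂, -⟩ := h₁
  have := k₁.lt
  have := k₂.lt
  have := k₂.lt_size
  refine ⟨by omega, by omega, ?_⟩
  rcases k₂.low_left with e | e | e
  · omega
  · omega
  · exact e

/-- Only the middle center of a triple has to be a hull index. It lies strictly between `a` and `b`,
so this also covers triples that use the lower disks `a` and `b` themselves. -/
theorem NextLow.concaveGap (S : SeparatedSeq z n) (h : NextLow z n a b) : ConcaveGap z n a b := by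
  refine ⟨S, h.lt, h.lt_size, fun i j k hi hij hjk hk => ?_⟩
  have : HullIndex z n j := by
    have := h.not_between j (by omega) (by omega)
    unfold LowIndex at this
    tauto
  exact this i k hij hjk (hk.trans_lt h.lt_size)

/-- The chord between consecutive lower centers serves as a reference: arrival is on one side of the
incoming chord, departure on the same side of the outgoing one, and the choice of side orders the
two chords accordingly. -/
theorem tautPath_lowerList (S : SeparatedSeq z n)
    (hnl : ∀ a, LowIndex z n a → a + 1 < n → NextLow z n a (nl a)) {a : ℕ} (ha : LowIndex z n a)
    {φ : ℝ} (h₁ : lowSide z n a = .left → ∀ b, NextLow z n a b → φ ≤ (z b - z a).arg)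
    (h₂ : lowSide z n a = .right → ∀ b, NextLow z n a b → (z b - z a).arg ≤ φ) :
    TautPath z n φ (a, lowSide z n a) (lowerList z n nl a) := by
  induction hk : n - a using Nat.strong_induction_on generalizing a φ with
  | _ k ih =>
    rw [lowerList]
    split_ifs with h
    swap
    · exact .nil _ _
    have H := hnl a ha (by omega)
    have G := H.concaveGap S
    refine (G.gapPath_gapList _ _ le_rfl H.lt).tautPath G le_rfl (fun hs => ⟨fun j h₃ h₄ => ?_, ?_⟩)
      (fun hs => ?_) (fun hs => ?_) (fun ψ h₃ h₄ => ?_)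
    · rw [hs, tangentDir_left_left]
      exact (h₁ hs _ H).trans ((S.concave_iff_left h₃ h₄ H.lt_size).mp
        (G.concave a j _ le_rfl h₃ h₄ le_rfl))
    · rw [hs]; exact (h₁ hs _ H).trans (arg_le_tangentDir_of_left ..)
    · rw [hs]; exact (tangentDir_le_arg_of_right ..).trans (h₂ hs _ H)
    · exact arg_le_tangentDir_to_right ..
    · have hx : ∀ d, NextLow z n (nl a) d → (0 ≤ cross (z (nl a) - z a) (z d - z (nl a)) ↔
          (z (nl a) - z a).arg ≤ (z d - z (nl a)).arg) := fun d hd =>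
        cross_nonneg_iff (S.re_pos H.lt H.lt_size) (S.re_pos hd.lt hd.lt_size)
      refine ih (n - nl a) (by omega) H.low_right (fun hs d hd => ?_) (fun hs d hd => ?_) rfl
      · rw [H.lowSide_eq hd] at hs
        split_ifs at hs with h₅
        exact (h₃ (by rw [H.lowSide_eq hd, if_pos h₅])).trans ((hx d hd).mp h₅)
      · rw [H.lowSide_eq hd] at hs
        split_ifs at hs with h₅
        refine le_trans ?_ (h₄ (by rw [H.lowSide_eq hd, if_neg h₅]))
        rw [hx d hd, not_le] at h₅
        exact h₅.le

theorem GapPath.side_eq {τ : Side} {r : ℕ} {ρ : Side} {p : List (ℕ × Side)}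
    (h : GapPath z b τ r ρ p) : ∀ x ∈ p, x.2 = .left := by
  induction h with
  | final => simp
  | shift _ _ _ _ _ _ ih => simpa using ih

theorem lowerList_right (S : SeparatedSeq z n)
    (hnl : ∀ a, LowIndex z n a → a + 1 < n → NextLow z n a (nl a)) {a : ℕ} (ha : LowIndex z n a) :
    ∀ x ∈ lowerList z n nl a, x.2 = .right → ¬ HullIndex z n x.1 := by
  induction hk : n - a using Nat.strong_induction_on generalizing a with
  | _ k ih =>
    rw [lowerList]
    split_ifs with h
    swap
    · simp
    have H := hnl a ha (by omega)
    have G := H.concaveGap S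
    intro x hx hxr
    rcases List.mem_append.mp hx with hx | hx
    · rw [(G.gapPath_gapList _ _ le_rfl H.lt).side_eq x hx] at hxr; simp at hxr
    · rcases List.mem_cons.mp hx with rfl | hx
      · exact (lowSide_right hxr).2.2
      · exact ih _ (by omega) H.low_right rfl x hx hxr

theorem mem_lowerList (hnl : ∀ a, LowIndex z n a → a + 1 < n → NextLow z n a (nl a)) {a i : ℕ}
    (ha : LowIndex z n a) (hi : LowIndex z n i) (hai : a < i) (hin : i < n) :
    (i, lowSide z n i) ∈ lowerList z n nl a := by
  induction hk : n - a using Nat.strong_induction_on generalizing a with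
  | _ k ih =>
    have H := hnl a ha (by omega)
    rw [lowerList, dif_pos ⟨H.lt, H.lt_size⟩]
    rcases lt_trichotomy i (nl a) with h | h | h
    · exact absurd hi (H.not_between i hai h)
    · simp [h]
    · have := H.lt
      exact List.mem_append_right _ (List.mem_cons_of_mem _ (ih _ (by omega) H.low_right h rfl))

theorem getLast_lowerList (hnl : ∀ a, LowIndex z n a → a + 1 < n → NextLow z n a (nl a)) {a : ℕ}
    (ha : LowIndex z n a) (han : a < n) {x : ℕ × Side}
    (hx : ((a, lowSide z n a) :: lowerList z n nl a).getLast? = some x) : x = (n - 1, .left) := by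
  induction hk : n - a using Nat.strong_induction_on generalizing a with
  | _ k ih =>
    rw [lowerList] at hx
    split_ifs at hx with h
    · rw [← List.cons_append, List.getLast?_append_cons] at hx
      exact ih _ (by omega) (hnl a ha (by omega)).low_right h.2 hx rfl
    · have e : a = n - 1 := by
        by_contra hne
        have := hnl a ha (by omega)
        exact h ⟨this.lt, this.lt_size⟩
      have : lowSide z n a = .left := lowSide_last (by omega)
      simp only [List.getLast?_singleton, Option.some.injEq] at hx
      rw [← hx, this, e]

theorem mem_lowList (hnl : ∀ a, LowIndex z n a → a + 1 < n → NextLow z n a (nl a)) {a i : ℕ}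
    (ha : LowIndex z n a) : i ∈ lowList n nl a ↔ a < i ∧ i < n ∧ LowIndex z n i := by
  induction hk : n - a using Nat.strong_induction_on generalizing a with
  | _ k ih =>
    rw [lowList]
    split_ifs with h
    · have H := hnl a ha (by omega)
      rw [List.mem_cons, ih _ (by omega) H.low_right rfl]
      constructor
      · rintro (rfl | ⟨h₁, h₂⟩)
        · exact ⟨h.1, h.2, H.low_right⟩
        · exact ⟨h.1.trans h₁, h₂⟩
      · rintro ⟨h₁, h₂⟩
        rcases lt_trichotomy i (nl a) with h | h | h
        · exact absurd h₂.2 (H.not_between i h₁ h)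
        · exact Or.inl h
        · exact Or.inr ⟨h, h₂⟩
    · simp only [List.not_mem_nil, false_iff]
      rintro ⟨h₁, h₂, -⟩
      have := hnl a ha (by omega)
      exact h ⟨this.lt, this.lt_size⟩

theorem pairwise_lowList (hnl : ∀ a, LowIndex z n a → a + 1 < n → NextLow z n a (nl a)) {a : ℕ}
    (ha : LowIndex z n a) : (a :: lowList n nl a).Pairwise (· < ·) := by
  induction hk : n - a using Nat.strong_induction_on generalizing a with
  | _ k ih =>
    rw [List.pairwise_cons]
    refine ⟨fun i hi => ((mem_lowList hnl ha).mp hi).1, ?_⟩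
    rw [lowList]
    split_ifs with h
    · exact ih _ (by omega) (hnl a ha (by omega)).low_right rfl
    · exact .nil

end

end
end ConveyorBelt

/-! ### The list of contacts is a winding belt and specifies a conveyor belt. -/

namespace ConveyorBelt
noncomputable section
open Real

/-! ### The path along the upper hull -/

/-- The indices on the path from `i` to `0` along the predecessors `pr`, without both ends. -/
def hullList (pr : ℕ → ℕ) (i : ℕ) : List ℕ :=
  if _h : 0 < pr i ∧ pr i < i then pr i :: hullList pr (pr i) else []
termination_by i

section
variable {z : ℕ → ℂ} {n : ℕ} {pr : ℕ → ℕ}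

/-- The predecessor of a hull index is the previous hull index, so the walk skips none. It stops
before `0`, which belongs to the lower part of the list. -/
theorem mem_hullList (S : SeparatedSeq z n) (hpr : ∀ i, 0 < i → i < n → HullPred z (pr i) i)
    {i j : ℕ} (hi : i < n) (hH : HullIndex z n i) :
    j ∈ hullList pr i ↔ 0 < j ∧ j < i ∧ HullIndex z n j := by
  induction i using Nat.strong_induction_on with
  | _ i ih =>
    rw [hullList]
    rcases Nat.eq_zero_or_pos i with rfl | h0
    · rw [dif_neg (by omega)]; simp
    have h₁ := (hpr i h0 hi).hullStep S hi hH
    split_ifs with h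
    · rw [List.mem_cons, ih _ h₁.lt (h₁.lt.trans hi) h₁.left]
      constructor
      · rintro (rfl | ⟨a, b, d⟩)
        · exact ⟨h.1, h.2, h₁.left⟩
        · exact ⟨a, b.trans h₁.lt, d⟩
      · rintro ⟨a, b, d⟩
        rcases lt_trichotomy j (pr i) with k | k | k
        · exact Or.inr ⟨a, k, d⟩
        · exact Or.inl k
        · exact absurd d (h₁.not_between j k b)
    · simp only [List.not_mem_nil, false_iff]
      rintro ⟨a, b, d⟩
      have := h₁.lt
      exact h₁.not_between j (by omega) b d

theorem pairwise_hullList (i : ℕ) : (i :: hullList pr i).Pairwise (· > ·) := by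
  induction i using Nat.strong_induction_on with
  | _ i ih =>
    rw [hullList]
    split_ifs with h
    · have h₁ := ih _ h.2
      refine List.pairwise_cons.mpr ⟨fun j hj => ?_, h₁⟩
      rcases List.mem_cons.mp hj with rfl | hj
      · exact h.2
      · exact (List.rel_of_pairwise_cons h₁ hj).trans h.2
    · simp

theorem hullStep_hullList (S : SeparatedSeq z n)
    (hpr : ∀ i, 0 < i → i < n → HullPred z (pr i) i) {i : ℕ} (h0 : 0 < i) (hi : i < n)
    (hH : HullIndex z n i) {j : ℕ} (hj : j < (hullList pr i).length + 1) :
    HullStep z n ((i :: hullList pr i).getD (j + 1) 0) ((i :: hullList pr i).getD j 0) := by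
  induction i using Nat.strong_induction_on generalizing j with
  | _ i ih =>
    have h₁ := (hpr i h0 hi).hullStep S hi hH
    rw [hullList] at hj ⊢
    split_ifs at hj ⊢ with h
    · cases j with
      | zero => simpa using h₁
      | succ j =>
        simpa only [List.getD_cons_succ] using
          ih _ h₁.lt h.1 (h₁.lt.trans hi) h₁.left (by simpa using hj)
    · have e : pr i = 0 := by have := h₁.lt; omega
      rw [e] at h₁
      have : j = 0 := by simpa using hj
      subst this
      simpa using h₁

end

/-! ### The winding belt -/

/-- The contacts of the winding belt, where `pr` and `nl` yield the predecessors on the upper hull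
and the next lower disks. -/
def beltList (z : ℕ → ℂ) (n : ℕ) (pr nl : ℕ → ℕ) : List (ℕ × Side) :=
  ((0, .left) :: lowerList z n nl 0) ++ (hullList pr (n - 1)).map fun u => (u, .left)

section
variable {z : ℕ → ℂ} {n : ℕ} {pr nl : ℕ → ℕ}

theorem lowIndex_zero : LowIndex z n 0 := Or.inl rfl

theorem beltSeq_beltList (S : SeparatedSeq z n) (hn : 1 < n)
    (hpr : ∀ i, 0 < i → i < n → HullPred z (pr i) i)
    (hnl : ∀ a, LowIndex z n a → a + 1 < n → NextLow z n a (nl a)) :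
    BeltSeq z n (lowerList z n nl 0).length (beltList z n pr nl).length
      (fun k => (beltList z n pr nl).getD k (0, .left)) := by
  set A := lowerList z n nl 0 with hA
  set U := hullList pr (n - 1) with hU
  have hB : beltList z n pr nl = ((0, .left) :: A) ++ U.map fun u => (u, Side.left) := rfl
  have hlen : (beltList z n pr nl).length = A.length + 1 + U.length := by simp [hB]; omega
  have H0 := hnl 0 lowIndex_zero (by omega)
  have hpos : 0 < A.length := by
    rw [hA, lowerList, dif_pos ⟨H0.lt, H0.lt_size⟩]; simp
  have hlow : ∀ k, k ≤ A.length → (beltList z n pr nl).getD k (0, .left) =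
      (((0 : ℕ), Side.left) :: A).getD k (0, .left) := fun k hk => by
    rw [hB, List.getD_append _ _ _ _ (by simp; omega)]
  have hlast : (((0 : ℕ), Side.left) :: A).getD A.length (0, .left) = (n - 1, .left) := by
    have h : ((0, Side.left) :: A)[A.length]? = some ((0, Side.left) :: A)[A.length] :=
      List.getElem?_eq_getElem (by simp)
    have h' := getLast_lowerList hnl lowIndex_zero (by omega : 0 < n)
      (x := ((0, Side.left) :: A)[A.length]) (by
        rw [lowSide_zero, List.getLast?_eq_getElem?, ← hA, List.length_cons,
          Nat.add_sub_cancel, h])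
    rw [List.getD_eq_getElem?_getD, h, h', Option.getD_some]
  have hup : ∀ j, (beltList z n pr nl).getD (A.length + j) (0, .left) =
      (((n - 1) :: U).getD j 0, .left) := fun j => by
    cases j with
    | zero => rw [add_zero, hlow _ le_rfl, hlast]; rfl
    | succ j =>
      rw [hB, List.getD_append_right _ _ _ _ (by simp), List.getD_cons_succ]
      have : A.length + (j + 1) - ((0, Side.left) :: A).length = j := by simp; omega
      rw [this]
      exact List.getD_map (n := j) (l := U) (d := 0) (f := fun u => (u, Side.left))
  -- The angle `-π` is below all chord directions, so it imposes no condition at the first disk.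
  have htaut : TautPath z n (-π) (0, .left) A := by
    have := tautPath_lowerList S hnl (φ := -π) lowIndex_zero
      (fun _ b hb => by linarith [(S.arg_mem hb.lt hb.lt_size).1, pi_pos])
      (fun h => by rw [lowSide_zero] at h; simp at h)
    rwa [lowSide_zero] at this
  have hget : ∀ k, k < A.length →
      A[k]? = some ((beltList z n pr nl).getD (k + 1) (0, .left)) := fun k hk => by
    rw [hlow _ hk, List.getD_cons_succ, List.getD_eq_getElem _ _ hk]
    exact List.getElem?_eq_getElem hk
  have hget' : ∀ k, k ≤ A.length →
      ((0, Side.left) :: A)[k]? = some ((beltList z n pr nl).getD k (0, .left)) := fun k hk => by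
    have hk' : k < (((0 : ℕ), Side.left) :: A).length := by simp; omega
    rw [hlow _ hk, List.getD_eq_getElem _ _ hk']
    exact List.getElem?_eq_getElem hk'
  have hstep : ∀ k, A.length ≤ k → k < (beltList z n pr nl).length →
      HullStep z n ((beltList z n pr nl).getD (k + 1) (0, .left)).1
        ((beltList z n pr nl).getD k (0, .left)).1 := by
    intro k hk hkN
    obtain ⟨j, rfl⟩ := Nat.exists_eq_add_of_le hk
    rw [add_assoc, hup, hup]
    exact hullStep_hullList S hpr (by omega) (by omega) hullIndex_last (by rw [← hU]; omega)
  refine ⟨S, hpos, by omega, by rw [hlow 0 (by omega)]; rfl, by rw [hlow _ le_rfl, hlast], ?_,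
    fun k hk => ?_, fun k hk => ?_, fun k hk => ?_, fun k hk => ?_, hstep, fun k hk _ => ?_,
    fun i hi => ?_⟩
  -- The default value beyond the list is the first contact, which closes the cycle.
  · exact List.getD_eq_default _ _ le_rfl
  · exact (htaut.getElem hk (hget' k hk.le) (hget k hk)).1
  · exact (htaut.getElem hk (hget' k hk.le) (hget k hk)).2.2.1
  · exact (htaut.getElem (by omega) (hget' k (by omega)) (hget k (by omega))).2.2.2 _
      (hget (k + 1) hk)
  · intro hr
    have h := List.mem_of_getElem? (hget' k hk.le)
    rcases List.mem_cons.mp h with e | h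
    · rw [e] at hr; simp at hr
    · exact lowerList_right S hnl lowIndex_zero _ h hr
  · obtain ⟨j, rfl⟩ := Nat.exists_eq_add_of_le hk
    rw [hup]
  · have hmem : ∀ x ∈ beltList z n pr nl, x.1 = i → ∃ k < (beltList z n pr nl).length,
        ((beltList z n pr nl).getD k (0, .left)).1 = i := by
      intro x hx e
      obtain ⟨k, hk, rfl⟩ := List.mem_iff_getElem.mp hx
      exact ⟨k, hk, by rw [List.getD_eq_getElem _ _ hk, e]⟩
    by_cases hl : LowIndex z n i
    · rcases Nat.eq_zero_or_pos i with rfl | h0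
      · exact hmem (0, .left) (by simp [hB]) rfl
      · refine hmem (i, lowSide z n i) ?_ rfl
        rw [hB]
        exact List.mem_append_left _ (List.mem_cons_of_mem _ (mem_lowerList hnl lowIndex_zero hl h0 hi))
    · unfold LowIndex at hl
      push Not at hl
      refine hmem (i, .left) ?_ rfl
      rw [hB]
      exact List.mem_append_right _ (List.mem_map_of_mem ((mem_hullList S hpr (by omega)
        hullIndex_last).mpr ⟨by omega, by omega, hl.2.2⟩))

end

/-! ### The belt of the disks -/

section
variable {n : ℕ} {c : Fin n → ℂ} {z : ℕ → ℂ} {F : ℕ → Fin n}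

/-- If the center `x` were within two of the point of the segment at parameter `t`, the midpoint `x
+ w / 2` would lie in the disk of `x` and, as the same combination of `u - w / 2` and `v - w / 2`,
in the convex hull. -/
theorem two_lt_of_disjoint {x u v : ℂ} (h : Disjoint (disk x) (convexHull ℝ (disk u ∪ disk v)))
    {t : ℝ} (h₀ : 0 ≤ t) (h₁ : t ≤ 1) :
    2 < ‖((1 - t : ℝ) : ℂ) * (u - x) + (t : ℂ) * (v - x)‖ := by
  set w := ((1 - t : ℝ) : ℂ) * (u - x) + (t : ℂ) * (v - x) with hw
  by_contra! hle
  have hnorm : ‖w / 2‖ ≤ 1 := by rw [norm_div]; norm_num; linarith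
  refine Set.disjoint_left.mp h (show x + w / 2 ∈ disk x from ?_) ?_
  · rwa [disk, mem_closedBall_iff_norm, add_sub_cancel_left]
  · have e : x + w / 2 = (1 - t) • (u - w / 2) + t • (v - w / 2) := by
      rw [Complex.real_smul, Complex.real_smul, hw]; push_cast; ring
    rw [e]
    have hd : ∀ y : ℂ, y - w / 2 ∈ disk y := fun y => by
      rwa [disk, mem_closedBall_iff_norm, sub_sub_cancel_left, norm_neg]
    have hu : u - w / 2 ∈ convexHull ℝ (disk u ∪ disk v) :=
      subset_convexHull ℝ _ (Set.mem_union_left _ (hd u))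
    have hv : v - w / 2 ∈ convexHull ℝ (disk u ∪ disk v) :=
      subset_convexHull ℝ _ (Set.mem_union_right _ (hd v))
    exact convex_convexHull ℝ _ hu hv (sub_nonneg.mpr h₁) h₀ (sub_add_cancel 1 t)

theorem separatedSeq_of_monotonicallySeparated (hF : ∀ i, i < n → (F i : ℕ) = i)
    (hc : ∀ q : Fin n, c q = z q) (hd : DisjointDisks c) (hm : MonotonicallySeparated c) :
    SeparatedSeq z n := by
  have hz : ∀ i, i < n → z i = c (F i) := fun i hi => by rw [hc, hF i hi]
  have hlt : ∀ i j, i < j → j < n → F i < F j := fun i j hij hj => by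
    rw [Fin.lt_def, hF i (hij.trans hj), hF j hj]; exact hij
  refine ⟨fun i j hij hj => ?_, fun i j hij hj => ?_, fun i j k hij hjk hk t h₀ h₁ => ?_,
    fun i j k hij hjk hk t h₀ h₁ => ?_⟩
  · rw [hz i (hij.trans hj), hz j hj]; exact hm.1 (hlt i j hij hj)
  · rw [hz i (hij.trans hj), hz j hj]
    -- Disjointness of two disks is the degenerate case in which both disks of the hull coincide.
    have h : Disjoint (disk (c (F i))) (convexHull ℝ (disk (c (F j)) ∪ disk (c (F j)))) := by
      rw [Set.union_self, Convex.convexHull_eq (s := disk (c (F j))) (convex_closedBall _ _)]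
      exact hd _ _ (hlt i j hij hj).ne
    simpa using two_lt_of_disjoint h le_rfl zero_le_one
  · rw [hz i (by omega), hz j (by omega), hz k hk]
    exact two_lt_of_disjoint (hm.2 _ _ _ (hlt i j hij (by omega)) (hlt j k hjk hk)).1 h₀ h₁
  · rw [hz i (by omega), hz j (by omega), hz k hk]
    exact two_lt_of_disjoint (hm.2 _ _ _ (hlt i j hij (by omega)) (hlt j k hjk hk)).2 h₀ h₁

/-- A strictly increasing list with the right members is the sorted list of the filtered set. This
identifies the lists built by recursion with those in the definition of the winding belt. -/
theorem sort_filter_eq (hF : ∀ i, i < n → (F i : ℕ) = i)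
    {p : Fin n → Prop} [DecidablePred p] {l : List ℕ}
    (hl : l.Pairwise (· < ·)) (hp : ∀ i, i ∈ l ↔ ∃ h : i < n, p ⟨i, h⟩) :
    (Finset.univ.filter p).sort (· ≤ ·) = l.map F := by
  have hlt : ∀ i ∈ l, i < n := fun i hi => ((hp i).mp hi).1
  have hP : (l.map F).Pairwise (· < ·) := by
    rw [List.pairwise_map]
    refine hl.imp_of_mem fun {i j} hi hj h => ?_
    rw [Fin.lt_def, hF i (hlt i hi), hF j (hlt j hj)]; exact h
  have e : Finset.univ.filter p = (l.map F).toFinset := by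
    ext q
    simp only [Finset.mem_filter, Finset.mem_univ, true_and, List.mem_toFinset, List.mem_map]
    constructor
    · intro h
      exact ⟨q, (hp q).mpr ⟨q.2, h⟩, Fin.ext (hF q q.2)⟩
    · rintro ⟨i, hi, rfl⟩
      obtain ⟨h, h'⟩ := (hp i).mp hi
      rwa [show F i = ⟨i, h⟩ from Fin.ext (hF i h)]
  rw [e]
  exact (List.toFinset_sort _ (hP.imp fun h => h.ne)).mpr (hP.imp fun h => h.le)

variable (S : SeparatedSeq z n) (hF : ∀ i, i < n → (F i : ℕ) = i) (hc : ∀ q : Fin n, c q = z q)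
include S hc

theorem isUpperHullDisk_iff_not_lowIndex (q : Fin n) :
    IsUpperHullDisk c q ↔ ¬ LowIndex z n q := by
  rw [isUpperHullDisk_iff S hc, LowIndex]
  have := q.2
  push Not
  constructor
  · rintro ⟨a, b, d⟩; exact ⟨by omega, by omega, d⟩
  · rintro ⟨a, b, d⟩; exact ⟨by omega, by omega, d⟩

include hF

open Classical in
theorem lowerDisks_eq (hn : 0 < n) {nl : ℕ → ℕ}
    (hnl : ∀ a, LowIndex z n a → a + 1 < n → NextLow z n a (nl a)) :
    lowerDisks c = (0 :: lowList n nl 0).map F := by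
  refine sort_filter_eq hF (pairwise_lowList hnl lowIndex_zero) fun i => ?_
  rw [List.mem_cons, mem_lowList hnl lowIndex_zero]
  constructor
  · rintro (rfl | ⟨-, h₁, h₂⟩)
    · exact ⟨hn, by rw [isUpperHullDisk_iff_not_lowIndex S hc, not_not]; exact lowIndex_zero⟩
    · exact ⟨h₁, by rw [isUpperHullDisk_iff_not_lowIndex S hc, not_not]; exact h₂⟩
  · rintro ⟨h₁, h₂⟩
    rw [isUpperHullDisk_iff_not_lowIndex S hc, not_not] at h₂
    rcases Nat.eq_zero_or_pos i with h | h
    · exact Or.inl h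
    · exact Or.inr ⟨h, h₁, h₂⟩

open Classical in
theorem upperDisks_reverse_eq (hn : 0 < n) {pr : ℕ → ℕ}
    (hpr : ∀ i, 0 < i → i < n → HullPred z (pr i) i) :
    (upperDisks c).reverse = (hullList pr (n - 1)).map F := by
  have : upperDisks c = (hullList pr (n - 1)).reverse.map F := by
    refine sort_filter_eq hF ?_ fun i => ?_
    · rw [List.pairwise_reverse]
      exact (pairwise_hullList (n - 1)).of_cons
    · rw [List.mem_reverse, mem_hullList S hpr (by omega) hullIndex_last]
      constructor
      · rintro ⟨h₁, h₂, h₃⟩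
        exact ⟨by omega, (isUpperHullDisk_iff S hc _).mpr ⟨h₁, by dsimp only; omega, h₃⟩⟩
      · rintro ⟨h₁, h₂⟩
        obtain ⟨h₃, h₄, h₅⟩ := (isUpperHullDisk_iff S hc _).mp h₂
        exact ⟨h₃, by dsimp only at h₄; omega, h₅⟩
  rw [this, List.map_reverse, List.reverse_reverse]

theorem NextLow.gapModel {a b : ℕ} (h : NextLow z n a b) :
    GapModel c z F (between c (F a) (F b)) a b := by
  refine ⟨h.concaveGap S, hc, hF, fun q => ?_⟩
  rw [between, Set.mem_ofPred_eq, Fin.lt_def, Fin.lt_def, hF a (h.lt.trans h.lt_size),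
    hF b h.lt_size, isUpperHullDisk_iff_not_lowIndex S hc]
  exact ⟨fun h => h.2, fun k => ⟨h.not_between q k.1 k.2, k⟩⟩

theorem chain_lowerList {nl : ℕ → ℕ}
    (hnl : ∀ a, LowIndex z n a → a + 1 < n → NextLow z n a (nl a)) {a : ℕ} (ha : LowIndex z n a)
    (han : a < n) :
    Chain c (fun q => lowSide z n q) ((a :: lowList n nl a).map F)
      (finContacts F ((a, lowSide z n a) :: lowerList z n nl a)) := by
  induction hk : n - a using Nat.strong_induction_on generalizing a with
  | _ k ih =>
    have ea : lowSide z n (F a) = lowSide z n a := by rw [hF a han]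
    rw [lowerList, lowList]
    split_ifs with h
    · have H := hnl a ha (by omega)
      have eb : lowSide z n (F (nl a)) = lowSide z n (nl a) := by rw [hF _ h.2]
      have h₁ := (H.gapModel S hF hc).isPartialBelt
        ((H.concaveGap S).gapPath_gapList (lowSide z n (nl a)) (lowSide z n a) le_rfl H.lt)
      have h₂ := ih _ (by omega) H.low_right h.2 rfl
      rw [← ea, ← eb] at h₁
      have := Chain.cons (σ := fun q : Fin n => lowSide z n q) h₁ h₂
      rw [ea, eb] at this
      simpa [finContacts] using this
    · have := Chain.single (c := c) (σ := fun q : Fin n => lowSide z n q) (F a)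
      rw [ea] at this
      simpa [finContacts] using this

open Classical in
omit hF in
theorem nextLow_of_infix {a b : Fin n} {s t : List (Fin n)}
    (h : s ++ [a, b] ++ t = lowerDisks c) : NextLow z n a b := by
  have hP : (lowerDisks c).Pairwise (· ≤ ·) := Finset.pairwise_sort _ _
  have hN : (lowerDisks c).Nodup := Finset.sort_nodup _ _
  have hL : ∀ q, q ∈ lowerDisks c ↔ LowIndex z n q := fun q => by
    rw [lowerDisks, Finset.mem_sort, Finset.mem_filter, isUpperHullDisk_iff_not_lowIndex S hc]
    simp
  have hP' : (s ++ [a, b] ++ t).Pairwise (· < ·) := by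
    rw [h]
    exact hP.imp₂ (fun _ _ h₁ h₂ => lt_of_le_of_ne h₁ h₂) hN
  rw [List.append_assoc, List.pairwise_append] at hP'
  obtain ⟨-, h₁, h₂⟩ := hP'
  simp only [List.cons_append, List.nil_append, List.pairwise_cons] at h₁
  refine ⟨(hL a).mp (by rw [← h]; simp), (hL b).mp (by rw [← h]; simp), h₁.1 b (by simp), b.2,
    fun j hj hjb hl => ?_⟩
  have hjn := hjb.trans b.2
  have := (hL ⟨j, hjn⟩).mpr hl
  rw [← h] at this
  simp only [List.append_assoc, List.cons_append, List.nil_append, List.mem_append,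
    List.mem_cons] at this
  rcases this with k | k | k | k
  · have := h₂ _ k a (by simp)
    rw [Fin.lt_def] at this; dsimp only at this; omega
  · have := congrArg Fin.val k; dsimp only at this; omega
  · have := congrArg Fin.val k; dsimp only at this; omega
  · have := h₁.2.1 _ k
    rw [Fin.lt_def] at this; dsimp only at this; omega

theorem isWindingBelt_beltList (hn : 0 < n) {pr nl : ℕ → ℕ}
    (hpr : ∀ i, 0 < i → i < n → HullPred z (pr i) i)
    (hnl : ∀ a, LowIndex z n a → a + 1 < n → NextLow z n a (nl a)) :
    IsWindingBelt c (finContacts F (beltList z n pr nl)) := by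
  refine ⟨fun q => lowSide z n q, finContacts F ((0, .left) :: lowerList z n nl 0),
    ⟨fun i hi => ?_, fun i hi => ?_, fun a b d h => ?_⟩, ?_, ?_⟩
  · have := hi ⟨0, hn⟩
    rw [Fin.le_def] at this
    have e : (i : ℕ) = 0 := Nat.le_zero.mp this
    dsimp only; rw [e]; exact lowSide_zero
  · have := hi ⟨n - 1, by omega⟩
    rw [Fin.le_def] at this
    exact lowSide_last (by have := i.2; dsimp only at *; omega)
  · obtain ⟨s, t, h⟩ := h
    have h₁ : NextLow z n a b := nextLow_of_infix S hc (s := s) (t := d :: t) (by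
      rw [← h]; simp)
    have h₂ : NextLow z n b d := nextLow_of_infix S hc (s := s ++ [a]) (t := t) (by
      rw [← h]; simp)
    dsimp only
    rw [h₁.lowSide_eq h₂, hc, hc, hc]
    exact ⟨fun h => if_pos h.le, fun h => if_neg h.not_ge⟩
  · rw [lowerDisks_eq S hF hc hn hnl]
    have := chain_lowerList S hF hc hnl lowIndex_zero hn
    rwa [lowSide_zero] at this
  · rw [upperDisks_reverse_eq S hF hc hn hpr, beltList, finContacts, List.map_append, finContacts]
    simp [Function.comp_def]

omit S hc hF in
-- A single disk has no segments: its belt is the full circle, with one arc of angle `2π` and a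
-- segment of length zero.
theorem exists_conveyorBelt_single {c : Fin 1 → ℂ} {a : Fin 1} :
    ∃ (γ : ℝ → ℂ) (T : ℝ), Traces c [(a, Side.left)] γ T ∧ IsConveyorBelt c γ T := by
  have D : BeltData c 1 (fun _ => (a, .left)) (fun j => 2 * π * j) (fun _ => 2 * π)
      (fun _ => 0) := by
    refine ⟨fun _ => by positivity, fun _ => le_rfl, fun j _ => ?_, fun j _ => by simp, rfl, ?_, ?_⟩
    · rw [Side.sign_left]; push_cast; ring
    · simp
    · simp [pi_pos]
  have hseg : ∀ j, segSet c (fun _ => (a, Side.left)) (fun j => 2 * π * j) (fun _ => 0) j = ∅ := by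
    intro j
    ext x
    simp only [segSet, Set.mem_ofPred_eq, Set.mem_empty_iff_false, iff_false]
    rintro ⟨t, h₁, h₂, -⟩
    exact h₂.not_ge h₁
  refine D.exists_conveyorBelt (fun _ => le_rfl) (fun i => ⟨0, one_pos, Subsingleton.elim _ _⟩)
    (fun _ _ => Or.inr rfl) (fun _ _ _ => ?_) (fun i j h => absurd (Subsingleton.elim i j) h)
    (fun i hi j hj h => by omega) (fun i _ j _ => ?_) (fun i hi j hj h => by omega) rfl
    (fun j => by simp)
  · rw [hseg]; exact Set.empty_disjoint _
  · rw [hseg]; exact Set.disjoint_empty _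

theorem exists_conveyorBelt_beltList (hn : 0 < n) {pr nl : ℕ → ℕ}
    (hpr : ∀ i, 0 < i → i < n → HullPred z (pr i) i)
    (hnl : ∀ a, LowIndex z n a → a + 1 < n → NextLow z n a (nl a)) :
    ∃ (γ : ℝ → ℂ) (T : ℝ),
      Traces c (finContacts F (beltList z n pr nl)) γ T ∧ IsConveyorBelt c γ T := by
  rcases (show 1 ≤ n from hn).eq_or_lt with rfl | hn
  · have e : beltList z 1 pr nl = [(0, .left)] := by
      rw [beltList, lowerList, dif_neg (by omega), hullList, dif_neg (by omega)]; rfl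
    rw [e]
    exact exists_conveyorBelt_single (a := F 0)
  · refine (beltSeq_beltList S hn hpr hnl).exists_conveyorBelt hF hc (by simp [finContacts])
      fun j => ?_
    have hj : (j : ℕ) < (beltList z n pr nl).length := by
      have := j.2; simpa only [finContacts, List.length_map] using this
    rw [List.getD_eq_getElem _ _ hj, List.get_eq_getElem]
    simp only [finContacts, List.getElem_map]

end

end
end ConveyorBelt

/-! ### Execution of code and compilation of expressions. -/

namespace ConveyorBelt
noncomputable section
open Real

/-! ### Runs of a real random access machine -/

theorem run_add (P : Program) (s t : ℕ) (x : State) :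
    run P (s + t) x = (run P s x).bind (run P t) := by
  induction s generalizing x with
  | zero => simp [run]
  | succ s ih =>
    rw [Nat.succ_add, run, run]
    cases step P x with
    | none => rfl
    | some y => simpa using ih y

theorem run_trans {P : Program} {s t : ℕ} {x y w : State} (h₁ : run P s x = some y)
    (h₂ : run P t y = some w) : run P (s + t) x = some w := by
  rw [run_add, h₁]; exact h₂

theorem run_one {P : Program} {x y : State} {ins : Instr} (h : P[x.pc]? = some ins)
    (he : ins.exec x = some y) : run P 1 x = some y := by
  simp [run, step, h, he]

/-- The code `l` stands at line `p` of the program. -/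
def CodeAt (P : Program) (p : ℕ) (l : List Instr) : Prop :=
  ∃ l₁ l₂, P = l₁ ++ (l ++ l₂) ∧ l₁.length = p

theorem CodeAt.left {P : Program} {p : ℕ} {l l' : List Instr} (h : CodeAt P p (l ++ l')) :
    CodeAt P p l := by
  obtain ⟨l₁, l₂, h, e⟩ := h
  exact ⟨l₁, l' ++ l₂, by simpa using h, e⟩

theorem CodeAt.right {P : Program} {p : ℕ} {l l' : List Instr} (h : CodeAt P p (l ++ l')) :
    CodeAt P (p + l.length) l' := by
  obtain ⟨l₁, l₂, h, e⟩ := h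
  exact ⟨l₁ ++ l, l₂, by simpa using h, by simp [e]⟩

theorem CodeAt.get {P : Program} {p : ℕ} {ins : Instr} {l : List Instr}
    (h : CodeAt P p (ins :: l)) : P[p]? = some ins := by
  obtain ⟨l₁, l₂, rfl, rfl⟩ := h
  simp

theorem CodeAt.tail {P : Program} {p : ℕ} {ins : Instr} {l : List Instr}
    (h : CodeAt P p (ins :: l)) : CodeAt P (p + 1) l :=
  CodeAt.right (l := [ins]) h

/-! ### Expressions -/

/-- The values of the program variables and the contents of the memory. -/
structure Store where
  v : ℕ → ℕ
  m : ℕ → ℕ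
  x : ℕ → ℝ

/-- The state represents the store: the variables are kept in the even registers. -/
def Represents (s : State) (σ : Store) : Prop :=
  (∀ i, s.natReg (2 * i) = σ.v i) ∧ s.natMem = σ.m ∧ s.realMem = σ.x

/-- The states differ only in the program counter, in the odd registers for natural numbers from
`2 * k + 1` on and in the registers for real numbers from `d` on. -/
structure SameBelow (k d : ℕ) (s s' : State) : Prop where
  even : ∀ i, s'.natReg (2 * i) = s.natReg (2 * i)
  odd : ∀ i, i < k → s'.natReg (2 * i + 1) = s.natReg (2 * i + 1)
  real : ∀ j, j < d → s'.realReg j = s.realReg j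
  natMem : s'.natMem = s.natMem
  realMem : s'.realMem = s.realMem

theorem SameBelow.trans {k d k' d' : ℕ} {s s' s'' : State} (h : SameBelow k d s s')
    (h' : SameBelow k' d' s' s'') (hk : k ≤ k') (hd : d ≤ d') : SameBelow k d s s'' where
  even i := (h'.even i).trans (h.even i)
  odd i hi := (h'.odd i (by omega)).trans (h.odd i hi)
  real j hj := (h'.real j (by omega)).trans (h.real j hj)
  natMem := h'.natMem.trans h.natMem
  realMem := h'.realMem.trans h.realMem

theorem SameBelow.represents {k d : ℕ} {s s' : State} (h : SameBelow k d s s') {σ : Store}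
    (hσ : Represents s σ) : Represents s' σ :=
  ⟨fun i => (h.even i).trans (hσ.1 i), h.natMem.trans hσ.2.1, h.realMem.trans hσ.2.2⟩

/-- Expressions for natural numbers. -/
inductive NExp where
  | const (k : ℕ)
  | var (i : ℕ)
  | add (a b : NExp)
  | sub (a b : NExp)
  | mem (a : NExp)

/-- The value of an expression. -/
def NExp.eval (σ : Store) : NExp → ℕ
  | const k => k
  | var i => σ.v i
  | add a b => a.eval σ + b.eval σ
  | sub a b => a.eval σ - b.eval σ
  | mem a => σ.m (a.eval σ)

/-- Code that computes the value of an expression in register `2 * k + 1`. -/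
def NExp.code : NExp → ℕ → List Instr
  | const c, k => [.natConst (2 * k + 1) c]
  | var i, k => [.natConst (2 * k + 1) 0, .natAdd (2 * k + 1) (2 * i) (2 * k + 1)]
  | add a b, k => a.code k ++ (b.code (k + 1) ++ [.natAdd (2 * k + 1) (2 * k + 1) (2 * k + 3)])
  | sub a b, k => a.code k ++ (b.code (k + 1) ++ [.natSub (2 * k + 1) (2 * k + 1) (2 * k + 3)])
  | mem a, k => a.code k ++ [.natLoad (2 * k + 1) (2 * k + 1)]

theorem sameBelow_update (s : State) (k d p w : ℕ) :
    SameBelow k d s { s with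
      pc := p, natReg := Function.update s.natReg (2 * k + 1) w } := by
  refine ⟨fun i => ?_, fun i hi => ?_, fun _ _ => rfl, rfl, rfl⟩ <;>
  exact Function.update_of_ne (by omega) _ _

theorem sameBelow_update_real (s : State) (k d p : ℕ) (w : ℝ) :
    SameBelow k d s { s with pc := p, realReg := Function.update s.realReg d w } := by
  refine ⟨fun _ => rfl, fun _ _ => rfl, fun j hj => ?_, rfl, rfl⟩
  exact Function.update_of_ne hj.ne _ _

/-- The effect of code that computes the value `w` in register `2 * k + 1`. -/
def NComputes (P : Program) (l : List Instr) (k d w : ℕ) (s : State) : Prop :=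
  ∃ s', run P l.length s = some s' ∧ s'.pc = s.pc + l.length ∧
    s'.natReg (2 * k + 1) = w ∧ SameBelow k d s s'

theorem NComputes.append {P : Program} {l : List Instr} {k d w w' : ℕ} {s : State}
    {ins : Instr} (h : CodeAt P s.pc (l ++ [ins])) (h₁ : NComputes P l k d w s)
    (h₂ : ∀ s' : State, SameBelow k d s s' → s'.natReg (2 * k + 1) = w →
      ins.exec s' = some { s' with
        pc := s'.pc + 1, natReg := Function.update s'.natReg (2 * k + 1) w' }) :
    NComputes P (l ++ [ins]) k d w' s := by
  obtain ⟨s₁, r₁, p₁, e₁, f₁⟩ := h₁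
  have h' := h.right
  rw [← p₁] at h'
  have r₂ := run_one h'.get (h₂ s₁ f₁ e₁)
  have r := run_trans r₁ r₂
  rw [show l.length + 1 = (l ++ [ins]).length by simp] at r
  refine ⟨_, r, ?_, Function.update_self _ _ _,
    f₁.trans (sameBelow_update s₁ k d _ _) le_rfl le_rfl⟩
  rw [List.length_append, ← add_assoc, ← p₁]; rfl

/-- The second operand is computed one register pair higher, so by `SameBelow` it cannot overwrite
the first one. -/
theorem NComputes.binary {P : Program} {l l' : List Instr} {k d w w' w'' : ℕ} {s : State}
    {ins : Instr} (h : CodeAt P s.pc (l ++ (l' ++ [ins]))) (h₁ : NComputes P l k d w s)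
    (h₂ : ∀ s', s'.pc = s.pc + l.length → SameBelow k d s s' → NComputes P l' (k + 1) d w' s')
    (h₃ : ∀ s' : State, s'.natReg (2 * k + 1) = w → s'.natReg (2 * k + 3) = w' →
      ins.exec s' = some { s' with
        pc := s'.pc + 1, natReg := Function.update s'.natReg (2 * k + 1) w'' }) :
    NComputes P (l ++ (l' ++ [ins])) k d w'' s := by
  obtain ⟨s₁, r₁, p₁, e₁, f₁⟩ := h₁
  have h' := h.right
  rw [← p₁] at h'
  obtain ⟨s₂, r₂, p₂, e₂, f₂⟩ := h₂ s₁ p₁ f₁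
  have h'' := h'.right
  rw [← p₂] at h''
  have r₃ := run_one h''.get (h₃ s₂ ((f₂.odd k (Nat.lt_succ_self k)).trans e₁) e₂)
  have r := run_trans r₁ (run_trans r₂ r₃)
  rw [show l.length + (l'.length + 1) = (l ++ (l' ++ [ins])).length by simp] at r
  refine ⟨_, r, ?_, Function.update_self _ _ _, (f₁.trans f₂ (Nat.le_succ k) le_rfl).trans
    (sameBelow_update s₂ k d _ _) le_rfl le_rfl⟩
  rw [List.length_append, List.length_append, ← add_assoc, ← p₁, ← add_assoc, ← p₂]; rfl

/-- Variables sit in even registers and intermediate results in odd ones, so the store stays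
represented during the evaluation. A variable is copied by adding zero to it. -/
theorem NExp.run_code {P : Program} {σ : Store} (e : NExp) {k : ℕ} {s : State} (d : ℕ)
    (h : CodeAt P s.pc (e.code k)) (hσ : Represents s σ) :
    NComputes P (e.code k) k d (e.eval σ) s := by
  induction e generalizing k s with
  | const c =>
    exact ⟨_, run_one h.get rfl, rfl, Function.update_self _ _ _, sameBelow_update s k d _ _⟩
  | var i =>
    have h₀ : NComputes P [.natConst (2 * k + 1) 0] k d 0 s :=
      ⟨_, run_one h.get rfl, rfl, Function.update_self _ _ _, sameBelow_update s k d _ _⟩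
    refine NComputes.append (l := [.natConst (2 * k + 1) 0]) h h₀ fun s' f e => ?_
    rw [Instr.exec, e, f.even, hσ.1]
    rfl
  | add a b iha ihb =>
    refine .binary h (iha h.left hσ) (fun s' p f => ihb ?_ (f.represents hσ)) (fun s' e₁ e₂ => ?_)
    · rw [p]; exact h.right.left
    · rw [Instr.exec, e₁, e₂]; rfl
  | sub a b iha ihb =>
    refine .binary h (iha h.left hσ) (fun s' p f => ihb ?_ (f.represents hσ)) (fun s' e₁ e₂ => ?_)
    · rw [p]; exact h.right.left
    · rw [Instr.exec, e₁, e₂]; rfl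
  | mem a iha =>
    refine .append h (iha h.left hσ) fun s' f e => ?_
    rw [Instr.exec, e, (f.represents hσ).2.1]
    rfl

/-- Expressions for real numbers. -/
inductive RExp where
  | const (k : ℕ)
  | add (a b : RExp)
  | sub (a b : RExp)
  | mul (a b : RExp)
  | div (a b : RExp)
  | sqrt (a : RExp)
  | mem (a : NExp)

/-- The value of an expression. -/
def RExp.eval (σ : Store) : RExp → ℝ
  | const k => k
  | add a b => a.eval σ + b.eval σ
  | sub a b => a.eval σ - b.eval σ
  | mul a b => a.eval σ * b.eval σ
  | div a b => a.eval σ / b.eval σ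
  | sqrt a => Real.sqrt (a.eval σ)
  | mem a => σ.x (a.eval σ)

/-- No division by zero and no square root of a negative number occurs in the evaluation. -/
def RExp.Safe (σ : Store) : RExp → Prop
  | const _ => True
  | add a b => a.Safe σ ∧ b.Safe σ
  | sub a b => a.Safe σ ∧ b.Safe σ
  | mul a b => a.Safe σ ∧ b.Safe σ
  | div a b => a.Safe σ ∧ b.Safe σ ∧ b.eval σ ≠ 0
  | sqrt a => a.Safe σ ∧ 0 ≤ a.eval σ
  | mem _ => True

/-- Code that computes the value of an expression in the real register `d`. -/
def RExp.code : RExp → ℕ → ℕ → List Instr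
  | const c, _, d => [.realConst d c]
  | add a b, k, d => a.code k d ++ (b.code k (d + 1) ++ [.realAdd d d (d + 1)])
  | sub a b, k, d => a.code k d ++ (b.code k (d + 1) ++ [.realSub d d (d + 1)])
  | mul a b, k, d => a.code k d ++ (b.code k (d + 1) ++ [.realMul d d (d + 1)])
  | div a b, k, d => a.code k d ++ (b.code k (d + 1) ++ [.realDiv d d (d + 1)])
  | sqrt a, k, d => a.code k d ++ [.realSqrt d d]
  | mem a, k, d => a.code k ++ [.realLoad d (2 * k + 1)]

/-- The effect of code that computes the value `w` in the real register `d`. -/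
def Computes (P : Program) (l : List Instr) (k d : ℕ) (w : ℝ) (s : State) : Prop :=
  ∃ s', run P l.length s = some s' ∧ s'.pc = s.pc + l.length ∧
    s'.realReg d = w ∧ SameBelow k d s s'

theorem Computes.binary {P : Program} {l l' : List Instr} {k d : ℕ} {w w' w'' : ℝ} {s : State}
    {ins : Instr} (h : CodeAt P s.pc (l ++ (l' ++ [ins]))) (h₁ : Computes P l k d w s)
    (h₂ : ∀ s', s'.pc = s.pc + l.length → SameBelow k d s s' → Computes P l' k (d + 1) w' s')
    (h₃ : ∀ s' : State, s'.realReg d = w → s'.realReg (d + 1) = w' →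
      ins.exec s' = some { s' with
        pc := s'.pc + 1, realReg := Function.update s'.realReg d w'' }) :
    Computes P (l ++ (l' ++ [ins])) k d w'' s := by
  obtain ⟨s₁, r₁, p₁, e₁, f₁⟩ := h₁
  have h' := h.right
  rw [← p₁] at h'
  obtain ⟨s₂, r₂, p₂, e₂, f₂⟩ := h₂ s₁ p₁ f₁
  have h'' := h'.right
  rw [← p₂] at h''
  have r₃ := run_one h''.get (h₃ s₂ ((f₂.real d (by omega)).trans e₁) e₂)
  have r := run_trans r₁ (run_trans r₂ r₃)
  rw [show l.length + (l'.length + 1) = (l ++ (l' ++ [ins])).length by simp] at r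
  refine ⟨_, r, ?_, Function.update_self _ _ _, (f₁.trans f₂ le_rfl (Nat.le_succ d)).trans
    (sameBelow_update_real s₂ k d _ _) le_rfl le_rfl⟩
  rw [List.length_append, List.length_append, ← add_assoc, ← p₁, ← add_assoc, ← p₂]; rfl

theorem RExp.run_code {P : Program} {σ : Store} (e : RExp) {k d : ℕ} {s : State}
    (h : CodeAt P s.pc (e.code k d)) (hσ : Represents s σ) (hs : e.Safe σ) :
    Computes P (e.code k d) k d (e.eval σ) s := by
  induction e generalizing d s with
  | const c =>
    exact ⟨_, run_one h.get rfl, rfl, Function.update_self _ _ _, sameBelow_update_real s k d _ _⟩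
  | add a b iha ihb =>
    refine .binary h (iha h.left hσ hs.1) (fun s' p f => ihb ?_ (f.represents hσ) hs.2)
      (fun s' e₁ e₂ => ?_)
    · rw [p]; exact h.right.left
    · simp [Instr.exec, e₁, e₂, RExp.eval]
  | sub a b iha ihb =>
    refine .binary h (iha h.left hσ hs.1) (fun s' p f => ihb ?_ (f.represents hσ) hs.2)
      (fun s' e₁ e₂ => ?_)
    · rw [p]; exact h.right.left
    · simp [Instr.exec, e₁, e₂, RExp.eval]
  | mul a b iha ihb =>
    refine .binary h (iha h.left hσ hs.1) (fun s' p f => ihb ?_ (f.represents hσ) hs.2)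
      (fun s' e₁ e₂ => ?_)
    · rw [p]; exact h.right.left
    · simp [Instr.exec, e₁, e₂, RExp.eval]
  | div a b iha ihb =>
    refine .binary h (iha h.left hσ hs.1) (fun s' p f => ihb ?_ (f.represents hσ) hs.2.1)
      (fun s' e₁ e₂ => ?_)
    · rw [p]; exact h.right.left
    · simp [Instr.exec, e₁, e₂, RExp.eval, hs.2.2]
  | sqrt a iha =>
    obtain ⟨s₁, r₁, p₁, e₁, f₁⟩ := iha h.left hσ hs.1
    have h' := h.right
    rw [← p₁] at h'
    have r₂ := run_one h'.get (y := { s₁ with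
      pc := s₁.pc + 1, realReg := Function.update s₁.realReg d (√(a.eval σ)) })
      (by rw [Instr.exec, e₁, if_neg hs.2.not_gt])
    have r := run_trans r₁ r₂
    rw [show (a.code k d).length + 1 = (RExp.code (.sqrt a) k d).length by simp [RExp.code]] at r
    refine ⟨_, r, ?_, Function.update_self _ _ _,
      f₁.trans (sameBelow_update_real s₁ k d _ _) le_rfl le_rfl⟩
    rw [RExp.code, List.length_append, ← add_assoc, ← p₁]; rfl
  | mem a =>
    obtain ⟨s₁, r₁, p₁, e₁, f₁⟩ := a.run_code d h.left hσ
    have h' := h.right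
    rw [← p₁] at h'
    have r₂ := run_one h'.get (y := { s₁ with
      pc := s₁.pc + 1, realReg := Function.update s₁.realReg d (σ.x (a.eval σ)) })
      (by rw [Instr.exec, e₁, (f₁.represents hσ).2.2])
    have r := run_trans r₁ r₂
    rw [show (a.code k).length + 1 = (RExp.code (.mem a) k d).length by simp [RExp.code]] at r
    refine ⟨_, r, ?_, Function.update_self _ _ _,
      f₁.trans (sameBelow_update_real s₁ k d _ _) le_rfl le_rfl⟩
    rw [RExp.code, List.length_append, ← add_assoc, ← p₁]; rfl

end
end ConveyorBelt

/-! ### Compilation of tests, commands and loops, with step counts. -/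

namespace ConveyorBelt
noncomputable section
open Real

/-! ### Tests and commands -/

/-- Comparisons. -/
inductive Test where
  | nat (a b : NExp)
  | real (a b : RExp)

/-- The comparison holds. -/
def Test.Holds (σ : Store) : Test → Prop
  | nat a b => a.eval σ ≤ b.eval σ
  | real a b => a.eval σ ≤ b.eval σ

/-- The comparison can be evaluated. -/
def Test.Safe (σ : Store) : Test → Prop
  | nat _ _ => True
  | real a b => a.Safe σ ∧ b.Safe σ

/-- Code that jumps to line `l` if the comparison holds. -/
def Test.code : Test → ℕ → List Instr
  | nat a b, l => a.code 0 ++ (b.code 1 ++ [.jumpNatLE 1 3 l])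
  | real a b, l => a.code 0 0 ++ (b.code 0 1 ++ [.jumpRealLE 0 1 l])

/-- The length of the code of a comparison. -/
def Test.len (b : Test) : ℕ := (b.code 0).length

theorem Test.length_code (b : Test) (l : ℕ) : (b.code l).length = b.len := by
  cases b <;> simp [Test.code, Test.len]

/-- Started at line `p` in a state that represents `σ`, the program reaches line `q` in a state
that represents `τ` within `t` steps. -/
def Runs (P : Program) (p : ℕ) (σ : Store) (t q : ℕ) (τ : Store) : Prop :=
  ∀ s, s.pc = p → Represents s σ →
    ∃ t' ≤ t, ∃ s', run P t' s = some s' ∧ s'.pc = q ∧ Represents s' τ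

theorem Runs.trans {P : Program} {p q r t t' : ℕ} {σ τ ω : Store} (h : Runs P p σ t q τ)
    (h' : Runs P q τ t' r ω) : Runs P p σ (t + t') r ω := by
  intro s hp hσ
  obtain ⟨u, hu, s₁, r₁, p₁, f₁⟩ := h s hp hσ
  obtain ⟨u', hu', s₂, r₂, p₂, f₂⟩ := h' s₁ p₁ f₁
  exact ⟨u + u', by omega, s₂, run_trans r₁ r₂, p₂, f₂⟩

theorem Runs.mono {P : Program} {p q t t' : ℕ} {σ τ : Store} (h : Runs P p σ t q τ)
    (ht : t ≤ t') : Runs P p σ t' q τ := by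
  intro s hp hσ
  obtain ⟨u, hu, h⟩ := h s hp hσ
  exact ⟨u, hu.trans ht, h⟩

theorem Runs.refl (P : Program) (p : ℕ) (σ : Store) : Runs P p σ 0 p σ :=
  fun s hp hσ => ⟨0, le_rfl, s, rfl, hp, hσ⟩

theorem runs_jump {P : Program} {p l : ℕ} {L : List Instr} (h : CodeAt P p (.jump l :: L))
    (σ : Store) : Runs P p σ 1 l σ := by
  rintro s rfl hσ
  exact ⟨1, le_rfl, _, run_one h.get rfl, rfl, hσ⟩

-- Evaluation leaves the store unchanged, so a test affects only the program counter: it jumps to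
-- `l` or falls through to the line behind its code.
open Classical in
theorem Test.runs {P : Program} (b : Test) {p l : ℕ} {σ : Store} (h : CodeAt P p (b.code l))
    (hs : b.Safe σ) : Runs P p σ b.len (if b.Holds σ then l else p + b.len) σ := by
  rintro s rfl hσ
  refine ⟨b.len, le_rfl, ?_⟩
  rw [← b.length_code l]
  cases b with
  | nat a b =>
    obtain ⟨s₁, r₁, p₁, e₁, f₁⟩ := a.run_code 0 h.left hσ
    have h' := h.right
    rw [← p₁] at h'
    obtain ⟨s₂, r₂, p₂, e₂, f₂⟩ := b.run_code 0 h'.left (f₁.represents hσ)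
    have h'' := h'.right
    rw [← p₂] at h''
    have e₁' : s₂.natReg 1 = a.eval σ := (f₂.odd 0 one_pos).trans e₁
    have e₂' : s₂.natReg 3 = b.eval σ := e₂
    have r₃ := run_one h''.get (y := { s₂ with
      pc := if a.eval σ ≤ b.eval σ then l else s₂.pc + 1 }) (by rw [Instr.exec, e₁', e₂'])
    have r := run_trans r₁ (run_trans r₂ r₃)
    rw [show (a.code 0).length + ((b.code 1).length + 1) = (Test.code (.nat a b) l).length by
      simp [Test.code]] at r
    refine ⟨_, r, ?_, f₂.represents (f₁.represents hσ)⟩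
    simp only [Test.code, Test.Holds, p₂, p₁, List.length_append, List.length_singleton, add_assoc]
  | real a b =>
    obtain ⟨s₁, r₁, p₁, e₁, f₁⟩ := a.run_code h.left hσ hs.1
    have h' := h.right
    rw [← p₁] at h'
    obtain ⟨s₂, r₂, p₂, e₂, f₂⟩ := b.run_code h'.left (f₁.represents hσ) hs.2
    have h'' := h'.right
    rw [← p₂] at h''
    have e₁' : s₂.realReg 0 = a.eval σ := (f₂.real 0 one_pos).trans e₁
    have e₂' : s₂.realReg 1 = b.eval σ := e₂
    have r₃ := run_one h''.get (y := { s₂ with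
      pc := if a.eval σ ≤ b.eval σ then l else s₂.pc + 1 }) (by rw [Instr.exec, e₁', e₂'])
    have r := run_trans r₁ (run_trans r₂ r₃)
    rw [show (a.code 0 0).length + ((b.code 0 1).length + 1) = (Test.code (.real a b) l).length by
      simp [Test.code]] at r
    refine ⟨_, r, ?_, f₂.represents (f₁.represents hσ)⟩
    simp only [Test.code, Test.Holds, p₂, p₁, List.length_append, List.length_singleton, add_assoc]

/-- Commands without loops. -/
inductive Cmd where
  | skip
  | set (i : ℕ) (e : NExp)
  | nstore (a e : NExp)
  | rstore (a : NExp) (e : RExp)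
  | seq (c c' : Cmd)
  | ite (b : Test) (c c' : Cmd)

open Classical in
/-- The effect of a command. -/
def Cmd.exec : Cmd → Store → Store
  | skip, σ => σ
  | set i e, σ => { σ with v := Function.update σ.v i (e.eval σ) }
  | nstore a e, σ => { σ with m := Function.update σ.m (a.eval σ) (e.eval σ) }
  | rstore a e, σ => { σ with x := Function.update σ.x (a.eval σ) (e.eval σ) }
  | seq c c', σ => c'.exec (c.exec σ)
  | ite b c c', σ => if b.Holds σ then c.exec σ else c'.exec σ

/-- The command can be executed. -/
def Cmd.Safe : Cmd → Store → Prop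
  | skip, _ => True
  | set _ _, _ => True
  | nstore _ _, _ => True
  | rstore _ e, σ => e.Safe σ
  | seq c c', σ => c.Safe σ ∧ c'.Safe (c.exec σ)
  | ite b c c', σ => b.Safe σ ∧ (b.Holds σ → c.Safe σ) ∧ (¬ b.Holds σ → c'.Safe σ)

/-- The length of the code of a command. -/
def Cmd.len : Cmd → ℕ
  | skip => 0
  | set _ e => (e.code 0).length + 2
  | nstore a e => (a.code 0).length + ((e.code 1).length + 1)
  | rstore a e => (a.code 0).length + ((e.code 1 0).length + 1)
  | seq c c' => c.len + c'.len
  | ite b c c' => b.len + (c'.len + (1 + c.len))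

/-- The code of a command that is placed at line `p`. -/
def Cmd.code : Cmd → ℕ → List Instr
  | skip, _ => []
  | set i e, _ => e.code 0 ++ [.natConst 3 0, .natAdd (2 * i) 1 3]
  | nstore a e, _ => a.code 0 ++ (e.code 1 ++ [.natStore 1 3])
  | rstore a e, _ => a.code 0 ++ (e.code 1 0 ++ [.realStore 1 0])
  | seq c c', p => c.code p ++ c'.code (p + c.len)
  | ite b c c', p => b.code (p + b.len + c'.len + 1) ++ (c'.code (p + b.len) ++
      (.jump (p + b.len + c'.len + 1 + c.len) :: c.code (p + b.len + c'.len + 1)))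

theorem Cmd.length_code (c : Cmd) (p : ℕ) : (c.code p).length = c.len := by
  induction c generalizing p with
  | skip => rfl
  | set => simp [code, len]
  | nstore => simp [code, len]
  | rstore => simp [code, len]
  | seq _ _ h h' => simp [code, len, h, h']
  | ite _ _ _ h h' => simp [code, len, h, h', Test.length_code]; omega

/-- The execution of a command takes at most as many steps as its code is long. -/
theorem Cmd.runs {P : Program} (c : Cmd) {p : ℕ} {σ : Store} (h : CodeAt P p (c.code p))
    (hs : c.Safe σ) : Runs P p σ c.len (p + c.len) (c.exec σ) := by
  induction c generalizing p σ with
  | skip => exact .refl P p σ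
  | set i e =>
    rintro s rfl hσ
    obtain ⟨s₁, r₁, p₁, e₁, f₁⟩ := e.run_code 0 h.left hσ
    have h' := h.right
    rw [← p₁] at h'
    have e₁' : s₁.natReg 1 = e.eval σ := e₁
    have r₂ := run_one h'.get (y := { s₁ with
      pc := s₁.pc + 1, natReg := Function.update s₁.natReg 3 0 }) rfl
    have r₃ := run_one (P := P) (x := { s₁ with
      pc := s₁.pc + 1, natReg := Function.update s₁.natReg 3 0 }) h'.tail.get
      (y := { s₁ with
        pc := s₁.pc + 1 + 1
        natReg := Function.update (Function.update s₁.natReg 3 0) (2 * i) (e.eval σ) })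
      (by simp [Instr.exec, e₁'])
    refine ⟨_, le_rfl, _, run_trans r₁ (run_trans r₂ r₃), ?_, fun j => ?_, ?_, ?_⟩
    · simp only [len, p₁, add_assoc]
    · by_cases hij : j = i
      · subst hij; simp only [exec, Function.update_self]
      · have h₁ : 2 * j ≠ 2 * i := by omega
        have h₂ : 2 * j ≠ 3 := by omega
        simp only [exec, Function.update_of_ne h₁, Function.update_of_ne h₂,
          Function.update_of_ne hij]
        exact (f₁.represents hσ).1 j
    · exact (f₁.represents hσ).2.1
    · exact (f₁.represents hσ).2.2
  | nstore a e =>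
    rintro s rfl hσ
    obtain ⟨s₁, r₁, p₁, e₁, f₁⟩ := a.run_code 0 h.left hσ
    have h' := h.right
    rw [← p₁] at h'
    have hσ₁ := f₁.represents hσ
    obtain ⟨s₂, r₂, p₂, e₂, f₂⟩ := e.run_code 0 h'.left hσ₁
    have h'' := h'.right
    rw [← p₂] at h''
    have hσ₂ := f₂.represents hσ₁
    have e₁' : s₂.natReg 1 = a.eval σ := (f₂.odd 0 one_pos).trans e₁
    have e₂' : s₂.natReg 3 = e.eval σ := e₂
    have r₃ := run_one h''.get (y := { s₂ with
      pc := s₂.pc + 1, natMem := Function.update σ.m (a.eval σ) (e.eval σ) })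
      (by rw [Instr.exec, e₁', e₂', hσ₂.2.1])
    refine ⟨_, le_rfl, _, run_trans r₁ (run_trans r₂ r₃), ?_, hσ₂.1, rfl, hσ₂.2.2⟩
    simp only [len, p₁, p₂, add_assoc]
  | rstore a e =>
    rintro s rfl hσ
    obtain ⟨s₁, r₁, p₁, e₁, f₁⟩ := a.run_code 0 h.left hσ
    have h' := h.right
    rw [← p₁] at h'
    have hσ₁ := f₁.represents hσ
    obtain ⟨s₂, r₂, p₂, e₂, f₂⟩ := e.run_code h'.left hσ₁ hs
    have h'' := h'.right
    rw [← p₂] at h''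
    have hσ₂ := f₂.represents hσ₁
    have e₁' : s₂.natReg 1 = a.eval σ := (f₂.odd 0 one_pos).trans e₁
    have r₃ := run_one h''.get (y := { s₂ with
      pc := s₂.pc + 1, realMem := Function.update σ.x (a.eval σ) (e.eval σ) })
      (by rw [Instr.exec, e₁', e₂, hσ₂.2.2])
    refine ⟨_, le_rfl, _, run_trans r₁ (run_trans r₂ r₃), ?_, hσ₂.1, hσ₂.2.1, rfl⟩
    simp only [len, p₁, p₂, add_assoc]
  | seq c c' ih ih' =>
    have h' := h.right
    rw [c.length_code] at h'
    have := (ih h.left hs.1).trans (ih' h' hs.2)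
    rwa [add_assoc] at this
  | ite b c c' ih ih' =>
    have h₁ := h.right
    rw [b.length_code] at h₁
    have h₂ := h₁.right
    rw [c'.length_code] at h₂
    have k := b.runs h.left hs.1
    by_cases hb : b.Holds σ
    · rw [if_pos hb] at k
      have := k.trans (ih h₂.tail (hs.2.1 hb))
      rw [exec, if_pos hb]
      rw [show p + b.len + c'.len + 1 + c.len = p + (ite b c c').len by simp only [len]; omega]
        at this
      exact this.mono (by simp only [len]; omega)
    · rw [if_neg hb] at k
      have := (k.trans (ih' h₁.left (hs.2.2 hb))).trans (runs_jump h₂ _)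
      rw [exec, if_neg hb]
      rw [show p + b.len + c'.len + 1 + c.len = p + (ite b c c').len by simp only [len]; omega]
        at this
      exact this.mono (by simp only [len]; omega)

/-! ### Loops -/

/-- The length of the code of a loop. -/
def loopLen (b : Test) (c : Cmd) : ℕ := b.len + (1 + (c.len + 1))

/-- The code of a loop that is placed at line `p`. -/
def loopCode (b : Test) (c : Cmd) (p : ℕ) : List Instr :=
  b.code (p + b.len + 1) ++ (.jump (p + loopLen b c) :: (c.code (p + b.len + 1) ++ [.jump p]))

theorem length_loopCode (b : Test) (c : Cmd) (p : ℕ) :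
    (loopCode b c p).length = loopLen b c := by
  simp [loopCode, loopLen, Test.length_code, Cmd.length_code]; omega

/-- A loop ends if every execution of its body decreases the bound in the invariant. -/
theorem runs_loop {P : Program} {b : Test} {c : Cmd} {p : ℕ} (h : CodeAt P p (loopCode b c p))
    (I : ℕ → Store → Prop) (hs : ∀ k σ, I k σ → b.Safe σ)
    (hI : ∀ k σ, I k σ → b.Holds σ → c.Safe σ ∧ ∃ k' < k, I k' (c.exec σ)) {k : ℕ} {σ : Store}
    (hσ : I k σ) : ∃ k' τ, I k' τ ∧ ¬ b.Holds τ ∧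
      Runs P p σ ((k + 1) * loopLen b c) (p + loopLen b c) τ := by
  induction k using Nat.strong_induction_on generalizing σ with
  | _ k ih =>
    have h₁ := h.right
    rw [b.length_code] at h₁
    have h₂ := h₁.tail.right
    rw [c.length_code] at h₂
    have r := b.runs h.left (hs k σ hσ)
    by_cases hb : b.Holds σ
    · rw [if_pos hb] at r
      obtain ⟨hc, k', hk, hσ'⟩ := hI k σ hσ hb
      obtain ⟨k'', τ, i₁, i₂, i₃⟩ := ih k' hk hσ'
      refine ⟨k'', τ, i₁, i₂, ?_⟩
      -- One round costs the test, the body and the jump back, at most the length of the loop code.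
      -- The round lowers the bound, which pays for it.
      have r' := ((r.trans (c.runs h₁.tail.left hc)).trans (runs_jump h₂ _)).trans i₃
      refine r'.mono ?_
      have e : b.len + c.len + 1 ≤ loopLen b c := by unfold loopLen; omega
      have : (k' + 1 + 1) * loopLen b c ≤ (k + 1) * loopLen b c :=
        Nat.mul_le_mul_right _ (by omega)
      rw [add_mul _ 1, one_mul] at this
      omega
    · rw [if_neg hb] at r
      refine ⟨k, σ, hσ, hb, (r.trans (runs_jump h₁ σ)).mono ?_⟩
      have : 1 * loopLen b c ≤ (k + 1) * loopLen b c := Nat.mul_le_mul_right _ (by omega)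
      have e : b.len + 1 ≤ loopLen b c := by unfold loopLen; omega
      omega

end
end ConveyorBelt

/-! ### Comparison of directions by arithmetic, and the hull scan. -/

namespace ConveyorBelt
noncomputable section
open Real

/-! ### Comparison of directions by arithmetic operations -/

/-- On `(-π, π)` the denominator is positive, and the left side is increasing in `θ`. So directions
are compared through a rational expression in sine and cosine, without trigonometric instructions.
-/
theorem tan_half {θ : ℝ} (h₁ : -π < θ) (h₂ : θ < π) : tan (θ / 2) = sin θ / (1 + cos θ) := by
  have h : 0 < cos (θ / 2) := cos_pos_of_mem_Ioo ⟨by linarith, by linarith⟩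
  have e₁ : sin θ = 2 * sin (θ / 2) * cos (θ / 2) := by rw [← sin_two_mul]; congr 1; ring
  have e₂ : cos θ = 2 * cos (θ / 2) ^ 2 - 1 := by rw [← cos_two_mul]; congr 1; ring
  rw [tan_eq_sin_div_cos, e₁, e₂, div_eq_div_iff h.ne' (by nlinarith)]
  ring

theorem tan_half_le_iff {θ φ : ℝ} (h₁ : -π < θ ∧ θ < π) (h₂ : -π < φ ∧ φ < π) :
    tan (θ / 2) ≤ tan (φ / 2) ↔ θ ≤ φ := by
  rw [strictMonoOn_tan.le_iff_le ⟨by linarith, by linarith⟩ ⟨by linarith, by linarith⟩]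
  constructor <;> intro h <;> linarith

section
variable {z : ℕ → ℂ} {n r q : ℕ}

/-- In coordinates along the bitangent the chord has lateral part `-k`, so its longitudinal part is
the square root `s`. Rotating back gives `cos T = (a * s - b * k) / (a * a + b * b)` and `sin T = (a
* k + b * s) / (a * a + b * b)`, and the common denominator cancels. -/
theorem SeparatedSeq.tan_half_tangentDir (S : SeparatedSeq z n) (ρ τ : Side) (h : r < q)
    (hq : q < n) :
    let a := (z q).re - (z r).re
    let b := (z q).im - (z r).im
    let k := ρ.sign - τ.sign
    let s := √(a * a + b * b - k * k)
    0 ≤ a * a + b * b - k * k ∧ a * a + b * b + (a * s - b * k) ≠ 0 ∧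
      (a * k + b * s) / (a * a + b * b + (a * s - b * k)) = tan (tangentDir z r ρ q τ / 2) := by
  intro a b k s
  set T := tangentDir z r ρ q τ with hT
  obtain ⟨m₁, m₂⟩ := S.tangentDir_mem ρ τ h hq
  have hd := S.two_lt r q h hq
  have e₁ : lat T (z q - z r) = -k := lat_bitangentAngle hd (ρ.abs_sub_le τ)
  have e₂ : 0 < lon T (z q - z r) := lon_bitangentAngle_pos hd (ρ.abs_sub_le τ)
  have ha : (z q - z r).re = a := rfl
  have hb : (z q - z r).im = b := rfl
  have e₃ : lon T (z q - z r) = a * cos T + b * sin T := by rw [lon, ha, hb]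
  have e₄ : -k = b * cos T - a * sin T := by rw [← e₁, lat, ha, hb]
  have e₅ := sin_sq_add_cos_sq T
  have e₆ : a * a + b * b - k * k = (a * cos T + b * sin T) ^ 2 := by
    have : k = a * sin T - b * cos T := by linarith
    rw [this]; linear_combination (-(a ^ 2 + b ^ 2)) * e₅
  have hs : s = a * cos T + b * sin T := by
    change √(a * a + b * b - k * k) = _
    rw [e₆, sqrt_sq (by rw [← e₃]; exact e₂.le)]
  have hk : k = a * sin T - b * cos T := by linarith
  have e₇ : a * a + b * b + (a * s - b * k) = (a * a + b * b) * (1 + cos T) := by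
    rw [hs, hk]; linear_combination 0 * e₅
  have e₈ : a * k + b * s = (a * a + b * b) * sin T := by
    rw [hs, hk]; ring
  have hcos := neg_one_lt_cos m₁ m₂
  have hpos : 0 < a * a + b * b := by
    have := S.re_pos h hq
    rw [ha] at this
    nlinarith
  refine ⟨by rw [e₆]; positivity, ?_, ?_⟩
  · rw [e₇]; exact (mul_pos hpos (by linarith)).ne'
  · rw [e₇, e₈, mul_div_mul_left _ _ hpos.ne', tan_half m₁ m₂]

end

/-! ### The input of the program -/

/-- The coordinates are in the memory, followed by the signs of the sides. -/
structure Input (z : ℕ → ℂ) (n : ℕ) (σ : Store) : Prop where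
  size : σ.v 0 = n
  re : ∀ i, i < n → σ.x (i + i) = (z i).re
  im : ∀ i, i < n → σ.x (i + i + 1) = (z i).im
  sign : ∀ ρ : Side, σ.x (n + n + ρ.code) = ρ.sign

/-- The coordinates of a center. -/
def reExp (a : NExp) : RExp := .mem (a.add a)

/-- The coordinates of a center. -/
def imExp (a : NExp) : RExp := .mem ((a.add a).add (.const 1))

/-- The cross product that tells the turn of three centers. -/
def crossExp (a b c : NExp) : RExp :=
  .sub (.mul (.sub (reExp b) (reExp a)) (.sub (imExp c) (imExp b)))
    (.mul (.sub (imExp b) (imExp a)) (.sub (reExp c) (reExp b)))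

/-- The sign of a side that is given by its code. -/
def signExp (ρ : NExp) : RExp := .mem (((NExp.var 0).add (.var 0)).add ρ)

/-- The tangent of half the direction of a bitangent, from the coordinates `a`, `b` of the
difference of the centers and the difference `k` of the signs. -/
def directionExp (a b k : RExp) : RExp :=
  let d := RExp.add (.mul a a) (.mul b b)
  let s := RExp.sqrt (.sub d (.mul k k))
  .div (.add (.mul a k) (.mul b s)) (.add d (.sub (.mul a s) (.mul b k)))

/-- The tangent of half the direction of the bitangent from `r`, on its side `ρ`, to `q`, on its
side `τ`. -/
def tangentExp (r ρ q τ : NExp) : RExp :=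
  directionExp (.sub (reExp q) (reExp r)) (.sub (imExp q) (imExp r))
    (.sub (signExp ρ) (signExp τ))

section
variable {z : ℕ → ℂ} {n : ℕ} {σ : Store} (H : Input z n σ)
include H

theorem Input.eval_crossExp {a b c : NExp} (ha : a.eval σ < n) (hb : b.eval σ < n)
    (hc : c.eval σ < n) : (crossExp a b c).eval σ =
      cross (z (b.eval σ) - z (a.eval σ)) (z (c.eval σ) - z (b.eval σ)) := by
  simp only [crossExp, reExp, imExp, RExp.eval, NExp.eval, H.re _ ha, H.re _ hb, H.re _ hc,
    H.im _ ha, H.im _ hb, H.im _ hc, cross, Complex.sub_re, Complex.sub_im]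

theorem Input.eval_tangentExp (S : SeparatedSeq z n) {r ρ q τ : NExp} {ρ' τ' : Side}
    (hr : r.eval σ < q.eval σ) (hq : q.eval σ < n) (hρ : ρ.eval σ = ρ'.code)
    (hτ : τ.eval σ = τ'.code) :
    (tangentExp r ρ q τ).Safe σ ∧ (tangentExp r ρ q τ).eval σ =
      tan (tangentDir z (r.eval σ) ρ' (q.eval σ) τ' / 2) := by
  obtain ⟨h₁, h₂, h₃⟩ := S.tan_half_tangentDir ρ' τ' hr hq
  have hr' := hr.trans hq
  have er := H.re _ hr'
  have ei := H.im _ hr'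
  have er' := H.re _ hq
  have ei' := H.im _ hq
  have es : σ.x (σ.v 0 + σ.v 0 + ρ.eval σ) = ρ'.sign := by rw [hρ, H.size]; exact H.sign ρ'
  have es' : σ.x (σ.v 0 + σ.v 0 + τ.eval σ) = τ'.sign := by rw [hτ, H.size]; exact H.sign τ'
  constructor
  · simp only [tangentExp, directionExp, RExp.Safe, RExp.eval, reExp, imExp, signExp, NExp.eval,
      er, ei, er', ei', es, es', true_and, and_true]
    exact ⟨h₁, h₁, h₂⟩
  · simp only [tangentExp, directionExp, RExp.eval, reExp, imExp, signExp, NExp.eval,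
      er, ei, er', ei', es, es']
    exact h₃

/-- Directions are compared by real arithmetic. -/
theorem Input.holds_tangentExp (S : SeparatedSeq z n) {r ρ q τ q₁ τ₁ : NExp} {ρ' τ' τ₁' : Side}
    (hr : r.eval σ < q.eval σ) (hq : q.eval σ < n) (hr₁ : r.eval σ < q₁.eval σ)
    (hq₁ : q₁.eval σ < n) (hρ : ρ.eval σ = ρ'.code) (hτ : τ.eval σ = τ'.code)
    (hτ₁ : τ₁.eval σ = τ₁'.code) :
    (Test.real (tangentExp r ρ q τ) (tangentExp r ρ q₁ τ₁)).Safe σ ∧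
    ((Test.real (tangentExp r ρ q τ) (tangentExp r ρ q₁ τ₁)).Holds σ ↔
      tangentDir z (r.eval σ) ρ' (q.eval σ) τ' ≤ tangentDir z (r.eval σ) ρ' (q₁.eval σ) τ₁') := by
  obtain ⟨h₁, h₂⟩ := H.eval_tangentExp S hr hq hρ hτ
  obtain ⟨h₃, h₄⟩ := H.eval_tangentExp S hr₁ hq₁ hρ hτ₁
  refine ⟨⟨h₁, h₃⟩, ?_⟩
  rw [Test.Holds, h₂, h₄]
  exact tan_half_le_iff (S.tangentDir_mem ρ' τ' hr hq) (S.tangentDir_mem ρ' τ₁' hr₁ hq₁)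

end

theorem safe_crossExp (σ : Store) (a b c : NExp) : (crossExp a b c).Safe σ := by
  simp [crossExp, reExp, imExp, RExp.Safe]

/-! ### The upper hull -/

/-- The address of the predecessor of a disk. -/
def predExp (a : NExp) : NExp :=
  (((NExp.var 0).add (.var 0)).add ((NExp.var 0).add (.var 0))).add a

/-- The cells below `4 * n` are left to the output, which has at most `2 * n` contacts of two cells
each; the table of predecessors starts behind them. -/
theorem Input.eval_predExp {z : ℕ → ℂ} {n : ℕ} {σ : Store} (H : Input z n σ) (a : NExp) :
    (predExp a).eval σ = 4 * n + a.eval σ := by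
  simp only [predExp, NExp.eval, H.size]; ring

/-- Whether there is a disk left. -/
def hullTest : Test := .nat ((NExp.var 1).add (.const 1)) (.var 0)

/-- The disk on top of the stack becomes the predecessor of the next disk, which is pushed. -/
def pushCmd : Cmd :=
  .seq (.nstore (predExp (.var 1)) (.var 2))
    (.seq (.set 2 (.var 1)) (.set 1 ((NExp.var 1).add (.const 1))))

/-- One step of the incremental computation of the upper hull. -/
def hullCmd : Cmd :=
  .ite (.nat (.var 2) (.const 0)) pushCmd
    (.ite (.real (crossExp (.mem (predExp (.var 2))) (.var 2) (.var 1)) (.const 0)) pushCmd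
      (.set 2 (.mem (predExp (.var 2)))))

/-- The invariant of the computation of the upper hull: the disks before the next disk have their
predecessors, and the disks after the top of the stack have been popped. -/
structure HullInv (z : ℕ → ℂ) (n k : ℕ) (σ : Store) : Prop where
  input : Input z n σ
  pos : 0 < σ.v 1
  le : σ.v 1 ≤ n
  lt : σ.v 2 < σ.v 1
  pred : ∀ j, 0 < j → j < σ.v 1 → HullPred z (σ.m (4 * n + j)) j
  pred_zero : σ.m (4 * n) = 0
  popped : ∀ j, σ.v 2 < j → j < σ.v 1 → σ.v 1 < n → ¬ Concave z (σ.v 2) j (σ.v 1)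
  bound : ∃ dep : ℕ → ℕ, (∀ j, 0 < j → j < σ.v 1 → dep (σ.m (4 * n + j)) < dep j) ∧
    2 * (n - σ.v 1) + dep (σ.v 2) ≤ k

theorem Input.exec_pushCmd {z : ℕ → ℂ} {n : ℕ} {σ : Store} (H : Input z n σ) :
    pushCmd.exec σ = ⟨Function.update (Function.update σ.v 2 (σ.v 1)) 1 (σ.v 1 + 1),
      Function.update σ.m (4 * n + σ.v 1) (σ.v 2), σ.x⟩ := by
  simp [pushCmd, Cmd.exec, H.eval_predExp, NExp.eval]

/-- The potential is twice the number of disks left plus the depth of the stack. A push removes one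
disk and adds one to the depth, so it decreases by one. The function `dep` records the depth at
which each disk was pushed. -/
theorem HullInv.push {z : ℕ → ℂ} {n k : ℕ} {σ : Store} (I : HullInv z n k σ) (h : σ.v 1 < n)
    (hb : ∀ j, j < σ.v 2 → Concave z j (σ.v 2) (σ.v 1)) :
    ∃ k' < k, HullInv z n k' (pushCmd.exec σ) := by
  obtain ⟨dep, h₁, h₂⟩ := I.bound
  have hne : ∀ j, j < σ.v 1 → 4 * n + j ≠ 4 * n + σ.v 1 := fun j hj => by omega
  refine ⟨2 * (n - (σ.v 1 + 1)) + (dep (σ.v 2) + 1), by omega, ?_⟩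
  rw [I.input.exec_pushCmd]
  constructor
  · exact ⟨by simpa using I.input.size, I.input.re, I.input.im, I.input.sign⟩
  · simp
  · simpa using h
  · simp
  · intro j hj hj'
    simp only [Function.update_self] at hj' ⊢
    rcases (Nat.lt_succ_iff.mp hj').eq_or_lt with rfl | hj'
    · rw [Function.update_self]
      exact ⟨I.lt, fun l hl hl' => I.popped l hl hl' h, hb⟩
    · rw [Function.update_of_ne (hne j hj')]
      exact I.pred j hj hj'
  · simp only
    rw [Function.update_of_ne (show 4 * n ≠ 4 * n + σ.v 1 by have := I.pos; omega), I.pred_zero]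
  · intro j hj hj'
    simp at hj hj'
    omega
  · refine ⟨Function.update dep (σ.v 1) (dep (σ.v 2) + 1), fun j hj hj' => ?_, ?_⟩
    · simp only [Function.update_self] at hj' ⊢
      rcases (Nat.lt_succ_iff.mp hj').eq_or_lt with rfl | hj'
      · rw [Function.update_self, Function.update_self, Function.update_of_ne I.lt.ne]
        exact Nat.lt_succ_self _
      · rw [Function.update_of_ne (hne j hj'), Function.update_of_ne hj'.ne,
          Function.update_of_ne ((I.pred j hj hj').lt.trans hj').ne]
        exact h₁ j hj hj'
    · simp

/-- An empty stack below the top forces a push; otherwise one cross product decides. A pop lowers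
the potential because the predecessor has smaller depth. -/
theorem HullInv.step {z : ℕ → ℂ} {n k : ℕ} {σ : Store} (S : SeparatedSeq z n)
    (I : HullInv z n k σ) (h : hullTest.Holds σ) :
    hullCmd.Safe σ ∧ ∃ k' < k, HullInv z n k' (hullCmd.exec σ) := by
  have hlt : σ.v 1 < n := by
    have : σ.v 1 + 1 ≤ σ.v 0 := h
    rwa [I.input.size] at this
  refine ⟨by simp [hullCmd, pushCmd, Cmd.Safe, Test.Safe, RExp.Safe, safe_crossExp], ?_⟩
  rw [hullCmd, Cmd.exec]
  split_ifs with h₁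
  · have e : σ.v 2 = 0 := Nat.le_zero.mp h₁
    exact I.push hlt fun j hj => by omega
  have hpos : 0 < σ.v 2 := Nat.pos_of_ne_zero fun e => h₁ (by
    change σ.v 2 ≤ 0; omega)
  have P := I.pred _ hpos I.lt
  have ep : (NExp.mem (predExp (.var 2))).eval σ = σ.m (4 * n + σ.v 2) := by
    rw [NExp.eval, I.input.eval_predExp]; rfl
  have ht : σ.v 2 < n := I.lt.trans hlt
  have hiff : (Test.real (crossExp (.mem (predExp (.var 2))) (.var 2) (.var 1)) (.const 0)).Holds σ
      ↔ Concave z (σ.m (4 * n + σ.v 2)) (σ.v 2) (σ.v 1) := by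
    rw [Test.Holds, I.input.eval_crossExp (b := .var 2) (c := .var 1) (by rw [ep]; exact P.lt.trans ht) ht hlt, ep]
    simp [RExp.eval, Concave, NExp.eval]
  rw [Cmd.exec]
  split_ifs with h₂
  · rw [hiff] at h₂
    exact I.push hlt (P.concave_of_concave S I.lt hlt h₂)
  · rw [hiff] at h₂
    obtain ⟨dep, k₁, k₂⟩ := I.bound
    have hd := k₁ _ hpos I.lt
    refine ⟨2 * (n - σ.v 1) + dep (σ.m (4 * n + σ.v 2)), by omega, ?_⟩
    rw [Cmd.exec, ep]
    have e₁ : ∀ w, Function.update σ.v 2 w 1 = σ.v 1 := fun w => by simp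
    constructor
    · exact ⟨by simpa using I.input.size, I.input.re, I.input.im, I.input.sign⟩
    · simpa using I.pos
    · simpa using I.le
    · simpa using P.lt.trans I.lt
    · simpa using I.pred
    · exact I.pred_zero
    · simp only [Function.update_self, e₁]
      intro j hj hj' _
      exact P.not_concave_of_not_concave S I.lt hlt (fun l hl hl' => I.popped l hl hl' hlt) h₂ j
        hj hj'
    · exact ⟨dep, by simpa using k₁, by simp⟩

end
end ConveyorBelt

/-! ### The scan for lower disks and the output of contacts. -/

namespace ConveyorBelt
noncomputable section
open Real

/-! ### The lower disks -/

/-- The address of the next lower disk. -/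
def nextExp (a : NExp) : NExp := predExp ((NExp.var 0).add a)

theorem Input.eval_nextExp {z : ℕ → ℂ} {n : ℕ} {σ : Store} (H : Input z n σ) (a : NExp) :
    (nextExp a).eval σ = 5 * n + a.eval σ := by
  rw [nextExp, H.eval_predExp, NExp.eval, NExp.eval, H.size]; ring

/-- The scan for the lower disks starts at the last disk. -/
def lowStart : Cmd :=
  .seq (.set 1 ((NExp.var 0).sub (.const 1)))
    (.seq (.set 2 (.var 1)) (.set 3 (.mem (predExp (.var 1)))))

/-- Whether there is a disk left. -/
def lowTest : Test := .nat (.const 1) (.var 1)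

/-- One step of the scan from right to left, with the last lower disk in variable `2` and the next
disk of the upper hull in variable `3`. -/
def lowCmd : Cmd :=
  .seq (.set 1 ((NExp.var 1).sub (.const 1)))
    (.seq (.nstore (nextExp (.var 1)) (.var 2))
      (.ite (.nat (.var 1) (.var 3)) (.set 3 (.mem (predExp (.var 3)))) (.set 2 (.var 1))))

/-- The memory holds the predecessors on the upper hull. -/
structure PredTable (z : ℕ → ℂ) (n : ℕ) (m : ℕ → ℕ) : Prop where
  pred : ∀ j, 0 < j → j < n → HullPred z (m (4 * n + j)) j
  pred_zero : m (4 * n) = 0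

theorem PredTable.congr {z : ℕ → ℂ} {n : ℕ} {m m' : ℕ → ℕ} (h : PredTable z n m)
    (e : ∀ j, j < n → m' (4 * n + j) = m (4 * n + j)) (hn : 0 < n) : PredTable z n m' :=
  ⟨fun j h₁ h₂ => by rw [e j h₂]; exact h.pred j h₁ h₂, (e 0 hn).trans h.pred_zero⟩

/-- The next lower disk after `j` is `b`. -/
structure LowAfter (z : ℕ → ℂ) (n j b : ℕ) : Prop where
  lt : j < b
  lt_size : b < n
  low : LowIndex z n b
  not_between : ∀ l, j < l → l < b → ¬ LowIndex z n l

/-- The invariant of the scan. -/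
structure LowInv (z : ℕ → ℂ) (n k : ℕ) (σ : Store) : Prop where
  input : Input z n σ
  table : PredTable z n σ.m
  bound : σ.v 1 ≤ k
  lt : σ.v 1 < n
  le : σ.v 1 ≤ σ.v 2
  low_lt : σ.v 2 < n
  low : LowIndex z n (σ.v 2)
  not_low : ∀ j, 0 < j → σ.v 1 ≤ j → j < σ.v 2 → ¬ LowIndex z n j
  hull : 0 < σ.v 1 → σ.v 3 < σ.v 1 ∧ HullIndex z n (σ.v 3) ∧
    ∀ j, σ.v 3 < j → j < σ.v 1 → ¬ HullIndex z n j
  next : ∀ j, σ.v 1 ≤ j → j + 1 < n → LowAfter z n j (σ.m (5 * n + j))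

section
variable {z : ℕ → ℂ} {n k : ℕ} {σ : Store}

theorem Input.of_eq {σ' : Store} (H : Input z n σ) (h₁ : σ'.v 0 = σ.v 0) (h₂ : σ'.x = σ.x) :
    Input z n σ' :=
  ⟨h₁.trans H.size, by rw [h₂]; exact H.re, by rw [h₂]; exact H.im, by rw [h₂]; exact H.sign⟩

theorem lowInv_start (S : SeparatedSeq z n) (hn : 0 < n) (H : Input z n σ)
    (T : PredTable z n σ.m) : lowStart.Safe σ ∧ LowInv z n (n - 1) (lowStart.exec σ) := by
  refine ⟨by simp [lowStart, Cmd.Safe], ?_⟩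
  have e : lowStart.exec σ = ⟨Function.update (Function.update (Function.update σ.v 1 (n - 1))
      2 (n - 1)) 3 (σ.m (4 * n + (n - 1))), σ.m, σ.x⟩ := by
    have H' : Input z n ⟨Function.update (Function.update σ.v 1 (n - 1)) 2 (n - 1), σ.m, σ.x⟩ :=
      H.of_eq (by simp) rfl
    simp [lowStart, Cmd.exec, NExp.eval, H.size, H'.eval_predExp]
  rw [e]
  constructor
  · exact H.of_eq (by simp) rfl
  · exact T
  · simp
  · simp [hn]
  · simp
  · simp [hn]
  · right; left; simp; omega
  · intro j _ h₁ h₂; simp at h₁ h₂; omega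
  · intro h
    simp only [Function.update_self, Function.update_apply] at h ⊢
    have h₀ : 0 < n - 1 := by simpa using h
    have := (T.pred (n - 1) h₀ (by omega)).hullStep S (by omega) hullIndex_last
    exact ⟨this.lt, this.left, this.not_between⟩
  · intro j h₁ h₂; simp at h₁; omega

theorem Input.exec_lowCmd (H : Input z n σ) :
    lowCmd.exec σ = if σ.v 1 - 1 ≤ σ.v 3 then
      ⟨Function.update (Function.update σ.v 1 (σ.v 1 - 1)) 3
        (Function.update σ.m (5 * n + (σ.v 1 - 1)) (σ.v 2) (4 * n + σ.v 3)),
        Function.update σ.m (5 * n + (σ.v 1 - 1)) (σ.v 2), σ.x⟩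
      else ⟨Function.update (Function.update σ.v 1 (σ.v 1 - 1)) 2 (σ.v 1 - 1),
        Function.update σ.m (5 * n + (σ.v 1 - 1)) (σ.v 2), σ.x⟩ := by
  have H' : ∀ m, Input z n ⟨Function.update σ.v 1 (σ.v 1 - 1), m, σ.x⟩ := fun m =>
    H.of_eq (by simp) rfl
  simp only [lowCmd, Cmd.exec, (H' _).eval_nextExp, (H' _).eval_predExp, NExp.eval, Test.Holds]
  simp

/-- Variable `3` holds the nearest hull index to the left of the scan, so a disk is on the hull
exactly when the scan arrives at this index. Disk `0` is low although it is a hull index; since it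
is never the next lower disk of another one, the clause `not_low` may leave it out. -/
theorem LowInv.step (S : SeparatedSeq z n) (I : LowInv z n k σ) (h : lowTest.Holds σ) :
    lowCmd.Safe σ ∧ ∃ k' < k, LowInv z n k' (lowCmd.exec σ) := by
  have hpos : 1 ≤ σ.v 1 := h
  have hlt := I.lt
  have hb := I.bound
  refine ⟨by simp [lowCmd, Cmd.Safe, Test.Safe], σ.v 1 - 1, by omega, ?_⟩
  obtain ⟨h₁, h₂, h₃⟩ := I.hull hpos
  have hm : ∀ j, j < n → Function.update σ.m (5 * n + (σ.v 1 - 1)) (σ.v 2) (4 * n + j) =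
      σ.m (4 * n + j) := fun j hj => Function.update_of_ne (by omega) _ _
  have hT := I.table.congr hm (by omega)
  have hnext : ∀ j, σ.v 1 - 1 ≤ j → j + 1 < n →
      LowAfter z n j (Function.update σ.m (5 * n + (σ.v 1 - 1)) (σ.v 2) (5 * n + j)) := by
    intro j hj hjn
    rcases hj.eq_or_lt with rfl | hj
    · rw [Function.update_self]
      have := I.le
      exact ⟨by omega, I.low_lt, I.low, fun l hl hl' => I.not_low l (by omega) (by omega) hl'⟩
    · rw [Function.update_of_ne (by omega)]
      exact I.next j (by omega) hjn
  rw [I.input.exec_lowCmd, hm _ (h₁.trans hlt)]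
  split_ifs with h₄
  · have e : σ.v 3 = σ.v 1 - 1 := by omega
    constructor
    · exact I.input.of_eq (by simp) rfl
    · exact hT
    · simp
    · simp; omega
    · have := I.le; simp; omega
    · simpa using I.low_lt
    · simpa using I.low
    · intro j hj hj' hjl
      simp at hj' hjl
      rcases hj'.eq_or_lt with h₅ | h₅
      · rw [show j = σ.v 3 by omega]
        rintro (h₆ | h₆ | h₆)
        · omega
        · omega
        · exact h₆ h₂
      · exact I.not_low j hj (by omega) hjl
    · intro h₅
      simp at h₅ ⊢
      have := (I.table.pred (σ.v 3) (by omega) (by omega)).hullStep S (by omega) h₂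
      rw [← e]
      exact ⟨this.lt, this.left, this.not_between⟩
    · simpa using hnext
  · constructor
    · exact I.input.of_eq (by simp) rfl
    · exact hT
    · simp
    · simp; omega
    · simp
    · simp; omega
    · simp only [Function.update_self]
      exact Or.inr (Or.inr (h₃ _ (by omega) (by omega)))
    · intro j hj hj' hjl
      simp at hj' hjl
      omega
    · intro h₅
      simp at h₅ ⊢
      exact ⟨by omega, h₂, fun j hj hj' => h₃ j hj (by omega)⟩
    · simpa using hnext

theorem LowInv.next_low (I : LowInv z n k σ) (h : ¬ lowTest.Holds σ) {a : ℕ}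
    (ha : LowIndex z n a) (han : a + 1 < n) : NextLow z n a (σ.m (5 * n + a)) := by
  have h₀ : ¬ 1 ≤ σ.v 1 := h
  have := I.next a (by omega) han
  exact ⟨ha, this.low, this.lt, this.lt_size, this.not_between⟩

end

/-! ### Output of contacts -/

/-- The memory holds the list of contacts. -/
def Holds (m : ℕ → ℕ) (E : List (ℕ × Side)) : Prop :=
  ∀ j (h : j < E.length), m (2 * j) = E[j].1 ∧ m (2 * j + 1) = E[j].2.code

/-- Output of the contact in the variables `3` and `4`. -/
def emitCmd : Cmd :=
  .seq (.nstore ((NExp.var 7).add (.var 7)) (.var 3))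
    (.seq (.nstore (((NExp.var 7).add (.var 7)).add (.const 1)) (.var 4))
      (.set 7 ((NExp.var 7).add (.const 1))))

theorem exec_emitCmd (σ : Store) : emitCmd.exec σ = ⟨Function.update σ.v 7 (σ.v 7 + 1),
    Function.update (Function.update σ.m (σ.v 7 + σ.v 7) (σ.v 3)) (σ.v 7 + σ.v 7 + 1) (σ.v 4),
    σ.x⟩ := by
  simp [emitCmd, Cmd.exec, NExp.eval]

theorem Holds.emit {m : ℕ → ℕ} {E : List (ℕ × Side)} (h : Holds m E) {k : ℕ} (hk : k = E.length)
    (x : ℕ × Side) : Holds (Function.update (Function.update m (k + k) x.1) (k + k + 1) x.2.code)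
      (E ++ [x]) := by
  subst hk
  intro j hj
  rw [List.length_append, List.length_singleton] at hj
  rcases (Nat.lt_succ_iff.mp hj).eq_or_lt with rfl | hj'
  · rw [show 2 * E.length = E.length + E.length by ring, List.getElem_concat_length rfl]
    simp
  · rw [List.getElem_append_left hj', Function.update_of_ne (by omega),
      Function.update_of_ne (by omega), Function.update_of_ne (by omega),
      Function.update_of_ne (by omega)]
    exact h j hj'

end
end ConveyorBelt

/-! ### Output of the lower path and of the way back along the hull. -/

namespace ConveyorBelt
noncomputable section
open Real

/-! ### The lower path -/

/-- The contacts that remain on the way from `r` along the lower disks, where `b` is the next lower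
disk or has been reached. -/
def restList (z : ℕ → ℂ) (n : ℕ) (nl : ℕ → ℕ) (r : ℕ) (ρ : Side) (b : ℕ) (τ : Side) :
    List (ℕ × Side) :=
  if b ≤ r then lowerList z n nl r else gapList z b τ r ρ ++ (b, τ) :: lowerList z n nl b

/-- The side on which a lower disk is kept. -/
def sideCmd : Cmd :=
  .ite (.nat (.var 0) ((NExp.var 5).add (.const 1))) (.set 6 (.const 1))
    (.ite (.real (.const 0) (crossExp (.var 3) (.var 5) (.mem (nextExp (.var 5)))))
      (.set 6 (.const 1)) (.set 6 (.const 0)))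

/-- When a lower disk is reached, the next lower disk is fetched. -/
def fetchCmd : Cmd :=
  .ite (.nat (.var 5) (.var 3)) (.seq (.set 5 (.mem (nextExp (.var 3)))) sideCmd) .skip

/-- The choice of the disk that is met first. -/
def chooseCmd : Cmd :=
  .ite (.real (tangentExp (.var 3) (.var 4) ((NExp.var 3).add (.const 1)) (.const 1))
      (tangentExp (.var 3) (.var 4) ((NExp.var 5).sub (.const 1)) (.const 1)))
    (.set 8 ((NExp.var 3).add (.const 1))) (.set 8 ((NExp.var 5).sub (.const 1)))

/-- The path goes on to the next lower disk. -/
def reachCmd : Cmd := .seq (.set 3 (.var 5)) (.set 4 (.var 6))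

/-- The path goes on to the disk in variable `8`. -/
def shiftCmd : Cmd := .seq (.set 3 (.var 8)) (.set 4 (.const 1))

/-- The path goes on to the next contact. -/
def advanceCmd : Cmd :=
  .ite (.nat (.var 5) ((NExp.var 3).add (.const 1))) reachCmd
    (.seq chooseCmd (.ite (.real (tangentExp (.var 3) (.var 4) (.var 8) (.const 1))
      (tangentExp (.var 3) (.var 4) (.var 5) (.var 6))) shiftCmd reachCmd))

/-- Whether the last disk has not been reached. -/
def pathTest : Test := .nat ((NExp.var 3).add (.const 2)) (.var 0)

/-- One step of the lower path. -/
def pathCmd : Cmd := .seq fetchCmd (.seq advanceCmd emitCmd)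

/-- The lower path starts with the first disk. -/
def pathStart : Cmd :=
  .seq (.set 3 (.const 0)) (.seq (.set 4 (.const 1)) (.seq (.set 5 (.const 0))
    (.seq (.set 6 (.const 1)) (.seq (.set 7 (.const 0)) emitCmd))))

/-- The position on the lower path: the contact `(r, ρ)` has been reached and `(b, τ)` is the next
lower contact, or it is the contact that has been reached. -/
structure PathPos (z : ℕ → ℂ) (n r : ℕ) (ρ : Side) (b : ℕ) (τ : Side) : Prop where
  lt : r < n
  lt_size : b < n
  reached : b ≤ r → LowIndex z n r ∧ ρ = lowSide z n r
  ahead : r < b → ∃ a, NextLow z n a b ∧ a ≤ r ∧ τ = lowSide z n b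

section
variable {z : ℕ → ℂ} {n : ℕ} {σ : Store} {m₀ : ℕ → ℕ} {r b : ℕ} {ρ τ : Side}

theorem Input.eval_sideCmd (H : Input z n σ)
    (hnl : ∀ a, LowIndex z n a → a + 1 < n → NextLow z n a (σ.m (5 * n + a)))
    (h : NextLow z n (σ.v 3) (σ.v 5)) :
    sideCmd.Safe σ ∧ sideCmd.exec σ =
      ⟨Function.update σ.v 6 (lowSide z n (σ.v 5)).code, σ.m, σ.x⟩ := by
  refine ⟨by simp [sideCmd, Cmd.Safe, Test.Safe, RExp.Safe, safe_crossExp], ?_⟩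
  rw [sideCmd, Cmd.exec]
  split_ifs with h₁
  · have h₁' : σ.v 0 ≤ σ.v 5 + 1 := h₁
    have := h.lt_size
    rw [H.size] at h₁'
    rw [lowSide_last (show σ.v 5 + 1 = n by omega)]
    rfl
  · have h₁' : ¬ σ.v 0 ≤ σ.v 5 + 1 := h₁
    rw [H.size] at h₁'
    have hd := hnl _ h.low_right (by omega)
    have ed : (NExp.mem (nextExp (.var 5))).eval σ = σ.m (5 * n + σ.v 5) := by
      rw [NExp.eval, H.eval_nextExp]; rfl
    have hiff : (Test.real (.const 0) (crossExp (.var 3) (.var 5) (.mem (nextExp (.var 5))))).Holds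
        σ ↔ 0 ≤ cross (z (σ.v 5) - z (σ.v 3)) (z (σ.m (5 * n + σ.v 5)) - z (σ.v 5)) := by
      rw [Test.Holds, H.eval_crossExp (a := .var 3) (b := .var 5) (h.lt.trans h.lt_size) h.lt_size
        (by rw [ed]; exact hd.lt_size), ed]
      simp [RExp.eval, NExp.eval]
    rw [Cmd.exec, h.lowSide_eq hd]
    simp only [hiff]
    split_ifs <;> rfl

/-- The state `b ≤ r` signals that the lower disk `r` has just been reached. Fetching the next one
exposes a gap in front of the ray, and the list of contacts still to come is unchanged. -/
theorem PathPos.fetch (H : Input z n σ)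
    (hnl : ∀ a, LowIndex z n a → a + 1 < n → NextLow z n a (σ.m (5 * n + a)))
    (hp : PathPos z n (σ.v 3) ρ (σ.v 5) τ) (hτ : σ.v 6 = τ.code) (hr : σ.v 3 + 1 < n) :
    fetchCmd.Safe σ ∧ ∃ b τ', fetchCmd.exec σ =
      ⟨Function.update (Function.update σ.v 5 b) 6 τ'.code, σ.m, σ.x⟩ ∧
      PathPos z n (σ.v 3) ρ b τ' ∧ σ.v 3 < b ∧
      restList z n (fun a => σ.m (5 * n + a)) (σ.v 3) ρ (σ.v 5) τ =
        restList z n (fun a => σ.m (5 * n + a)) (σ.v 3) ρ b τ' := by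
  rw [fetchCmd, Cmd.exec, Cmd.Safe]
  have hiff : (Test.nat (.var 5) (.var 3)).Holds σ ↔ σ.v 5 ≤ σ.v 3 := Iff.rfl
  simp only [hiff]
  by_cases h : σ.v 5 ≤ σ.v 3
  · obtain ⟨h₁, h₂⟩ := hp.reached h
    have hN := hnl _ h₁ hr
    set b := σ.m (5 * n + σ.v 3) with hb
    have e : (Cmd.set 5 (.mem (nextExp (.var 3)))).exec σ =
        ⟨Function.update σ.v 5 b, σ.m, σ.x⟩ := by
      simp [Cmd.exec, NExp.eval, H.eval_nextExp, hb]
    have H' : Input z n ⟨Function.update σ.v 5 b, σ.m, σ.x⟩ := H.of_eq (by simp) rfl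
    obtain ⟨k₁, k₂⟩ := H'.eval_sideCmd hnl (by simpa using hN)
    refine ⟨⟨trivial, fun _ => ⟨trivial, by rw [e]; exact k₁⟩, fun h' => absurd h h'⟩, b,
      lowSide z n b, ?_, ⟨hp.lt, hN.lt_size, fun h' => absurd h' hN.lt.not_ge,
        fun _ => ⟨_, hN, le_rfl, rfl⟩⟩, hN.lt, ?_⟩
    · rw [if_pos h, Cmd.exec, e, k₂]
      simp
    · rw [restList, restList, if_pos h, if_neg hN.lt.not_ge, lowerList, dif_pos ⟨hN.lt, hN.lt_size⟩,
        h₂]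
  · refine ⟨⟨trivial, fun h' => absurd h' h, fun _ => trivial⟩, σ.v 5, τ, ?_, hp, by omega, rfl⟩
    rw [if_neg h, Cmd.exec, ← hτ]
    simp

theorem PathPos.reach (hp : PathPos z n r ρ b τ) (hrb : r < b) :
    PathPos z n b τ b τ := by
  obtain ⟨a, h₁, h₂, h₃⟩ := hp.ahead hrb
  exact ⟨hp.lt_size, hp.lt_size, fun _ => ⟨h₁.low_right, h₃⟩, fun h => absurd h (lt_irrefl b)⟩

theorem PathPos.shift {u : ℕ} (hp : PathPos z n r ρ b τ) (hru : r < u) (hub : u < b) :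
    PathPos z n u .left b τ := by
  obtain ⟨a, h₁, h₂, h₃⟩ := hp.ahead (hru.trans hub)
  exact ⟨hub.trans hp.lt_size, hp.lt_size, fun h => absurd hub h.not_gt,
    fun _ => ⟨a, h₁, h₂.trans hru.le, h₃⟩⟩

open Classical in
theorem Input.exec_chooseCmd (S : SeparatedSeq z n) (H : Input z n σ) (hρ : σ.v 4 = ρ.code)
    (hr : σ.v 3 + 1 < σ.v 5) (hb : σ.v 5 < n) : chooseCmd.Safe σ ∧ chooseCmd.exec σ =
      ⟨Function.update σ.v 8 (firstMet z (σ.v 3) ρ (σ.v 5)), σ.m, σ.x⟩ := by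
  obtain ⟨h₁, h₂⟩ := H.holds_tangentExp S (r := .var 3) (ρ := .var 4)
    (q := (NExp.var 3).add (.const 1)) (τ := .const 1) (q₁ := (NExp.var 5).sub (.const 1))
    (τ₁ := .const 1) (ρ' := ρ) (τ' := .left) (τ₁' := .left) (by simp [NExp.eval])
    (by simp only [NExp.eval]; omega) (by simp only [NExp.eval]; omega)
    (by simp only [NExp.eval]; omega) hρ rfl rfl
  refine ⟨⟨h₁, fun _ => trivial, fun _ => trivial⟩, ?_⟩
  rw [chooseCmd, Cmd.exec, firstMet]
  simp only [h₂, NExp.eval]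
  split_ifs <;> simp [Cmd.exec, NExp.eval]

/-- One execution follows one unfolding of `gapList`: an empty gap leads to `b`, and otherwise the
first disk met is compared with the target. In each case exactly one contact leaves the remaining
list. -/
theorem PathPos.advance (S : SeparatedSeq z n) (H : Input z n σ) {nl : ℕ → ℕ}
    (hp : PathPos z n (σ.v 3) ρ (σ.v 5) τ) (hρ : σ.v 4 = ρ.code) (hτ : σ.v 6 = τ.code)
    (hr : σ.v 3 < σ.v 5) :
    advanceCmd.Safe σ ∧ ∃ u w ρ', advanceCmd.exec σ =
      ⟨Function.update (Function.update (Function.update σ.v 8 w) 3 u) 4 ρ'.code, σ.m, σ.x⟩ ∧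
      σ.v 3 < u ∧ PathPos z n u ρ' (σ.v 5) τ ∧
      restList z n nl (σ.v 3) ρ (σ.v 5) τ = (u, ρ') :: restList z n nl u ρ' (σ.v 5) τ := by
  have hb := hp.lt_size
  have hiff : (Test.nat (.var 5) ((NExp.var 3).add (.const 1))).Holds σ ↔ σ.v 5 ≤ σ.v 3 + 1 :=
    Iff.rfl
  have hreach : ∀ w, reachCmd.exec ⟨Function.update σ.v 8 w, σ.m, σ.x⟩ =
      ⟨Function.update (Function.update (Function.update σ.v 8 w) 3 (σ.v 5)) 4 τ.code, σ.m,
        σ.x⟩ := fun w => by simp [reachCmd, Cmd.exec, NExp.eval, hτ]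
  rw [advanceCmd, Cmd.exec, Cmd.Safe]
  simp only [hiff]
  by_cases h : σ.v 5 ≤ σ.v 3 + 1
  · refine ⟨⟨trivial, fun _ => by simp [reachCmd, Cmd.Safe], fun h' => absurd h h'⟩, σ.v 5, σ.v 8, τ,
      ?_, hr, hp.reach hr, ?_⟩
    · rw [if_pos h, ← hreach]; simp
    · rw [restList, if_neg hr.not_ge, restList, if_pos le_rfl, gapList, dif_neg (by omega)]; rfl
  · have h' : σ.v 3 + 1 < σ.v 5 := by omega
    obtain ⟨m₁, m₂⟩ := firstMet_mem z ρ h'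
    obtain ⟨s₁, e₁⟩ := H.exec_chooseCmd S hρ h' hb
    set u := firstMet z (σ.v 3) ρ (σ.v 5) with hu
    have H' : Input z n ⟨Function.update σ.v 8 u, σ.m, σ.x⟩ := H.of_eq (by simp) rfl
    obtain ⟨h₁, h₂⟩ := H'.holds_tangentExp S (r := .var 3) (ρ := .var 4)
      (q := .var 8) (τ := .const 1) (q₁ := .var 5)
      (τ₁ := .var 6) (ρ' := ρ) (τ' := .left) (τ₁' := τ) (by simpa [NExp.eval] using m₁)
      (by simpa [NExp.eval] using m₂.trans hb) (by simpa [NExp.eval] using hr)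
      (by simpa [NExp.eval] using hb) (by simpa [NExp.eval] using hρ) rfl
      (by simpa [NExp.eval] using hτ)
    replace h₂ : Test.Holds ⟨Function.update σ.v 8 u, σ.m, σ.x⟩
        (.real (tangentExp (.var 3) (.var 4) (.var 8) (.const 1))
          (tangentExp (.var 3) (.var 4) (.var 5) (.var 6))) ↔
        tangentDir z (σ.v 3) ρ u .left ≤ tangentDir z (σ.v 3) ρ (σ.v 5) τ := by
      simpa [NExp.eval] using h₂
    refine ⟨⟨trivial, fun h'' => absurd h'' h, fun _ => ⟨s₁, ?_⟩⟩, ?_⟩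
    · rw [e₁]
      exact ⟨h₁, fun _ => by simp [shiftCmd, Cmd.Safe], fun _ => by simp [reachCmd, Cmd.Safe]⟩
    · rw [if_neg h, Cmd.exec, e₁, Cmd.exec]
      simp only [h₂]
      by_cases hc : tangentDir z (σ.v 3) ρ u .left ≤ tangentDir z (σ.v 3) ρ (σ.v 5) τ
      · refine ⟨u, u, .left, ?_, m₁, hp.shift m₁ m₂, ?_⟩
        · rw [if_pos hc]; simp [shiftCmd, Cmd.exec, NExp.eval, Side.code]
        · rw [restList, if_neg hr.not_ge, restList, if_neg m₂.not_ge, gapList, dif_pos h', ← hu,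
            if_pos hc]; rfl
      · refine ⟨σ.v 5, u, τ, by rw [if_neg hc, hreach], hr, hp.reach hr, ?_⟩
        rw [restList, if_neg hr.not_ge, restList, if_pos le_rfl, gapList, dif_pos h', ← hu,
          if_neg hc]; rfl

/-- The invariant of the lower path, where `E` has been output and `L` is the whole list. -/
structure PathInv (z : ℕ → ℂ) (n : ℕ) (m₀ : ℕ → ℕ) (L : List (ℕ × Side)) (k : ℕ) (σ : Store) :
    Prop where
  input : Input z n σ
  mem : ∀ j, 4 * n ≤ j → σ.m j = m₀ j
  bound : n - σ.v 3 ≤ k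
  list : ∃ ρ τ E, σ.v 4 = Side.code ρ ∧ σ.v 6 = Side.code τ ∧ σ.v 7 = E.length ∧ Holds σ.m E ∧
    PathPos z n (σ.v 3) ρ (σ.v 5) τ ∧
    E ++ restList z n (fun a => m₀ (5 * n + a)) (σ.v 3) ρ (σ.v 5) τ = L

/-- Each contact has a larger index than the previous one, so `n - σ.v 3` decreases. The bound on
the whole list keeps the output below `4 * n`, away from the two tables. -/
theorem PathInv.step (S : SeparatedSeq z n)
    (hnl : ∀ a, LowIndex z n a → a + 1 < n → NextLow z n a (m₀ (5 * n + a)))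
    {L : List (ℕ × Side)} (hL : L.length ≤ n) {k : ℕ} (I : PathInv z n m₀ L k σ)
    (h : pathTest.Holds σ) :
    pathCmd.Safe σ ∧ ∃ k' < k, PathInv z n m₀ L k' (pathCmd.exec σ) := by
  have hr : σ.v 3 + 2 ≤ σ.v 0 := h
  rw [I.input.size] at hr
  have hk := I.bound
  have hm : (fun a => σ.m (5 * n + a)) = fun a => m₀ (5 * n + a) :=
    funext fun a => I.mem _ (by omega)
  obtain ⟨ρ, τ, E, hρ, hτ, hE, hH, hp, hl⟩ := I.list
  obtain ⟨s₁, b, τ', e₁, p₁, hb, l₁⟩ := hp.fetch I.input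
    (fun a ha han => by rw [I.mem _ (by omega)]; exact hnl a ha han) hτ (by omega)
  rw [hm] at l₁
  set σ₁ : Store := ⟨Function.update (Function.update σ.v 5 b) 6 τ'.code, σ.m, σ.x⟩ with hσ₁
  have H₁ : Input z n σ₁ := I.input.of_eq (by simp [hσ₁]) rfl
  have v₃ : σ₁.v 3 = σ.v 3 := by simp [hσ₁]
  have v₅ : σ₁.v 5 = b := by simp [hσ₁]
  obtain ⟨s₂, u, w, ρ', e₂, hu, p₂, l₂⟩ := PathPos.advance S H₁ (ρ := ρ) (τ := τ')
    (nl := fun a => m₀ (5 * n + a)) (by rw [v₃, v₅]; exact p₁) (by simpa [hσ₁] using hρ)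
    (by simp [hσ₁]) (by rw [v₃, v₅]; exact hb)
  rw [v₃, v₅] at l₂
  rw [v₃] at hu
  rw [v₅] at p₂
  refine ⟨⟨s₁, by rw [e₁]; exact s₂, by simp [emitCmd, Cmd.Safe]⟩, n - u, by omega, ?_⟩
  have hlen : E.length < n := by
    have := congrArg List.length hl
    rw [l₁, l₂] at this
    simp at this
    omega
  have e : pathCmd.exec σ = ⟨Function.update (Function.update (Function.update (Function.update
      σ₁.v 8 w) 3 u) 4 ρ'.code) 7 (E.length + 1), Function.update (Function.update σ.m
      (E.length + E.length) u) (E.length + E.length + 1) ρ'.code, σ.x⟩ := by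
    rw [pathCmd, Cmd.exec, Cmd.exec, e₁, e₂, exec_emitCmd]
    simp [hσ₁, hE]
  rw [e]
  constructor
  · exact I.input.of_eq (by simp [hσ₁]) rfl
  · intro j hj
    simp only
    rw [Function.update_of_ne (by omega), Function.update_of_ne (by omega)]
    exact I.mem j hj
  · simp
  · refine ⟨ρ', τ', E ++ [(u, ρ')], by simp, by simp [hσ₁], by simp, hH.emit rfl (u, ρ'), ?_, ?_⟩
    · simpa [hσ₁] using p₂
    · rw [← hl, l₁, l₂]
      simp [hσ₁]

theorem pathInv_start (hn : 0 < n) (H : Input z n σ) (hm : ∀ j, 4 * n ≤ j → σ.m j = m₀ j) :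
    pathStart.Safe σ ∧ PathInv z n m₀
      ((0, .left) :: lowerList z n (fun a => m₀ (5 * n + a)) 0) n (pathStart.exec σ) := by
  refine ⟨by simp [pathStart, emitCmd, Cmd.Safe], ?_⟩
  have e : pathStart.exec σ = ⟨Function.update (Function.update (Function.update (Function.update
      (Function.update (Function.update σ.v 3 0) 4 1) 5 0) 6 1) 7 0) 7 1, Function.update
      (Function.update σ.m (0 + 0) 0) (0 + 0 + 1) 1, σ.x⟩ := by
    simp [pathStart, Cmd.exec, exec_emitCmd, NExp.eval]
  rw [e]
  constructor
  · exact H.of_eq (by simp) rfl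
  · intro j hj
    simp only
    rw [Function.update_of_ne (by omega), Function.update_of_ne (by omega)]
    exact hm j hj
  · simp
  · refine ⟨.left, .left, [] ++ [(0, Side.left)], by simp [Side.code], by simp [Side.code], by simp,
      Holds.emit (m := σ.m) (E := []) (fun j hj => absurd hj (by simp)) rfl (0, .left), ?_, ?_⟩
    · simp only [Function.update_apply]
      refine ⟨hn, hn, fun _ => ⟨lowIndex_zero, lowSide_zero.symm⟩, fun h => ?_⟩
      simp at h
    · simp [restList]

theorem PathInv.final {L : List (ℕ × Side)} {k : ℕ} (I : PathInv z n m₀ L k σ)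
    (h : ¬ pathTest.Holds σ) : σ.v 7 = L.length ∧ Holds σ.m L := by
  have hr : ¬ σ.v 3 + 2 ≤ σ.v 0 := h
  rw [I.input.size] at hr
  obtain ⟨ρ, τ, E, hρ, hτ, hE, hH, hp, hl⟩ := I.list
  have h₁ := hp.lt
  have h₂ := hp.lt_size
  have : restList z n (fun a => m₀ (5 * n + a)) (σ.v 3) ρ (σ.v 5) τ = [] := by
    rw [restList, if_pos (by omega), lowerList, dif_neg (by omega)]
  rw [this, List.append_nil] at hl
  rw [← hl]
  exact ⟨hE, hH⟩

/-! ### The path back along the upper hull -/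

/-- The way back starts with the predecessor of the last disk. -/
def backStart : Cmd :=
  .seq (.set 3 (.mem (predExp ((NExp.var 0).sub (.const 1))))) (.set 4 (.const 1))

/-- Whether the first disk has not been reached. -/
def backTest : Test := .nat (.const 1) (.var 3)

/-- One step back along the upper hull. -/
def backCmd : Cmd := .seq emitCmd (.set 3 (.mem (predExp (.var 3))))

/-- The invariant of the way back. -/
structure BackInv (z : ℕ → ℂ) (n : ℕ) (m₀ : ℕ → ℕ) (L : List (ℕ × Side)) (k : ℕ) (σ : Store) :
    Prop where
  input : Input z n σ
  mem : ∀ j, 4 * n ≤ j → σ.m j = m₀ j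
  lt : σ.v 3 < n
  bound : σ.v 3 ≤ k
  left : σ.v 4 = 1
  list : ∃ E, σ.v 7 = E.length ∧ Holds σ.m E ∧
    E ++ (if 0 < σ.v 3 then σ.v 3 :: hullList (fun j => m₀ (4 * n + j)) (σ.v 3) else []).map
      (fun u => (u, Side.left)) = L

theorem PredTable.hullList_eq (T : PredTable z n m₀) {i : ℕ} (hi : i < n) :
    m₀ (4 * n + i) < n ∧ hullList (fun j => m₀ (4 * n + j)) i =
      if 0 < m₀ (4 * n + i) then
        m₀ (4 * n + i) :: hullList (fun j => m₀ (4 * n + j)) (m₀ (4 * n + i)) else [] := by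
  rw [hullList]
  rcases Nat.eq_zero_or_pos i with rfl | h0
  · have := T.pred_zero
    simp [this, hi]
  · have h := (T.pred i h0 hi).lt
    exact ⟨h.trans hi, by simp [h]⟩

/-- The index decreases along the predecessors. Output may now use up to `2 * n` contacts, which
still ends below `4 * n`, so the predecessor read after the output is the original one. -/
theorem BackInv.step (T : PredTable z n m₀) {L : List (ℕ × Side)} (hL : L.length ≤ 2 * n) {k : ℕ}
    (I : BackInv z n m₀ L k σ) (h : backTest.Holds σ) :
    backCmd.Safe σ ∧ ∃ k' < k, BackInv z n m₀ L k' (backCmd.exec σ) := by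
  have hpos : 0 < σ.v 3 := h
  have hlt := I.lt
  have hk := I.bound
  obtain ⟨E, hE, hH, hl⟩ := I.list
  obtain ⟨t₁, t₂⟩ := T.hullList_eq I.lt
  have hlen : E.length < 2 * n := by
    have := congrArg List.length hl
    rw [if_pos hpos] at this
    simp at this
    omega
  have hm : ∀ j, 4 * n ≤ j → Function.update (Function.update σ.m (E.length + E.length) (σ.v 3))
      (E.length + E.length + 1) (σ.v 4) j = m₀ j := fun j hj => by
    rw [Function.update_of_ne (by omega), Function.update_of_ne (by omega)]
    exact I.mem j hj
  have e : backCmd.exec σ = ⟨Function.update (Function.update σ.v 7 (E.length + 1)) 3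
      (m₀ (4 * n + σ.v 3)), Function.update (Function.update σ.m
      (E.length + E.length) (σ.v 3)) (E.length + E.length + 1) (σ.v 4), σ.x⟩ := by
    have H' : Input z n (emitCmd.exec σ) := by
      rw [exec_emitCmd]; exact I.input.of_eq (by simp) rfl
    have e' : (NExp.mem (predExp (.var 3))).eval (emitCmd.exec σ) = m₀ (4 * n + σ.v 3) := by
      rw [NExp.eval, H'.eval_predExp, exec_emitCmd, hE, ← hm _ (by omega)]
      simp [NExp.eval]
    rw [backCmd, Cmd.exec, Cmd.exec, e', exec_emitCmd, hE]
  have hlt' : m₀ (4 * n + σ.v 3) < σ.v 3 := by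
    have := (T.pred _ hpos hlt).lt; exact this
  refine ⟨by simp [backCmd, emitCmd, Cmd.Safe], m₀ (4 * n + σ.v 3), by omega, ?_⟩
  rw [e]
  constructor
  · exact I.input.of_eq (by simp) rfl
  · exact hm
  · simpa using t₁
  · simp
  · simpa using I.left
  · refine ⟨E ++ [(σ.v 3, .left)], by simp, ?_, ?_⟩
    · have := hH.emit rfl (σ.v 3, .left)
      rw [I.left]
      exact this
    · rw [← hl, if_pos hpos, t₂]
      simp

theorem backInv_start (hn : 0 < n) (T : PredTable z n m₀) (H : Input z n σ)
    (hm : ∀ j, 4 * n ≤ j → σ.m j = m₀ j) {A : List (ℕ × Side)} (hA : σ.v 7 = A.length)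
    (hH : Holds σ.m A) : backStart.Safe σ ∧ BackInv z n m₀
      (A ++ (hullList (fun j => m₀ (4 * n + j)) (n - 1)).map fun u => (u, Side.left)) n
      (backStart.exec σ) := by
  refine ⟨by simp [backStart, Cmd.Safe], ?_⟩
  obtain ⟨t₁, t₂⟩ := T.hullList_eq (show n - 1 < n by omega)
  have e : backStart.exec σ = ⟨Function.update (Function.update σ.v 3 (m₀ (4 * n + (n - 1)))) 4 1,
      σ.m, σ.x⟩ := by
    have e' : (NExp.mem (predExp ((NExp.var 0).sub (.const 1)))).eval σ = m₀ (4 * n + (n - 1)) := by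
      rw [NExp.eval, H.eval_predExp, hm _ (by omega)]
      simp [NExp.eval, H.size]
    rw [← e']
    rfl
  rw [e]
  constructor
  · exact H.of_eq (by simp) rfl
  · exact hm
  · simpa using t₁
  · simpa using t₁.le
  · simp
  · refine ⟨A, by simpa using hA, hH, ?_⟩
    rw [t₂]
    simp

theorem BackInv.final {L : List (ℕ × Side)} {k : ℕ} (I : BackInv z n m₀ L k σ)
    (h : ¬ backTest.Holds σ) : σ.v 7 = L.length ∧ Holds σ.m L := by
  have h₀ : ¬ 1 ≤ σ.v 3 := h
  obtain ⟨E, hE, hH, hl⟩ := I.list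
  rw [if_neg (by omega), List.map_nil, List.append_nil] at hl
  rw [← hl]
  exact ⟨hE, hH⟩

end

end
end ConveyorBelt

/-! ### The whole program and its running time. -/

namespace ConveyorBelt
noncomputable section
open Real

/-! ### The program -/

/-- The signs of the sides are stored after the coordinates. -/
def initCmd : Cmd :=
  .seq (.rstore ((NExp.var 0).add (.var 0)) (.sub (.const 0) (.const 1)))
    (.seq (.rstore (((NExp.var 0).add (.var 0)).add (.const 1)) (.const 1)) (.set 1 (.const 1)))

/-- The length of the list is the last part of the output. -/
def finishCmd : Cmd := .set 0 (.var 7)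

/-- A command that is followed by a loop, placed at line `p`. -/
def phaseCode (c : Cmd) (b : Test) (d : Cmd) (p : ℕ) : List Instr :=
  c.code p ++ loopCode b d (p + c.len)

/-- The length of the code of a command that is followed by a loop. -/
@[irreducible] def phaseLen (c : Cmd) (b : Test) (d : Cmd) : ℕ := c.len + loopLen b d

theorem length_phaseCode (c : Cmd) (b : Test) (d : Cmd) (p : ℕ) :
    (phaseCode c b d p).length = phaseLen c b d := by
  simp [phaseCode, phaseLen, Cmd.length_code, length_loopCode]

theorem runs_phase {P : Program} {c d : Cmd} {b : Test} {p : ℕ}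
    (h : CodeAt P p (phaseCode c b d p)) (I : ℕ → Store → Prop)
    (hs : ∀ k σ, I k σ → b.Safe σ)
    (hI : ∀ k σ, I k σ → b.Holds σ → d.Safe σ ∧ ∃ k' < k, I k' (d.exec σ)) {k : ℕ} {σ : Store}
    (hσ : c.Safe σ ∧ I k (c.exec σ)) : ∃ k' τ, I k' τ ∧ ¬ b.Holds τ ∧
      Runs P p σ ((k + 1) * phaseLen c b d) (p + phaseLen c b d) τ := by
  have h' := h.right
  rw [c.length_code] at h'
  obtain ⟨k', τ, h₁, h₂, h₃⟩ := runs_loop h' I hs hI hσ.2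
  refine ⟨k', τ, h₁, h₂, ?_⟩
  have := (c.runs h.left hσ.1).trans h₃
  rw [add_assoc] at this
  rw [phaseLen]
  refine this.mono ?_
  rw [mul_add, add_mul k 1 c.len, one_mul]
  exact Nat.add_le_add_right (Nat.le_add_left _ _) _

/-- The lengths of the phases of the program. -/
@[irreducible] def hullLen : ℕ := phaseLen initCmd hullTest hullCmd

/-- The lengths of the phases of the program. -/
@[irreducible] def lowLen : ℕ := phaseLen lowStart lowTest lowCmd

/-- The lengths of the phases of the program. -/
@[irreducible] def pathLen : ℕ := phaseLen pathStart pathTest pathCmd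

/-- The lengths of the phases of the program. -/
@[irreducible] def backLen : ℕ := phaseLen backStart backTest backCmd

/-- The program that computes the winding belt. -/
def beltProgram : Program :=
  phaseCode initCmd hullTest hullCmd 0 ++ (phaseCode lowStart lowTest lowCmd hullLen ++
    (phaseCode pathStart pathTest pathCmd (hullLen + lowLen) ++
      (phaseCode backStart backTest backCmd (hullLen + lowLen + pathLen) ++
        (finishCmd.code (hullLen + lowLen + pathLen + backLen) ++ [.halt]))))

theorem CodeAt.self (P : Program) : CodeAt P 0 P := ⟨[], [], (List.append_nil P).symm, rfl⟩

theorem codeAt_beltProgram :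
    CodeAt beltProgram 0 (phaseCode initCmd hullTest hullCmd 0) ∧
    -- Jumps are absolute, so each phase has to stand at the line for which its code was generated.
    CodeAt beltProgram hullLen (phaseCode lowStart lowTest lowCmd hullLen) ∧
    CodeAt beltProgram (hullLen + lowLen)
      (phaseCode pathStart pathTest pathCmd (hullLen + lowLen)) ∧
    CodeAt beltProgram (hullLen + lowLen + pathLen)
      (phaseCode backStart backTest backCmd (hullLen + lowLen + pathLen)) ∧
    CodeAt beltProgram (hullLen + lowLen + pathLen + backLen)
      (finishCmd.code (hullLen + lowLen + pathLen + backLen)) ∧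
    CodeAt beltProgram (hullLen + lowLen + pathLen + backLen + finishCmd.len) [.halt] := by
  have a₀ := CodeAt.self beltProgram
  generalize hP : beltProgram = P at a₀ ⊢
  nth_rw 2 [← hP] at a₀
  rw [beltProgram] at a₀
  have a₁ := a₀.right
  rw [length_phaseCode, zero_add, ← hullLen] at a₁
  have a₂ := a₁.right
  rw [length_phaseCode, ← lowLen] at a₂
  have a₃ := a₂.right
  rw [length_phaseCode, ← pathLen] at a₃
  have a₄ := a₃.right
  rw [length_phaseCode, ← backLen] at a₄
  have a₅ := a₄.right
  rw [Cmd.length_code] at a₅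
  exact ⟨a₀.left, a₁.left, a₂.left, a₃.left, a₄.left, a₅⟩

/-- The coordinates in the memory. -/
structure Coordinates (z : ℕ → ℂ) (n : ℕ) (σ : Store) : Prop where
  size : σ.v 0 = n
  var_eq_zero : ∀ i, 0 < i → σ.v i = 0
  mem_eq_zero : ∀ i, σ.m i = 0
  re : ∀ i, i < n → σ.x (i + i) = (z i).re
  im : ∀ i, i < n → σ.x (i + i + 1) = (z i).im

section
variable {z : ℕ → ℂ} {n : ℕ} {σ : Store}

/-- The scan starts with disk `0` on the stack, next disk `1` and depth zero. All memory is zero,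
which provides the predecessor entry of disk `0`. -/
theorem Coordinates.hullInv (C : Coordinates z n σ) (hn : 0 < n) :
    initCmd.Safe σ ∧ HullInv z n (2 * n) (initCmd.exec σ) := by
  refine ⟨by simp [initCmd, Cmd.Safe, RExp.Safe], ?_⟩
  have e : initCmd.exec σ = ⟨Function.update σ.v 1 1, σ.m,
      Function.update (Function.update σ.x (n + n) (-1)) (n + n + 1) 1⟩ := by
    simp [initCmd, Cmd.exec, NExp.eval, RExp.eval, C.size]
  rw [e]
  have v₂ : Function.update σ.v 1 1 2 = 0 := by simp [C.var_eq_zero]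
  constructor
  · refine ⟨by simpa using C.size, fun i hi => ?_, fun i hi => ?_, fun ρ => ?_⟩
    · simp only
      rw [Function.update_of_ne (by omega), Function.update_of_ne (by omega), C.re i hi]
    · simp only
      rw [Function.update_of_ne (by omega), Function.update_of_ne (by omega), C.im i hi]
    · cases ρ <;> simp [Side.code, Side.sign]
  · simp
  · simpa using (show 1 ≤ n from hn)
  · simp [C.var_eq_zero]
  · intro j h₁ h₂; simp at h₂; omega
  · exact C.mem_eq_zero _
  · intro j h₁ h₂; simp [C.var_eq_zero] at h₁ h₂; omega
  · exact ⟨fun _ => 0, fun j h₁ h₂ => by simp at h₂; omega, by simp⟩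

theorem HullInv.predTable {k : ℕ} (I : HullInv z n k σ) (h : ¬ hullTest.Holds σ) :
    PredTable z n σ.m := by
  have h' : ¬ σ.v 1 + 1 ≤ σ.v 0 := h
  rw [I.input.size] at h'
  exact ⟨fun j h₁ h₂ => I.pred j h₁ (by omega), I.pred_zero⟩

theorem TautPath.length_lt {φ : ℝ} {x : ℕ × Side} {l : List (ℕ × Side)} (h : TautPath z n φ x l)
    (hx : x.1 < n) : x.1 + l.length < n ∧ ∀ y ∈ l, y.1 < n := by
  induction h with
  | nil => simpa using hx
  | cons h₁ h₂ _ _ _ ih =>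
    obtain ⟨h₃, h₄⟩ := ih h₂
    exact ⟨by rw [List.length_cons]; omega, List.forall_mem_cons.mpr ⟨h₂, h₄⟩⟩

theorem length_hullList_le (pr : ℕ → ℕ) (i : ℕ) :
    (hullList pr i).length ≤ i ∧ ∀ j ∈ hullList pr i, j < i := by
  induction i using Nat.strong_induction_on with
  | _ i ih =>
    rw [hullList]
    split_ifs with h
    · obtain ⟨h₁, h₂⟩ := ih _ h.2
      exact ⟨by rw [List.length_cons]; omega,
        List.forall_mem_cons.mpr ⟨h.2, fun j hj => (h₂ j hj).trans h.2⟩⟩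
    · simp

theorem length_lowerList_lt (S : SeparatedSeq z n) (hn : 0 < n) {nl : ℕ → ℕ}
    (hnl : ∀ a, LowIndex z n a → a + 1 < n → NextLow z n a (nl a)) :
    (lowerList z n nl 0).length < n ∧ ∀ x ∈ lowerList z n nl 0, x.1 < n := by
  have := (tautPath_lowerList S hnl (φ := -π) lowIndex_zero
    (fun _ b hb => by linarith [(S.arg_mem hb.lt hb.lt_size).1, pi_pos])
    (fun h => by rw [lowSide_zero] at h; simp at h)).length_lt hn
  simpa using this

/-- The program computes the list of contacts in linear time. -/
theorem Coordinates.run_beltProgram (C : Coordinates z n σ) (S : SeparatedSeq z n) (hn : 0 < n)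
    {s : State} (hp : s.pc = 0) (hσ : Represents s σ) : ∃ pr nl : ℕ → ℕ,
    (∀ i, 0 < i → i < n → HullPred z (pr i) i) ∧
    (∀ a, LowIndex z n a → a + 1 < n → NextLow z n a (nl a)) ∧
    ∃ t ≤ (3 * hullLen + lowLen + 2 * pathLen + 2 * backLen + finishCmd.len) * n, ∃ s',
      HaltsIn beltProgram s t s' ∧ s'.natReg 0 = (beltList z n pr nl).length ∧
      Holds s'.natMem (beltList z n pr nl) := by
  obtain ⟨a₀, a₁, a₂, a₃, a₄, a₅⟩ := codeAt_beltProgram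
  obtain ⟨k₁, τ₁, i₁, e₁, r₁⟩ := runs_phase a₀ (HullInv z n) (fun _ _ _ => trivial)
    (fun k τ I h => I.step S h) (C.hullInv hn)
  have T₁ := i₁.predTable e₁
  obtain ⟨k₂, τ₂, i₂, e₂, r₂⟩ := runs_phase a₁ (LowInv z n) (fun _ _ _ => trivial)
    (fun k τ I h => I.step S h) (lowInv_start S hn i₁.input T₁)
  have hnl := fun a ha han => i₂.next_low e₂ (a := a) ha han
  have hL := length_lowerList_lt S hn hnl
  obtain ⟨k₃, τ₃, i₃, e₃, r₃⟩ := runs_phase a₂ (PathInv z n τ₂.m _) (fun _ _ _ => trivial)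
    (fun k τ I h => I.step S hnl (by rw [List.length_cons]; exact hL.1) h)
    (pathInv_start hn i₂.input fun j _ => rfl)
  obtain ⟨f₃, g₃⟩ := i₃.final e₃
  have hB : (beltList z n (fun j => τ₂.m (4 * n + j)) fun a => τ₂.m (5 * n + a)).length ≤
      2 * n := by
    have := (length_hullList_le (fun j => τ₂.m (4 * n + j)) (n - 1)).1
    rw [beltList, List.length_append, List.length_cons, List.length_map]
    have := hL.1
    omega
  obtain ⟨k₄, τ₄, i₄, e₄, r₄⟩ := runs_phase a₃ (BackInv z n τ₂.m _) (fun _ _ _ => trivial)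
    (fun k τ I h => I.step i₂.table hB h) (backInv_start hn i₂.table i₃.input i₃.mem f₃ g₃)
  obtain ⟨f₄, g₄⟩ := i₄.final e₄
  have r₅ := finishCmd.runs a₄ (σ := τ₄) trivial
  rw [zero_add, ← hullLen] at r₁
  rw [← lowLen] at r₂
  rw [← pathLen] at r₃
  rw [← backLen] at r₄
  obtain ⟨t, ht, s', h₁, h₂, h₃⟩ := ((((r₁.trans r₂).trans r₃).trans r₄).trans r₅) s hp hσ
  -- The predecessor and successor functions are read off the memory after the second phase; the
  -- later phases write only below `4 * n`.
  refine ⟨_, _, i₂.table.pred, hnl, t, ht.trans ?_, s', ⟨h₁, ?_⟩, ?_, ?_⟩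
  -- The loop bounds are `2 * n`, `n - 1`, `n` and `n`, each plus one for the final failing test; as
  -- `n ≥ 1`, this gives the coefficients `3, 1, 2, 2`.
  · have key : ∀ l, l ≤ l * n := fun l => Nat.le_mul_of_pos_right l hn
    have q₁ := key hullLen
    have q₃ := key pathLen
    have q₄ := key backLen
    have q₅ := key finishCmd.len
    have q₂ : (n - 1 + 1) * lowLen = lowLen * n := by rw [Nat.sub_add_cancel hn, mul_comm]
    change (2 * n + 1) * hullLen + (n - 1 + 1) * lowLen + (n + 1) * pathLen + (n + 1) * backLen +
      finishCmd.len ≤ _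
    rw [q₂]
    nlinarith
  · rw [h₂]; exact a₅.get
  · have := h₃.1 0
    rw [mul_zero] at this
    rw [this]
    simpa [finishCmd, Cmd.exec, NExp.eval, beltList] using f₄
  · rw [h₃.2.1]; exact g₄

end

/-- The program solves the problem. -/
theorem exists_windingBelt {n : ℕ} {c : Fin n → ℂ} (hn : 0 < n) (hd : DisjointDisks c)
    (hm : MonotonicallySeparated c) :
    ∃ (t : ℕ) (s : State) (B : List (Contact n)),
      t ≤ (3 * hullLen + lowLen + 2 * pathLen + 2 * backLen + finishCmd.len) * n ∧
      HaltsIn beltProgram (inputState c) t s ∧ HasOutput s B ∧ IsWindingBelt c B ∧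
      ∃ (γ : ℝ → ℂ) (T : ℝ), Traces c B γ T ∧ IsConveyorBelt c γ T := by
  -- Indices are taken modulo `n` only to obtain total functions on `ℕ`; below `n` nothing changes.
  set F : ℕ → Fin n := fun i => ⟨i % n, Nat.mod_lt i hn⟩ with hFdef
  set z : ℕ → ℂ := fun i => c (F i) with hz
  have hF : ∀ i, i < n → (F i : ℕ) = i := fun i hi => Nat.mod_eq_of_lt hi
  have hc : ∀ q : Fin n, c q = z q := fun q => congrArg c (Fin.ext (hF q q.2).symm)
  have S := separatedSeq_of_monotonicallySeparated hF hc hd hm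
  have C : Coordinates z n ⟨fun i => if i = 0 then n else 0, fun _ => 0,
      (inputState c).realMem⟩ := by
    refine ⟨rfl, fun i hi => if_neg hi.ne', fun _ => rfl, fun i hi => ?_, fun i hi => ?_⟩
    · have h₁ : (i + i) / 2 = i := by omega
      have h₂ : (i + i) % 2 = 0 := by omega
      simp only [inputState, h₁, h₂, hi, dif_pos, if_pos]
      rw [hc ⟨i, hi⟩]
    · have h₁ : (i + i + 1) / 2 = i := by omega
      have h₂ : (i + i + 1) % 2 = 1 := by omega
      simp only [inputState, h₁, h₂, hi, dif_pos]
      rw [hc ⟨i, hi⟩]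
      simp
  obtain ⟨pr, nl, hpr, hnl, t, ht, s, h₁, h₂, h₃⟩ := C.run_beltProgram S hn (s := inputState c)
    rfl ⟨fun i => by simp [inputState], rfl, rfl⟩
  refine ⟨t, s, finContacts F (beltList z n pr nl), ht, h₁, ⟨?_, fun j => ?_⟩,
    isWindingBelt_beltList S hF hc hn hpr hnl, exists_conveyorBelt_beltList S hF hc hn hpr hnl⟩
  · rw [h₂, finContacts, List.length_map]
  · have hj : (j : ℕ) < (beltList z n pr nl).length := by
      have := j.2; simpa only [finContacts, List.length_map] using this
    obtain ⟨h₄, h₅⟩ := h₃ j hj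
    have hlt : (beltList z n pr nl)[(j : ℕ)].1 < n := by
      have : ∀ x ∈ beltList z n pr nl, x.1 < n := by
        intro x hx
        rw [beltList, List.mem_append, List.mem_cons, List.mem_map] at hx
        rcases hx with (rfl | hx) | ⟨u, hu, rfl⟩
        · exact hn
        · exact (length_lowerList_lt S hn hnl).2 x hx
        · have := (length_hullList_le pr (n - 1)).2 u hu
          dsimp only; omega
      exact this _ (List.getElem_mem _)
    rw [h₄, h₅, List.get_eq_getElem]
    simp only [finContacts, List.getElem_map, hF _ hlt, and_self]

end
end ConveyorBelt

theorem mainTheorem2 :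
    ∃ (P : ConveyorBelt.Program) (C : ℕ),
      ∀ (n : ℕ) (c : Fin n → ℂ), 0 < n →
        ConveyorBelt.DisjointDisks c → ConveyorBelt.MonotonicallySeparated c →
          ∃ (t : ℕ) (s : ConveyorBelt.State) (B : List (ConveyorBelt.Contact n)),
            t ≤ C * n ∧
            ConveyorBelt.HaltsIn P (ConveyorBelt.inputState c) t s ∧
            ConveyorBelt.HasOutput s B ∧
            ConveyorBelt.IsWindingBelt c B ∧
            ∃ (γ : ℝ → ℂ) (T : ℝ),
              ConveyorBelt.Traces c B γ T ∧ ConveyorBelt.IsConveyorBelt c γ T :=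
  ⟨_, _, fun _ _ hn hd hm => ConveyorBelt.exists_windingBelt hn hd hm⟩
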